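/- Let $M$ be a smooth manifold (finite-dimensional, Hausdorff, $\sigma$-compact, without boundary). \emph{Strong KT manifolds.} A strong KT structure on $M$ is a pair $(g,I)$ of a Riemannian metric and an integrable complex structure $I$ (the $+i$-eigenbundle $T^{1,0}M$ of $I$ is closed under the Lie bracket) with $g(IX,IY)=g(X,Y)$ and $dd^c\omega=0$, where $\omega(X,Y)=g(IX,Y)$ and $d^c=-i(\partial-\bar\partial)$. \emph{Courant algebroids.} A Courant algebroid over $M$ is a vector bundle $\mathcal E\to M$ with a fibrewise nondegenerate symmetric pairing $\langle\cdot,\cdot\rangle$, an $\mathbb R$-bilinear bracket $[\![\cdot,\cdot]\!]$ on $\Gamma(\mathcal E)$ and a bundle map $\pi:\mathcal E\to TM$ such that for $e_1,e_2,e_3\in\Gamma(\mathcal E)$ and $f\in C^\infty(M)$: $[\![e_1,[\![e_2,e_3]\!]]\!]=[\![[\![e_1,e_2]\!],e_3]\!]+[\![e_2,[\![e_1,e_3]\!]]\!]$; $\pi[\![e_1,e_2]\!]=[\pi e_1,\pi e_2]$; $[\![e_1,fe_2]\!]=f[\![e_1,e_2]\!]+(\pi(e_1)f)e_2$; $\pi(e_1)\langle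 e_2,e_3\rangle=\langle[\![e_1,e_2]\!],e_3\rangle+\langle e_2,[\![e_1,e_3]\!]\rangle$; $[\![e_1,e_1]\!]=\tfrac12\pi^*d\langle e_1,e_1\rangle$, where $\pi^*:T^*M\to\mathcal E$ is defined by $\langle\pi^*\xi,e\rangle=\xi(\pi e)$. It is exact if $0\to T^*M\xrightarrow{\pi^*}\mathcal E\xrightarrow{\pi}TM\to0$ is exact. An isotropic splitting is a bundle map $\nabla:TM\to\mathcal E$ with $\pi\nabla=\mathrm{id}$ and isotropic image; its curvature is the closed 3-form $H(X,Y,Z)=2\langle[\![\nabla X,\nabla Y]\!],\nabla Z\rangle$, i.e. the 3-form $H$ for which $\nabla+\tfrac12\pi^*:TM\oplus T^*M\to\mathcal E$ carries the bracket $[X,Y]+\mathcal L_X\eta-i_Yd\xi+i_Yi_XH$ of $X+\xi$ and $Y+\eta$ to that of $\mathcal E$. Isotropic splittings exist, and the class $[H]\in H^3(M,\mathbb R)$, which does not depend on the splitting, is the characteristic class of $\mathcal E$. \emph{Strong KT structures on Courant algebroids.} A generalized metric on an exact Courant algebroid $\mathcal E$ is a smooth orthogonal self-adjoint bundle endomorphism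 $\mathcal G$ with $\langle\mathcal Ge,e\rangle>0$ for $e\neq0$; let $V_+$ be its $+1$-eigenbundle. A strong KT structure on $\mathcal E$ is a generalized metric $\mathcal G$ together with a complex structure $\mathcal I$ on $V_+$ that is orthogonal for the pairing and whose $+i$-eigenbundle in $V_+\otimes\mathbb C$ is closed under the complexified bracket. The metric and complex structure $(g,I)$ on $M$ induced by $(\mathcal G,\mathcal I)$ are those determined by $g(\pi e,\pi e')=\langle e,e'\rangle$ and $I\pi e=\pi\mathcal Ie$ for $e,e'\in V_+$. The following hold. 1. Given a strong KT structure $(\mathcal G,\mathcal I)$ on an exact Courant algebroid $\mathcal E$ over $M$ with characteristic class $[H]$, the induced pair $(g,I)$ exists, is unique, and is a strong KT structure on $M$, and $[d^c\omega]=-[H]$. 2. Conversely, let $(g,I)$ be a strong KT structure on $M$. There is an exact Courant algebroid over $M$, on the bundle $TM\oplus T^*M$, with characteristic class $[-d^c\omega]$, and every exact Courant algebroid over $M$ with this characteristic class admits a strong KT structure that induces $(g,I)$. -/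

import Mathlib

open Bundle Manifold ContDiff
open scoped Bundle Manifold ContDiff

noncomputable section

namespace SKT

section Manifold

variable (E : Type*) [NormedAddCommGroup E] [NormedSpace ℝ E]
  (M : Type*) [TopologicalSpace M] [ChartedSpace E M]

/-- The tangent space of the (boundaryless) manifold `M` modelled on `E`. -/
abbrev T (x : M) : Type _ := TangentSpace 𝓘(ℝ, E) x

/-- Smooth vector fields on `M`. -/
abbrev VField [IsManifold 𝓘(ℝ, E) ∞ M] : Type _ := Cₛ^∞⟮𝓘(ℝ, E); E, (T E M)⟯

/-- Fields of alternating `k`-forms on `M` with values in `𝕜` (`ℝ` or `ℂ`), not necessarily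
smooth. -/
abbrev FormField (𝕜 : Type*) [NormedAddCommGroup 𝕜] [NormedSpace ℝ 𝕜] (k : ℕ) : Type _ :=
  ∀ x : M, (T E M x) [⋀^Fin k]→L[ℝ] 𝕜

end Manifold

section Forms

variable {E : Type*} [NormedAddCommGroup E] [NormedSpace ℝ E]
  {M : Type*} [TopologicalSpace M] [ChartedSpace E M]
  {𝕜 : Type*} [NormedAddCommGroup 𝕜] [NormedSpace ℝ 𝕜] {k : ℕ}

/-- A form is smooth if its value on smooth vector fields is a smooth function. -/
def IsSmoothForm [IsManifold 𝓘(ℝ, E) ∞ M] (α : FormField E M 𝕜 k) : Prop :=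
  ∀ X : Fin k → VField E M,
    ContMDiff 𝓘(ℝ, E) 𝓘(ℝ, 𝕜) ∞ (fun x => α x (fun i => X i x))

/-- The form `α` read in the preferred chart around `x₀`, i.e. pulled back by the inverse chart. -/
def chartForm (α : FormField E M 𝕜 k) (x₀ : M) (y : E) : E [⋀^Fin k]→L[ℝ] 𝕜 :=
  (α ((extChartAt 𝓘(ℝ, E) x₀).symm y)).compContinuousLinearMap
    (mfderiv 𝓘(ℝ, E) 𝓘(ℝ, E) (extChartAt 𝓘(ℝ, E) x₀).symm y)

/-- The exterior derivative on the manifold: at `x₀`, the exterior derivative of the form read in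
the chart around `x₀`, pulled back by that chart. -/
def d (α : FormField E M 𝕜 k) : FormField E M 𝕜 (k + 1) := fun x₀ =>
  (extDeriv (chartForm α x₀) (extChartAt 𝓘(ℝ, E) x₀ x₀)).compContinuousLinearMap
    (mfderiv 𝓘(ℝ, E) 𝓘(ℝ, E) (extChartAt 𝓘(ℝ, E) x₀) x₀)

/-- `α` and `β` are closed smooth real `(k+1)`-forms with the same de Rham cohomology class. -/
def SameClass [IsManifold 𝓘(ℝ, E) ∞ M] (α β : FormField E M ℝ (k + 1)) : Prop :=
  IsSmoothForm α ∧ IsSmoothForm β ∧ d α = 0 ∧ d β = 0 ∧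
    ∃ γ : FormField E M ℝ k, IsSmoothForm γ ∧ α - β = d γ

/-- A real form seen as a complex valued one. -/
def toComplex (α : FormField E M ℝ k) : FormField E M ℂ k := fun x =>
  Complex.ofRealCLM.compContinuousAlternatingMap (α x)

/-- The real part of a complex valued form. -/
def rePart (α : FormField E M ℂ k) : FormField E M ℝ k := fun x =>
  Complex.reCLM.compContinuousAlternatingMap (α x)

/-- Fields of endomorphisms of the tangent spaces. -/
abbrev EndField (E : Type*) [NormedAddCommGroup E] [NormedSpace ℝ E]
    (M : Type*) [TopologicalSpace M] [ChartedSpace E M] : Type _ :=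
  ∀ x : M, (T E M x) →L[ℝ] (T E M x)

/-- For a complex valued form `α` and an almost complex structure `J`, the real multilinear map
`(v₀, …, v_{k-1}) ↦ α(v₀^{1,0}, …, v_{p-1}^{1,0}, v_p^{0,1}, …, v_{k-1}^{0,1})`, where `α` is
extended complex multilinearly to `T ⊗ ℂ`, `v^{1,0} = (v - i J v) / 2` and
`v^{0,1} = (v + i J v) / 2`. The sum runs over the sets `S` of slots in which the summand
`∓ i J v` is chosen. -/
def evalType (J : EndField E M) (p : ℕ) (α : FormField E M ℂ k) (x : M) :
    ContinuousMultilinearMap ℝ (fun _ : Fin k => T E M x) ℂ :=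
  ∑ S : Finset (Fin k),
    ((1 / 2 : ℂ) ^ k * ∏ j ∈ S, (if (j : ℕ) < p then -Complex.I else Complex.I)) •
      (α x).toContinuousMultilinearMap.compContinuousLinearMap
        (fun j => if j ∈ S then J x else ContinuousLinearMap.id ℝ (T E M x))

/-- The component of type `(p, k - p)` of a complex valued `k`-form, `0 ≤ p ≤ k`: the sum, over all
the ways to select `p` of the `k` arguments, of the value of `α` on the `(1,0)`-parts of the
selected arguments and the `(0,1)`-parts of the others. (In the alternatization every selection
occurs `p! (k - p)!` times.) -/
def typePart (J : EndField E M) (p : Fin (k + 1)) (α : FormField E M ℂ k) :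
    FormField E M ℂ k := fun x =>
  (((p : ℕ).factorial * (k - (p : ℕ)).factorial : ℂ)⁻¹) •
    ContinuousMultilinearMap.alternatization (evalType J p α x)

/-- `∂`, the sum over `p + q = k` of the `(p+1,q)`-part of `d` of the `(p,q)`-part. -/
def del (J : EndField E M) (α : FormField E M ℂ k) : FormField E M ℂ (k + 1) :=
  ∑ p : Fin (k + 1), typePart J p.succ (d (typePart J p α))

/-- `∂̄`, the sum over `p + q = k` of the `(p,q+1)`-part of `d` of the `(p,q)`-part. -/
def delbar (J : EndField E M) (α : FormField E M ℂ k) : FormField E M ℂ (k + 1) :=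
  ∑ p : Fin (k + 1), typePart J p.castSucc (d (typePart J p α))

/-- The operator `d^c = -i (∂ - ∂̄)` on real forms. It is a real operator, so that taking the real
part only changes the type of the values from `ℂ` to `ℝ`. -/
def dc (J : EndField E M) (α : FormField E M ℝ k) : FormField E M ℝ (k + 1) :=
  rePart ((-Complex.I) • (del J (toComplex α) - delbar J (toComplex α)))

end Forms

section StrongKTManifold

variable (E : Type*) [NormedAddCommGroup E] [NormedSpace ℝ E]
  (M : Type*) [TopologicalSpace M] [ChartedSpace E M] [IsManifold 𝓘(ℝ, E) ∞ M]

variable {E M} in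
/-- The complex vector field `A + i B` is a section of the `+i`-eigenbundle `T^{1,0}` of `J`:
`J A + i J B = i (A + i B)`. -/
def IsHolField (J : EndField E M) (A B : ∀ x, T E M x) : Prop :=
  ∀ x, J x (A x) = - B x ∧ J x (B x) = A x

/-- A Hermitian structure: a Riemannian metric `g` and an orthogonal integrable complex structure
`J`. Integrability is involutivity of `T^{1,0}`: the Lie bracket
`[A + i B, A' + i B'] = ([A, A'] - [B, B']) + i ([A, B'] + [B, A'])` of sections of `T^{1,0}` is a
section of `T^{1,0}`. -/
structure HermitianStructure where
  g : ContMDiffRiemannianMetric 𝓘(ℝ, E) ∞ E (T E M)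
  J : EndField E M
  smooth_J : ∀ X : VField E M,
    ContMDiff 𝓘(ℝ, E) (𝓘(ℝ, E).prod 𝓘(ℝ, E)) ∞ (fun x => TotalSpace.mk' E x (J x (X x)))
  J_sq : ∀ x (v : T E M x), J x (J x v) = - v
  integrable : ∀ A B A' B' : VField E M, IsHolField J A B → IsHolField J A' B' →
    IsHolField J
      (fun x => VectorField.mlieBracket 𝓘(ℝ, E) A A' x - VectorField.mlieBracket 𝓘(ℝ, E) B B' x)
      (fun x => VectorField.mlieBracket 𝓘(ℝ, E) A B' x + VectorField.mlieBracket 𝓘(ℝ, E) B A' x)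
  hermitian : ∀ x (v w : T E M x), g.inner x (J x v) (J x w) = g.inner x v w

variable {E M}

theorem HermitianStructure.inner_J_self (S : HermitianStructure E M) (x : M) (v : T E M x) :
    S.g.inner x (S.J x v) v = 0 := by
  have h := S.hermitian x (S.J x v) v
  rw [S.J_sq] at h
  have h2 := S.g.symm x v (S.J x v)
  simp only [map_neg, _root_.neg_apply] at h
  linarith

/-- The Hermitian form `ω(X, Y) = g(J X, Y)`. -/
def HermitianStructure.omega (S : HermitianStructure E M) : FormField E M ℝ 2 := fun x =>
  { toFun := fun v => S.g.inner x (S.J x (v 0)) (v 1)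
    map_update_add' := by
      intro _ m i a b
      fin_cases i <;> simp [Function.update]
    map_update_smul' := by
      intro _ m i c a
      fin_cases i <;> simp [Function.update]
    cont := by fun_prop
    map_eq_zero_of_eq' := by
      intro v i j h hij
      have h01 : v 0 = v 1 := by
        fin_cases i <;> fin_cases j <;> simp_all
      simpa [h01] using S.inner_J_self x (v 1) }

variable (E M) in
/-- A strong KT structure on the manifold `M`: a Hermitian structure with `d d^c ω = 0`. -/
structure StrongKT extends HermitianStructure E M where
  closed : d (dc J toHermitianStructure.omega) = 0

end StrongKTManifold

section Courant

variable (E : Type*) [NormedAddCommGroup E] [NormedSpace ℝ E]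
  {M : Type*} [TopologicalSpace M] [ChartedSpace E M] [IsManifold 𝓘(ℝ, E) ∞ M]
  (F : Type*) [NormedAddCommGroup F] [NormedSpace ℝ F]
  (V : M → Type*) [TopologicalSpace (TotalSpace F V)]
  [∀ x, AddCommGroup (V x)] [∀ x, Module ℝ (V x)] [∀ x, TopologicalSpace (V x)]
  [FiberBundle F V] [VectorBundle ℝ F V]

/-- Smooth sections of a vector bundle. -/
abbrev Sec : Type _ := Cₛ^∞⟮𝓘(ℝ, E); F, V⟯

variable {E F V} in
/-- The product of a smooth function and a smooth section. -/
def fsmul (f : C^∞⟮𝓘(ℝ, E), M; ℝ⟯) (s : Sec E F V) : Sec E F V :=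
  ⟨fun x => f x • s x, f.contMDiff.smul_section s.contMDiff⟩

/-- The differential of a real function, as a covector. -/
def dfun {E : Type*} [NormedAddCommGroup E] [NormedSpace ℝ E]
    {M : Type*} [TopologicalSpace M] [ChartedSpace E M] (f : M → ℝ) (x : M) :
    T E M x →L[ℝ] ℝ :=
  mfderiv 𝓘(ℝ, E) 𝓘(ℝ, ℝ) f x

/-- A Courant algebroid structure on the vector bundle `V` over `M`: a smooth fibrewise
nondegenerate symmetric pairing, a bracket on the smooth sections and a smooth anchor `π`. The map
`coanchor` is the dual `π* : T*M → V` of the anchor under the identification `V = V*` given by the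
pairing; it is determined by `pairing_coanchor`. -/
structure CourantAlgebroid where
  pairing : ∀ x, V x →ₗ[ℝ] V x →ₗ[ℝ] ℝ
  anchor : ∀ x, V x →ₗ[ℝ] T E M x
  coanchor : ∀ x, (T E M x →L[ℝ] ℝ) →ₗ[ℝ] V x
  bracket : Sec E F V →ₗ[ℝ] Sec E F V →ₗ[ℝ] Sec E F V
  smooth_pairing : ∀ s t : Sec E F V,
    ContMDiff 𝓘(ℝ, E) 𝓘(ℝ, ℝ) ∞ (fun x => pairing x (s x) (t x))
  smooth_anchor : ∀ s : Sec E F V,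
    ContMDiff 𝓘(ℝ, E) (𝓘(ℝ, E).prod 𝓘(ℝ, E)) ∞ (fun x => TotalSpace.mk' E x (anchor x (s x)))
  symm : ∀ x e e', pairing x e e' = pairing x e' e
  nondegenerate : ∀ x e, (∀ e', pairing x e e' = 0) → e = 0
  pairing_coanchor : ∀ x ξ e, pairing x (coanchor x ξ) e = ξ (anchor x e)
  jacobi : ∀ e₁ e₂ e₃, bracket e₁ (bracket e₂ e₃) =
    bracket (bracket e₁ e₂) e₃ + bracket e₂ (bracket e₁ e₃)
  anchor_bracket : ∀ e₁ e₂ x, anchor x (bracket e₁ e₂ x) =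
    VectorField.mlieBracket 𝓘(ℝ, E) (fun y => anchor y (e₁ y)) (fun y => anchor y (e₂ y)) x
  leibniz : ∀ e₁ e₂ (f : C^∞⟮𝓘(ℝ, E), M; ℝ⟯) x, bracket e₁ (fsmul f e₂) x =
    f x • bracket e₁ e₂ x + dfun f x (anchor x (e₁ x)) • e₂ x
  invariance : ∀ (e₁ e₂ e₃ : Sec E F V) x,
    dfun (fun y => pairing y (e₂ y) (e₃ y)) x (anchor x (e₁ x)) =
      pairing x (bracket e₁ e₂ x) (e₃ x) + pairing x (e₂ x) (bracket e₁ e₃ x)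
  bracket_self : ∀ (e : Sec E F V) x, bracket e e x =
    (1 / 2 : ℝ) • coanchor x (dfun (fun y => pairing y (e y) (e y)) x)

variable {E F V}

namespace CourantAlgebroid

variable (A : CourantAlgebroid E F V)

/-- Exactness of `0 → T*M → V → TM → 0`, with maps `π*` and `π`. -/
def IsExact : Prop :=
  ∀ x, Function.Injective (A.coanchor x) ∧ Function.Surjective (A.anchor x) ∧
    ∀ e, A.anchor x e = 0 ↔ e ∈ LinearMap.range (A.coanchor x)

/-- A smooth isotropic splitting `∇ : TM → V` of the anchor. -/
structure IsotropicSplitting where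
  nab : ∀ x, T E M x →ₗ[ℝ] V x
  smooth_nab : ∀ X : VField E M,
    ContMDiff 𝓘(ℝ, E) (𝓘(ℝ, E).prod 𝓘(ℝ, F)) ∞ (fun x => TotalSpace.mk' F x (nab x (X x)))
  anchor_nab : ∀ x v, A.anchor x (nab x v) = v
  isotropic : ∀ x v w, A.pairing x (nab x v) (nab x w) = 0

variable {A}

/-- The section `∇ X`. -/
def IsotropicSplitting.lift (N : A.IsotropicSplitting) (X : VField E M) : Sec E F V :=
  ⟨fun x => N.nab x (X x), N.smooth_nab X⟩

/-- `H` is the curvature 3-form of the splitting: `H(X, Y, Z) = 2 ⟨[∇X, ∇Y], ∇Z⟩`. With this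
normalization `∇ + (1/2) π* : TM ⊕ T*M → V` carries the pairing `(η(X) + ξ(Y)) / 2` to the pairing
of `V` and the bracket `[X, Y] + L_X η - i_Y dξ + i_Y i_X H` to the bracket of `V`. -/
def IsotropicSplitting.IsCurvature (N : A.IsotropicSplitting) (H : FormField E M ℝ 3) : Prop :=
  ∀ (X Y Z : VField E M) x,
    H x ![X x, Y x, Z x] = 2 * A.pairing x (A.bracket (N.lift X) (N.lift Y) x) (N.nab x (Z x))

variable (A)

/-- The characteristic class of `A` is the de Rham class of the 3-form `η`: isotropic splittings
exist, and the curvature of each of them is a closed 3-form with the class of `η`. -/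
def HasCharacteristicClass (η : FormField E M ℝ 3) : Prop :=
  Nonempty A.IsotropicSplitting ∧
    ∀ N : A.IsotropicSplitting, ∃ H : FormField E M ℝ 3, N.IsCurvature H ∧ SameClass H η

/-- A generalized metric: a smooth orthogonal self-adjoint operator `G` with `⟨G e, e⟩ > 0` for
`e ≠ 0`. -/
structure GeneralizedMetric where
  G : ∀ x, V x →ₗ[ℝ] V x
  smooth_G : ∀ s : Sec E F V,
    ContMDiff 𝓘(ℝ, E) (𝓘(ℝ, E).prod 𝓘(ℝ, F)) ∞ (fun x => TotalSpace.mk' F x (G x (s x)))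
  orthogonal : ∀ x e e', A.pairing x (G x e) (G x e') = A.pairing x e e'
  selfAdjoint : ∀ x e e', A.pairing x (G x e) e' = A.pairing x e (G x e')
  pos : ∀ x e, e ≠ 0 → 0 < A.pairing x (G x e) e

variable {A} in
/-- The `+1`-eigenspace `V₊` of `G` at `x`. -/
def GeneralizedMetric.Vplus (K : A.GeneralizedMetric) (x : M) : Submodule ℝ (V x) :=
  LinearMap.ker (K.G x - LinearMap.id)

variable {A} in
/-- The complexified section `a + i b` is a section of the `+i`-eigenbundle, inside `V₊ ⊗ ℂ`, of the
endomorphism `J` of `V₊`. -/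
def GeneralizedMetric.IsEigenSection (K : A.GeneralizedMetric)
    (J : ∀ x, K.Vplus x →ₗ[ℝ] K.Vplus x) (a b : Sec E F V) : Prop :=
  ∀ x, ∃ (ha : a x ∈ K.Vplus x) (hb : b x ∈ K.Vplus x),
    J x ⟨a x, ha⟩ = - ⟨b x, hb⟩ ∧ J x ⟨b x, hb⟩ = ⟨a x, ha⟩

/-- A strong KT structure on `A`: a generalized metric together with a smooth complex structure `J`
on its `+1`-eigenbundle, orthogonal for the pairing, whose `+i`-eigenbundle is closed under the
complex bilinear extension
`[a + i b, a' + i b'] = ([a, a'] - [b, b']) + i ([a, b'] + [b, a'])` of the bracket. -/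
structure StrongKT extends A.GeneralizedMetric where
  J : ∀ x, toGeneralizedMetric.Vplus x →ₗ[ℝ] toGeneralizedMetric.Vplus x
  smooth_J : ∀ (s : Sec E F V) (hs : ∀ x, s x ∈ toGeneralizedMetric.Vplus x),
    ContMDiff 𝓘(ℝ, E) (𝓘(ℝ, E).prod 𝓘(ℝ, F)) ∞
      (fun x => TotalSpace.mk' F x (J x ⟨s x, hs x⟩ : V x))
  J_sq : ∀ x e, J x (J x e) = - e
  orthogonal_J : ∀ x (e e' : toGeneralizedMetric.Vplus x),
    A.pairing x (J x e) (J x e') = A.pairing x e e'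
  involutive : ∀ a b a' b' : Sec E F V,
    toGeneralizedMetric.IsEigenSection J a b → toGeneralizedMetric.IsEigenSection J a' b' →
      toGeneralizedMetric.IsEigenSection J (A.bracket a a' - A.bracket b b')
        (A.bracket a b' + A.bracket b a')

variable {A} in
/-- `(g, J)` on `M` is the pair induced by the strong KT structure `K` on `A` through the
projection `π : V₊ → TM`. -/
def StrongKT.Induces (K : A.StrongKT) (S : SKT.StrongKT E M) : Prop :=
  ∀ x, (∀ e e' : K.Vplus x,
      S.g.inner x (A.anchor x e) (A.anchor x e') = A.pairing x (e : V x) (e' : V x)) ∧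
    ∀ e : K.Vplus x, S.J x (A.anchor x e) = A.anchor x (K.J x e)

end CourantAlgebroid

end Courant

section Standard

variable (E : Type*) [NormedAddCommGroup E] [NormedSpace ℝ E]
  (M : Type*) [TopologicalSpace M] [ChartedSpace E M]

/-- The cotangent bundle of `M`. -/
abbrev Tstar (x : M) : Type _ := T E M x →L[ℝ] Trivial M ℝ x

/-- The bundle `TM ⊕ T*M`. -/
abbrev TTstar : M → Type _ := (T E M) ×ᵇ (Tstar E M)

end Standard

end SKT

end

/-! The kernel of the anchor of an exact Courant algebroid is the isotropic subspace π*T*M.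
Positivity of ⟨Ge, e⟩ makes V₊ meet it trivially, so the anchor identifies V₊ with TM; let s be the
inverse. The subspace G(π*T*M) is the image of an isotropic splitting ∇, and V₊ is the graph of a
metric g over it: ⟨sX, ∇Y⟩ = ½ g(X, Y). `MetricLift` isolates these data, so that both directions of
the theorem rest on one computation.

Let H be the curvature of ∇ and D the Levi-Civita connection of g. The Courant axioms give 2⟨[sX,
sY], sZ⟩ − 2g([X, Y], Z) = H(X, Y, Z) + 2g(D_Z X, Y). This is `pairing_bracket_lift`, where the last
term occurs as its Koszul expression `koszul` and no connection is constructed. A vector e lies in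
V₊ exactly when ⟨e, sZ⟩ = g(πe, Z) for all Z. On the Hermitian side, vanishing of the Nijenhuis
tensor and d^cω = −dω(J·, J·, J·) show that passing from (X, Y) to (JX, JY) changes the Koszul term
by the same amount as d^cω (`koszul_sub_koszul`). Hence [sX, sY] − [sJX, sJY], the real part of the
bracket of sX − i sJX and sY − i sJY, lies in V₊ if and only if H + d^cω is unchanged by J on its
first two arguments (`bracket_sub_bracket_mem_iff`). An alternating 3-form with this property for
all arguments vanishes: it kills any two vectors of the same type, and among three vectors of type
(1,0) or (0,1) two have the same type. So involutivity of the +i-eigenbundle means integrability of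
J together with the equality of forms H = −d^cω.

Given a structure on the algebroid, involutivity therefore determines H. The Jacobi identity makes
the curvature closed, which is dd^cω = 0. Conversely, changing an isotropic splitting by a 2-form B
changes its curvature by 2dB, so an algebroid with class [−d^cω] has a splitting with curvature
exactly −d^cω, and the graph of g over it is the required V₊. Such an algebroid exists because −d^cω
is closed: twist the standard bracket on TM ⊕ T*M by it. -/

noncomputable section

set_option linter.unusedSectionVars false

namespace SKT

open Module Filter Topology

/-! ### Smoothness criteria for sections of vector bundles. -/

section SectionCriteria

variable {E : Type*} [NormedAddCommGroup E] [NormedSpace ℝ E] [FiniteDimensional ℝ E]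
  {M : Type*} [TopologicalSpace M] [ChartedSpace E M] [IsManifold 𝓘(ℝ, E) ∞ M] [T2Space M]
  {F : Type*} [NormedAddCommGroup F] [NormedSpace ℝ F]
  {V : M → Type*} [TopologicalSpace (TotalSpace F V)]
  [∀ x, AddCommGroup (V x)] [∀ x, Module ℝ (V x)] [∀ x, TopologicalSpace (V x)]
  [FiberBundle F V] [VectorBundle ℝ F V]

/-- A smooth bump function at `x`, equal to one near `x` and supported in a neighbourhood `u`. -/
theorem exists_bump (x : M) {u : Set M} (hu : u ∈ 𝓝 x) :
    ∃ f : SmoothBumpFunction 𝓘(ℝ, E) x, tsupport f ⊆ u := by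
  obtain ⟨f, -, hf⟩ := (SmoothBumpFunction.nhds_basis_tsupport (I := 𝓘(ℝ, E)) x).mem_iff.1 hu
  exact ⟨f, hf⟩

/-- A local smooth section extends, after shrinking its domain, to a global smooth section. -/
theorem exists_sec_eventuallyEq {σ : ∀ x, V x} {u : Set M} (hu : IsOpen u) {x : M} (hx : x ∈ u)
    (hσ : ContMDiffOn 𝓘(ℝ, E) (𝓘(ℝ, E).prod 𝓘(ℝ, F)) ∞ (fun y => TotalSpace.mk' F y (σ y)) u) :
    ∃ s : Sec E F V, ∀ᶠ y in 𝓝 x, s y = σ y := by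
  obtain ⟨f, hf⟩ := exists_bump (E := E) x (hu.mem_nhds hx)
  refine ⟨⟨fun y => f y • σ y, ContMDiffOn.smul_section_of_tsupport
    (f.contMDiff.contMDiffOn) hu hf hσ⟩, ?_⟩
  filter_upwards [f.eventuallyEq_one] with y hy
  change f y • σ y = σ y
  rw [hy]
  simp

variable [FiniteDimensional ℝ F] [ContMDiffVectorBundle ∞ F V 𝓘(ℝ, E)]

/-- Global smooth sections that agree with the frame of a trivialization near a point. -/
theorem exists_sec_localFrame (x : M) {ι : Type*} (b : Basis ι ℝ F) (i : ι) :
    ∃ s : Sec E F V, ∀ᶠ y in 𝓝 x, s y = (trivializationAt F V x).localFrame b i y :=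
  exists_sec_eventuallyEq (trivializationAt F V x).open_baseSet
    (FiberBundle.mem_baseSet_trivializationAt F V x)
    ((trivializationAt F V x).contMDiffOn_localFrame_baseSet ∞ b i)

/-- Every vector in a fibre is the value of a global smooth section. -/
theorem exists_sec_apply_eq (x : M) (v : V x) : ∃ s : Sec E F V, s x = v := by
  let b := Basis.ofVectorSpace ℝ F
  let t := trivializationAt F V x
  have hx : x ∈ t.baseSet := FiberBundle.mem_baseSet_trivializationAt F V x
  choose s hs using fun i => exists_sec_localFrame (E := E) (V := V) x b i
  refine ⟨∑ i, (t.basisAt b hx).repr v i • s i, ?_⟩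
  rw [← ContMDiffSection.coeAddHom_apply, map_sum, Finset.sum_apply]
  conv_rhs => rw [← (t.basisAt b hx).sum_repr v]
  refine Finset.sum_congr rfl fun i _ => ?_
  change (t.basisAt b hx).repr v i • s i x = _
  rw [(hs i).self_of_nhds, t.localFrame_apply_of_mem_baseSet b hx]

/-- A section is smooth at `x` if its composites with enough functionals, smooth on smooth sections,
are smooth at `x`. -/
theorem contMDiffAt_section_of_functionals (e : ∀ x, V x) (x : M)
    (h : ∀ v : V x, v ≠ 0 → ∃ l : ∀ y, V y →ₗ[ℝ] ℝ,
      (∀ s : Sec E F V, ContMDiffAt 𝓘(ℝ, E) 𝓘(ℝ, ℝ) ∞ (fun y => l y (s y)) x) ∧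
      ContMDiffAt 𝓘(ℝ, E) 𝓘(ℝ, ℝ) ∞ (fun y => l y (e y)) x ∧ l x v ≠ 0) :
    ContMDiffAt 𝓘(ℝ, E) (𝓘(ℝ, E).prod 𝓘(ℝ, F)) ∞ (fun y => TotalSpace.mk' F y (e y)) x := by
  classical
  let b := Basis.ofVectorSpace ℝ F
  let t := trivializationAt F V x
  have hx : x ∈ t.baseSet := FiberBundle.mem_baseSet_trivializationAt F V x
  choose s hs using fun i => exists_sec_localFrame (E := E) (V := V) x b i
  have : ContMDiffVectorBundle 1 F V 𝓘(ℝ, E) := ContMDiffVectorBundle.of_le (n := ∞) (by norm_cast)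
  refine (contMDiffAt_iff_localFrameCoeff (I := 𝓘(ℝ, E)) (e := t) b hx).2 fun i₀ => ?_
  -- The admissible functionals form a linear space. Its values at `x` separate points of the fibre
  -- by hypothesis, hence fill the dual in finite dimension, and the dual basis of the frame can be
  -- realized at `x`.
  let L : Submodule ℝ (∀ y, V y →ₗ[ℝ] ℝ) :=
    { carrier := {l | (∀ s : Sec E F V,
        ContMDiffAt 𝓘(ℝ, E) 𝓘(ℝ, ℝ) ∞ (fun y => l y (s y)) x) ∧
        ContMDiffAt 𝓘(ℝ, E) 𝓘(ℝ, ℝ) ∞ (fun y => l y (e y)) x}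
      add_mem' := fun ha hb => ⟨fun s => (ha.1 s).add (hb.1 s), ha.2.add hb.2⟩
      zero_mem' := ⟨fun s => contMDiffAt_const, contMDiffAt_const⟩
      smul_mem' := fun c l hl => ⟨fun s => contMDiffAt_const.mul (hl.1 s), contMDiffAt_const.mul hl.2⟩ }
  let ev : L →ₗ[ℝ] Dual ℝ (V x) := (LinearMap.proj x).comp L.subtype
  have hfin : FiniteDimensional ℝ (V x) := VectorBundle.finiteDimensional ℝ F V x
  have hev : LinearMap.range ev = ⊤ := by
    rw [← Subspace.dualCoannihilator_dualAnnihilator_eq (W := LinearMap.range ev)]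
    have : (LinearMap.range ev).dualCoannihilator = ⊥ := by
      rw [eq_bot_iff]
      intro v hv
      by_contra hv0
      obtain ⟨l, h1, h2, h3⟩ := h v hv0
      exact h3 ((Submodule.mem_dualCoannihilator _).1 hv _ ⟨⟨l, h1, h2⟩, rfl⟩)
    rw [this, Submodule.dualAnnihilator_bot]
  choose l hl using fun i => (LinearMap.range_eq_top.1 hev) ((t.basisAt b hx).coord i)
  -- The coefficients `c` of `e` in the frame solve the linear system `A c = r` with smooth data.
  -- Since `A x = 1`, the matrix is invertible near `x`, and Cramer's rule exhibits `c` as smooth.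
  let A : M → Matrix _ _ ℝ := fun y => Matrix.of fun i j => (l i).1 y (s j y)
  let c : M → _ → ℝ := fun y i => t.localFrameCoeff 𝓘(ℝ, E) b i y (e y)
  let r : M → _ → ℝ := fun y i => (l i).1 y (e y)
  have hA : ∀ i j, ContMDiffAt 𝓘(ℝ, E) 𝓘(ℝ, ℝ) ∞ (fun y => A y i j) x :=
    fun i j => (l i).2.1 (s j)
  have hr : ∀ i, ContMDiffAt 𝓘(ℝ, E) 𝓘(ℝ, ℝ) ∞ (fun y => r y i) x := fun i => (l i).2.2
  have hdet : ContMDiffAt 𝓘(ℝ, E) 𝓘(ℝ, ℝ) ∞ (fun y => (A y).det) x := by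
    simp only [Matrix.det_apply']
    exact ContMDiffAt.sum fun σ _ => contMDiffAt_const.mul (contMDiffAt_finsetProd fun i _ => hA _ _)
  have hadj : ∀ i j, ContMDiffAt 𝓘(ℝ, E) 𝓘(ℝ, ℝ) ∞ (fun y => (A y).adjugate i j) x := by
    intro i j
    simp only [Matrix.adjugate_apply, Matrix.det_apply']
    refine ContMDiffAt.sum fun σ _ => contMDiffAt_const.mul (contMDiffAt_finsetProd fun k _ => ?_)
    by_cases hk : σ k = j
    · simp only [hk, Matrix.updateRow_self]; exact contMDiffAt_const
    · simp only [Matrix.updateRow_ne hk]; exact hA _ _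
  have hA1 : A x = 1 := by
    ext i j
    have : (l i).1 x = (t.basisAt b hx).coord i := hl i
    change (l i).1 x (s j x) = _
    rw [this, (hs j).self_of_nhds, t.localFrame_apply_of_mem_baseSet b hx]
    simp [Matrix.one_apply, Finsupp.single_apply, eq_comm]
  have hne : ∀ᶠ y in 𝓝 x, (A y).det ≠ 0 :=
    hdet.continuousAt.eventually_ne (by simp [hA1])
  have hcr : ∀ᶠ y in 𝓝 x, (A y).mulVec (c y) = r y := by
    filter_upwards [eventually_all.2 hs, t.open_baseSet.mem_nhds hx] with y hy hyt
    ext i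
    change ∑ j, (l i).1 y (s j y) * c y j = (l i).1 y (e y)
    rw [t.eq_sum_localFrameCoeff_smul (I := 𝓘(ℝ, E)) (b := b) (s := e) hyt, map_sum]
    refine Finset.sum_congr rfl fun j _ => ?_
    rw [map_smul, smul_eq_mul, mul_comm, hy j]
  have hc : (fun y => c y i₀) =ᶠ[𝓝 x]
      fun y => ((A y).det)⁻¹ * ∑ j, (A y).adjugate i₀ j * r y j := by
    filter_upwards [hne, hcr] with y h1 h2
    have : (A y).adjugate.mulVec (r y) = (A y).det • c y := by
      rw [← h2, Matrix.mulVec_mulVec, Matrix.adjugate_mul, Matrix.smul_mulVec, Matrix.one_mulVec]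
    have := congrFun this i₀
    simp only [Matrix.mulVec, dotProduct, Pi.smul_apply, smul_eq_mul] at this
    rw [this, inv_mul_cancel_left₀ h1]
  refine ContMDiffAt.congr_of_eventuallyEq ?_ hc
  exact (hdet.inv₀ (by simp [hA1])).mul (ContMDiffAt.sum fun j _ => (hadj _ _).mul (hr _))

/-- A section is smooth if its pairings with smooth sections, under a smooth nondegenerate
pairing of two bundles, are smooth. -/
theorem contMDiff_section_of_pairing {F' : Type*} [NormedAddCommGroup F'] [NormedSpace ℝ F']
    [FiniteDimensional ℝ F']
    {W : M → Type*} [TopologicalSpace (TotalSpace F' W)]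
    [∀ x, AddCommGroup (W x)] [∀ x, Module ℝ (W x)] [∀ x, TopologicalSpace (W x)]
    [FiberBundle F' W] [VectorBundle ℝ F' W] [ContMDiffVectorBundle ∞ F' W 𝓘(ℝ, E)]
    (B : ∀ x, V x →ₗ[ℝ] W x →ₗ[ℝ] ℝ)
    (hB : ∀ (s : Sec E F V) (t : Sec E F' W),
      ContMDiff 𝓘(ℝ, E) 𝓘(ℝ, ℝ) ∞ (fun x => B x (s x) (t x)))
    (hnd : ∀ x v, (∀ w, B x v w = 0) → v = 0) (e : ∀ x, V x)
    (he : ∀ t : Sec E F' W, ContMDiff 𝓘(ℝ, E) 𝓘(ℝ, ℝ) ∞ (fun x => B x (e x) (t x))) :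
    ContMDiff 𝓘(ℝ, E) (𝓘(ℝ, E).prod 𝓘(ℝ, F)) ∞ (fun x => TotalSpace.mk' F x (e x)) := by
  intro x
  refine contMDiffAt_section_of_functionals e x fun v hv => ?_
  have : ∃ w, B x v w ≠ 0 := by
    by_contra hw
    push Not at hw
    exact hv (hnd x v hw)
  obtain ⟨w, hw⟩ := this
  obtain ⟨t, ht⟩ := exists_sec_apply_eq (E := E) (F := F') x w
  exact ⟨fun y => (B y).flip (t y), fun s => hB s t x, he t x, by simpa [ht] using hw⟩

/-- A section is smooth if its image under a fibrewise injective map, which preserves smooth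
sections, is smooth. -/
theorem contMDiff_section_of_injective {F' : Type*} [NormedAddCommGroup F'] [NormedSpace ℝ F']
    [FiniteDimensional ℝ F']
    {W : M → Type*} [TopologicalSpace (TotalSpace F' W)]
    [∀ x, AddCommGroup (W x)] [∀ x, Module ℝ (W x)] [∀ x, TopologicalSpace (W x)]
    [FiberBundle F' W] [VectorBundle ℝ F' W] [ContMDiffVectorBundle ∞ F' W 𝓘(ℝ, E)]
    {ι : Type*} (φ : ι → ∀ x, V x →ₗ[ℝ] W x)
    (hφ : ∀ i (s : Sec E F V), ContMDiff 𝓘(ℝ, E) (𝓘(ℝ, E).prod 𝓘(ℝ, F')) ∞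
      (fun x => TotalSpace.mk' F' x (φ i x (s x))))
    (hinj : ∀ x v, (∀ i, φ i x v = 0) → v = 0) (e : ∀ x, V x)
    (he : ∀ i, ContMDiff 𝓘(ℝ, E) (𝓘(ℝ, E).prod 𝓘(ℝ, F')) ∞
      (fun x => TotalSpace.mk' F' x (φ i x (e x)))) :
    ContMDiff 𝓘(ℝ, E) (𝓘(ℝ, E).prod 𝓘(ℝ, F)) ∞ (fun x => TotalSpace.mk' F x (e x)) := by
  intro x
  refine contMDiffAt_section_of_functionals e x fun v hv => ?_
  have : ∃ i, φ i x v ≠ 0 := by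
    by_contra hw
    push Not at hw
    exact hv (hinj x v hw)
  obtain ⟨i, hi⟩ := this
  let b := Basis.ofVectorSpace ℝ F'
  let t := trivializationAt F' W x
  have hx : x ∈ t.baseSet := FiberBundle.mem_baseSet_trivializationAt F' W x
  have h1 : ContMDiffVectorBundle 1 F' W 𝓘(ℝ, E) := ContMDiffVectorBundle.of_le (n := ∞) (by norm_cast)
  have : ∃ j, (t.basisAt b hx).repr (φ i x v) j ≠ 0 := by
    by_contra hw
    push Not at hw
    exact hi ((t.basisAt b hx).ext_elem (by simpa using hw))
  obtain ⟨j, hj⟩ := this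
  -- The functionals are the frame coordinates of the images under `φ i`; one of them detects `v` by
  -- joint injectivity.
  refine ⟨fun y => (t.localFrameCoeff 𝓘(ℝ, E) b j y).comp (φ i y), fun s => ?_, ?_, ?_⟩
  · exact contMDiffAt_localFrameCoeff (I := 𝓘(ℝ, E)) (e := t) b hx (hφ i s x) j
  · exact contMDiffAt_localFrameCoeff (I := 𝓘(ℝ, E)) (e := t) b hx (he i x) j
  · obtain ⟨s, hs⟩ := exists_sec_apply_eq (E := E) (F := F') x (φ i x v)
    have := t.localFrameCoeff_apply_of_mem_baseSet (I := 𝓘(ℝ, E)) b hx s j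
    rw [hs] at this
    simpa [this] using hj

end SectionCriteria

/-! ### Vector fields, derivatives and Lie brackets read in a chart. -/

section VectorFieldAlgebra

variable {E : Type*} [NormedAddCommGroup E] [NormedSpace ℝ E] [FiniteDimensional ℝ E]
  {M : Type*} [TopologicalSpace M] [ChartedSpace E M] [IsManifold 𝓘(ℝ, E) ∞ M]

/-- The Lie bracket of smooth vector fields. -/
def lie (X Y : VField E M) : VField E M :=
  ⟨VectorField.mlieBracket 𝓘(ℝ, E) X Y, by
    have : IsManifold 𝓘(ℝ, E) (((⊤ : ℕ∞) : WithTop ℕ∞) + 1) M := ‹IsManifold 𝓘(ℝ, E) ∞ M›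
    have : IsManifold 𝓘(ℝ, E) (minSmoothness ℝ 2) M := by
      rw [minSmoothness_of_isRCLikeNormedField]
      infer_instance
    have : IsManifold 𝓘(ℝ, E) (minSmoothness ℝ 3) M := by
      rw [minSmoothness_of_isRCLikeNormedField]
      infer_instance
    exact ContDiff.mlieBracket_vectorField (m := ⊤) (n := ⊤) X.contMDiff Y.contMDiff (by simp)⟩

theorem lie_apply (X Y : VField E M) (x : M) :
    lie X Y x = VectorField.mlieBracket 𝓘(ℝ, E) X Y x := rfl

/-- The derivative of a smooth function along a smooth vector field. -/
theorem contMDiff_dfun {f : M → ℝ} (hf : ContMDiff 𝓘(ℝ, E) 𝓘(ℝ, ℝ) ∞ f) (X : VField E M) :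
    ContMDiff 𝓘(ℝ, E) 𝓘(ℝ, ℝ) ∞ (fun x => dfun f x (X x)) := by
  have h1 : ContMDiff 𝓘(ℝ, E).tangent 𝓘(ℝ, ℝ).tangent ∞ (tangentMap 𝓘(ℝ, E) 𝓘(ℝ, ℝ) f) :=
    hf.contMDiff_tangentMap (by simp)
  have h2 := (contMDiff_snd_tangentBundle_modelSpace ℝ 𝓘(ℝ, ℝ) (n := ∞)).comp
    (h1.comp X.contMDiff)
  exact h2

/-- A vector field read in the preferred chart around `x₀`. -/
def chartField (X : ∀ x, T E M x) (x₀ : M) : E → E :=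
  VectorField.mpullbackWithin 𝓘(ℝ, E) 𝓘(ℝ, E) (extChartAt 𝓘(ℝ, E) x₀).symm X
    (Set.range 𝓘(ℝ, E))

theorem mfderiv_symm_chartField (X : ∀ x, T E M x) (x₀ : M) {y : E}
    (hy : y ∈ (extChartAt 𝓘(ℝ, E) x₀).target) :
    mfderiv 𝓘(ℝ, E) 𝓘(ℝ, E) (extChartAt 𝓘(ℝ, E) x₀).symm y (chartField (E := E) X x₀ y) =
      X ((extChartAt 𝓘(ℝ, E) x₀).symm y) := by
  have h := isInvertible_mfderivWithin_extChartAt_symm (I := 𝓘(ℝ, E)) hy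
  have h2 : mfderivWithin 𝓘(ℝ, E) 𝓘(ℝ, E) (extChartAt 𝓘(ℝ, E) x₀).symm (Set.range 𝓘(ℝ, E)) y =
    mfderiv 𝓘(ℝ, E) 𝓘(ℝ, E) (extChartAt 𝓘(ℝ, E) x₀).symm y := by
    rw [modelWithCornersSelf_coe, Set.range_id, mfderivWithin_univ]
  rw [← h2]
  exact h.self_apply_inverse _

theorem mfderiv_extChartAt_apply (X : ∀ x, T E M x) (x₀ : M) :
    mfderiv 𝓘(ℝ, E) 𝓘(ℝ, E) (extChartAt 𝓘(ℝ, E) x₀) x₀ (X x₀) =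
      chartField (E := E) X x₀ (extChartAt 𝓘(ℝ, E) x₀ x₀) := by
  have h := (VectorField.eventuallyEq_mpullback_mpullbackWithin_extChartAt
    (I := 𝓘(ℝ, E)) (x := x₀) (s := Set.univ) X)
  rw [nhdsWithin_univ] at h
  have h2 := h.self_of_nhds
  have h3 := isInvertible_mfderiv_extChartAt (I := 𝓘(ℝ, E)) (mem_extChartAt_source (I := 𝓘(ℝ, E)) x₀)
  rw [h2]
  exact h3.self_apply_inverse _

theorem contDiffAt_chartField (X : VField E M) (x₀ : M) :
    ContDiffAt ℝ ∞ (chartField (E := E) X x₀) (extChartAt 𝓘(ℝ, E) x₀ x₀) := by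
  have h := VectorField.contMDiffWithinAt_mpullbackWithin_extChartAt_symm (I := 𝓘(ℝ, E))
    (m := ∞) (n := ∞) (s := Set.univ) (x := x₀) (V := X) (X.contMDiff x₀).contMDiffWithinAt
    uniqueMDiffOn_univ (Set.mem_univ _) (by simp)
  rw [Set.preimage_univ, Set.inter_univ] at h
  have h1 := h.contMDiffAt (extChartAt_target_mem_nhds (I := 𝓘(ℝ, E)) x₀)
  have h2 := (contMDiff_snd_tangentBundle_modelSpace E 𝓘(ℝ, E) (n := ∞)).contMDiffAt.comp _ h1
  exact h2.contDiffAt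

theorem chartField_lie (X Y : VField E M) (x₀ : M) :
    chartField (E := E) (lie X Y) x₀ (extChartAt 𝓘(ℝ, E) x₀ x₀) =
      VectorField.lieBracket ℝ (E := E) (chartField (E := E) X x₀) (chartField (E := E) Y x₀)
        (extChartAt 𝓘(ℝ, E) x₀ x₀) := by
  rw [← mfderiv_extChartAt_apply]
  have h3 := isInvertible_mfderiv_extChartAt (I := 𝓘(ℝ, E)) (mem_extChartAt_source (I := 𝓘(ℝ, E)) x₀)
  have h : lie X Y x₀ = (mfderiv 𝓘(ℝ, E) 𝓘(ℝ, E) (extChartAt 𝓘(ℝ, E) x₀) x₀).inverse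
      (VectorField.lieBracket ℝ (E := E) (chartField (E := E) X x₀) (chartField (E := E) Y x₀)
        (extChartAt 𝓘(ℝ, E) x₀ x₀)) := by
    rw [lie_apply, ← VectorField.mlieBracketWithin_univ, VectorField.mlieBracketWithin_apply,
      ← VectorField.lieBracketWithin_univ]
    have hu : (extChartAt 𝓘(ℝ, E) x₀).symm ⁻¹' Set.univ ∩ Set.range 𝓘(ℝ, E) = Set.univ := by
      simp
    exact congrArg (fun s => (mfderiv 𝓘(ℝ, E) 𝓘(ℝ, E) (extChartAt 𝓘(ℝ, E) x₀) x₀).inverse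
      (VectorField.lieBracketWithin ℝ (E := E) (chartField (E := E) X x₀)
        (chartField (E := E) Y x₀) s (extChartAt 𝓘(ℝ, E) x₀ x₀))) hu
  rw [h]
  exact h3.self_apply_inverse _

/-- The derivative of a function along a vector field, read in a chart. -/
theorem dfun_symm_apply {f : M → ℝ} (x₀ : M) {y : E}
    (hy : y ∈ (extChartAt 𝓘(ℝ, E) x₀).target)
    (hf : MDifferentiableAt 𝓘(ℝ, E) 𝓘(ℝ, ℝ) f ((extChartAt 𝓘(ℝ, E) x₀).symm y))
    (X : ∀ x, T E M x) :
    dfun f ((extChartAt 𝓘(ℝ, E) x₀).symm y) (X ((extChartAt 𝓘(ℝ, E) x₀).symm y)) =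
      fderiv ℝ (f ∘ (extChartAt 𝓘(ℝ, E) x₀).symm) y (chartField (E := E) X x₀ y) := by
  have h2 : MDifferentiableAt 𝓘(ℝ, E) 𝓘(ℝ, E) (extChartAt 𝓘(ℝ, E) x₀).symm y := by
    have := mdifferentiableWithinAt_extChartAt_symm (I := 𝓘(ℝ, E)) hy
    rwa [modelWithCornersSelf_coe, Set.range_id, mdifferentiableWithinAt_univ] at this
  rw [← mfderiv_eq_fderiv, mfderiv_comp y hf h2, ← mfderiv_symm_chartField X x₀ hy]
  rfl

theorem dfun_apply_self {f : M → ℝ} (x₀ : M) (hf : MDifferentiableAt 𝓘(ℝ, E) 𝓘(ℝ, ℝ) f x₀)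
    (X : ∀ x, T E M x) :
    dfun f x₀ (X x₀) = fderiv ℝ (f ∘ (extChartAt 𝓘(ℝ, E) x₀).symm) (extChartAt 𝓘(ℝ, E) x₀ x₀)
      (chartField (E := E) X x₀ (extChartAt 𝓘(ℝ, E) x₀ x₀)) := by
  have h : (extChartAt 𝓘(ℝ, E) x₀).symm (extChartAt 𝓘(ℝ, E) x₀ x₀) = x₀ := extChartAt_to_inv x₀
  have := dfun_symm_apply x₀ (mem_extChartAt_target x₀) (f := f) (by rwa [h]) X
  rw [← this]
  exact (congrArg (fun z => dfun f z (X z)) h).symm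

theorem contDiffAt_comp_symm {G : Type*} [NormedAddCommGroup G] [NormedSpace ℝ G] {f : M → G}
    (x₀ : M) (hf : ContMDiffAt 𝓘(ℝ, E) 𝓘(ℝ, G) ∞ f x₀) :
    ContDiffAt ℝ ∞ (f ∘ (extChartAt 𝓘(ℝ, E) x₀).symm) (extChartAt 𝓘(ℝ, E) x₀ x₀) := by
  have h : (extChartAt 𝓘(ℝ, E) x₀).symm (extChartAt 𝓘(ℝ, E) x₀ x₀) = x₀ := extChartAt_to_inv x₀
  have h1 : ContMDiffAt 𝓘(ℝ, E) 𝓘(ℝ, E) ∞ (extChartAt 𝓘(ℝ, E) x₀).symm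
      (extChartAt 𝓘(ℝ, E) x₀ x₀) :=
    (contMDiffOn_extChartAt_symm x₀).contMDiffAt (extChartAt_target_mem_nhds x₀)
  rw [← h] at hf
  exact (hf.comp _ h1).contDiffAt

/-- The Lie bracket acts on functions as the commutator. -/
theorem dfun_lie {f : M → ℝ} (hf : ContMDiff 𝓘(ℝ, E) 𝓘(ℝ, ℝ) ∞ f) (X Y : VField E M) (x : M) :
    dfun f x (lie X Y x) =
      dfun (fun y => dfun f y (Y y)) x (X x) - dfun (fun y => dfun f y (X y)) x (Y x) := by
  set φ := extChartAt 𝓘(ℝ, E) x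
  set h := f ∘ φ.symm
  have hfd : MDifferentiable 𝓘(ℝ, E) 𝓘(ℝ, ℝ) f := hf.mdifferentiable (by simp)
  have hh : ContDiffAt ℝ ∞ h (φ x) := contDiffAt_comp_symm x (hf x)
  have key : ∀ X Y : VField E M, dfun (fun y => dfun f y (Y y)) x (X x) =
      fderiv ℝ (fderiv ℝ h) (φ x) (chartField (E := E) X x (φ x)) (chartField (E := E) Y x (φ x)) +
        fderiv ℝ h (φ x) (fderiv ℝ (chartField (E := E) Y x) (φ x) (chartField (E := E) X x (φ x))) := by
    intro X Y
    rw [dfun_apply_self x ((contMDiff_dfun hf Y).mdifferentiable (by simp) x) X]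
    have he : (fun y => dfun f y (Y y)) ∘ φ.symm =ᶠ[𝓝 (φ x)]
        fun y => fderiv ℝ h y (chartField (E := E) Y x y) := by
      filter_upwards [extChartAt_target_mem_nhds (I := 𝓘(ℝ, E)) x] with y hy
      exact dfun_symm_apply x hy (hfd _) Y
    rw [he.fderiv_eq, fderiv_clm_apply]
    · simp [add_comm, φ]
    · exact (hh.fderiv_right (m := 1) (by norm_cast)).differentiableAt (by simp)
    · exact (contDiffAt_chartField Y x).differentiableAt (by simp)
  -- In the commutator the second derivatives of `h` cancel by symmetry, and the first-order terms
  -- that remain are `h'` applied to the coordinate Lie bracket.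
  have hs : IsSymmSndFDerivAt ℝ h (φ x) := hh.isSymmSndFDerivAt (by simp; norm_cast)
  rw [key, key, dfun_apply_self x (hfd x), chartField_lie, VectorField.lieBracket_eq]
  rw [hs.eq (chartField (E := E) X x (φ x))]
  simp only [map_sub]
  ring

end VectorFieldAlgebra

/-! ### The invariant formula for the exterior derivative. -/

section Cartan

variable {E : Type*} [NormedAddCommGroup E] [NormedSpace ℝ E] [FiniteDimensional ℝ E]
  {M : Type*} [TopologicalSpace M] [ChartedSpace E M] [IsManifold 𝓘(ℝ, E) ∞ M]

/-- A family of alternating maps is differentiable if its values on basis vectors are. -/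
theorem differentiableAt_alternating {k : ℕ} {ι : Type*} [Finite ι] (b : Basis ι ℝ E)
    {G : Type*} [NormedAddCommGroup G] [NormedSpace ℝ G] [FiniteDimensional ℝ G]
    {f : E → E [⋀^Fin k]→L[ℝ] G} {y : E}
    (h : ∀ c : Fin k → ι, DifferentiableAt ℝ (fun z => f z (fun i => b (c i))) y) :
    DifferentiableAt ℝ f y := by
  have := Fintype.ofFinite ι
  -- Evaluation on basis tuples is an injective linear map between finite-dimensional spaces, so a
  -- linear, hence continuous, left inverse recovers the form from finitely many scalar or vector
  -- components.
  let ev : (E [⋀^Fin k]→L[ℝ] G) →ₗ[ℝ] ((Fin k → ι) → G) :=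
    { toFun := fun a c => a (fun i => b (c i))
      map_add' := fun _ _ => rfl
      map_smul' := fun _ _ => rfl }
  have hev : LinearMap.ker ev = ⊥ := by
    rw [LinearMap.ker_eq_bot]
    intro a a' haa
    apply ContinuousAlternatingMap.toAlternatingMap_injective
    exact b.ext_alternating fun c _ => congrFun haa c
  obtain ⟨g, hg⟩ := ev.exists_leftInverse_of_injective hev
  have hf : f = fun z => g.toContinuousLinearMap (ev (f z)) := by
    ext1 z
    exact (LinearMap.congr_fun hg (f z)).symm
  rw [hf]
  exact g.toContinuousLinearMap.differentiableAt.comp y (differentiableAt_pi.2 h)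

theorem chartForm_apply_chartField {G : Type*} [NormedAddCommGroup G] [NormedSpace ℝ G] {k : ℕ}
    (α : FormField E M G k) (x₀ : M) {y : E} (hy : y ∈ (extChartAt 𝓘(ℝ, E) x₀).target)
    (X : Fin k → ∀ x, T E M x) :
    chartForm α x₀ y (fun i => chartField (X i) x₀ y) =
      (fun x => α x (fun i => X i x)) ((extChartAt 𝓘(ℝ, E) x₀).symm y) := by
  change α _ (fun i => mfderiv 𝓘(ℝ, E) 𝓘(ℝ, E) (extChartAt 𝓘(ℝ, E) x₀).symm y
    (chartField (E := E) (X i) x₀ y)) = _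
  exact congrArg (α _) (funext fun i => mfderiv_symm_chartField (X i) x₀ hy)

theorem d_apply_eq_extDeriv {G : Type*} [NormedAddCommGroup G] [NormedSpace ℝ G] {k : ℕ}
    (α : FormField E M G k) (x₀ : M) (X : Fin (k + 1) → ∀ x, T E M x) :
    d α x₀ (fun i => X i x₀) = extDeriv (chartForm α x₀) (extChartAt 𝓘(ℝ, E) x₀ x₀)
      (fun i => chartField (X i) x₀ (extChartAt 𝓘(ℝ, E) x₀ x₀)) := by
  change extDeriv (chartForm α x₀) (extChartAt 𝓘(ℝ, E) x₀ x₀)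
    (fun i => mfderiv 𝓘(ℝ, E) 𝓘(ℝ, E) (extChartAt 𝓘(ℝ, E) x₀) x₀ (X i x₀)) = _
  exact congrArg _ (funext fun i => mfderiv_extChartAt_apply (X i) x₀)

variable [T2Space M]

/-- Global vector fields that are constant in a chart near a point. -/
theorem exists_vfield_chartField_eq (x₀ : M) (v : E) :
    ∃ X : VField E M, ∀ᶠ y in 𝓝 (extChartAt 𝓘(ℝ, E) x₀ x₀), chartField X x₀ y = v := by
  let W : ∀ x : M, T E M x :=
    VectorField.mpullback 𝓘(ℝ, E) 𝓘(ℝ, E) (extChartAt 𝓘(ℝ, E) x₀) (fun _ => v)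
  have hW : ContMDiffOn 𝓘(ℝ, E) (𝓘(ℝ, E).prod 𝓘(ℝ, E)) ∞ (fun y => TotalSpace.mk' E y (W y))
      (extChartAt 𝓘(ℝ, E) x₀).source := by
    intro x hx
    refine ContMDiffAt.contMDiffWithinAt ?_
    refine ContMDiffAt.mpullback_vectorField_preimage (n := ∞) (m := ∞) ?_ ?_ ?_ (by simp)
    · exact (contMDiffAt_vectorSpace_iff_contDiffAt (V := fun _ : E => v)).2 contDiffAt_const
    · exact contMDiffAt_extChartAt' (by simpa using hx)
    · exact isInvertible_mfderiv_extChartAt hx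
  obtain ⟨X, hX⟩ := exists_sec_eventuallyEq (isOpen_extChartAt_source x₀)
    (mem_extChartAt_source (I := 𝓘(ℝ, E)) x₀) hW
  refine ⟨X, ?_⟩
  have hc : Tendsto (extChartAt 𝓘(ℝ, E) x₀).symm (𝓝 (extChartAt 𝓘(ℝ, E) x₀ x₀)) (𝓝 x₀) := by
    have := continuousAt_extChartAt_symm (I := 𝓘(ℝ, E)) x₀
    rwa [ContinuousAt, extChartAt_to_inv] at this
  filter_upwards [hc.eventually hX, extChartAt_target_mem_nhds (I := 𝓘(ℝ, E)) x₀] with y hy hyt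
  have h1 := isInvertible_mfderivWithin_extChartAt_symm (I := 𝓘(ℝ, E)) hyt
  have h2 := isInvertible_mfderiv_extChartAt (I := 𝓘(ℝ, E)) ((extChartAt 𝓘(ℝ, E) x₀).map_target hyt)
  have h3 := mfderiv_extChartAt_comp_mfderivWithin_extChartAt_symm (I := 𝓘(ℝ, E)) hyt
  change (mfderivWithin 𝓘(ℝ, E) 𝓘(ℝ, E) (extChartAt 𝓘(ℝ, E) x₀).symm (Set.range 𝓘(ℝ, E)) y).inverse
    (X ((extChartAt 𝓘(ℝ, E) x₀).symm y)) = v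
  exact h1.inverse_apply_eq.2 (hy.trans (h2.inverse_apply_eq.2
    (DFunLike.congr_fun h3 v).symm))

theorem contDiffAt_formApply {G : Type*} [NormedAddCommGroup G] [NormedSpace ℝ G] {k : ℕ}
    {α : FormField E M G k} (hα : IsSmoothForm α) (x₀ : M) (X : Fin k → VField E M) :
    ContDiffAt ℝ ∞ (fun y => chartForm α x₀ y (fun i => chartField (X i) x₀ y))
      (extChartAt 𝓘(ℝ, E) x₀ x₀) := by
  refine (contDiffAt_comp_symm x₀ (hα X x₀)).congr_of_eventuallyEq ?_
  filter_upwards [extChartAt_target_mem_nhds (I := 𝓘(ℝ, E)) x₀] with y hy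
  exact chartForm_apply_chartField α x₀ hy (fun i => X i)

/-- Smoothness of a form is defined by testing on global vector fields. Global fields that are
constant near the point in the chart turn these tests into statements about the components of the
form. -/
theorem differentiableAt_chartForm {G : Type*} [NormedAddCommGroup G] [NormedSpace ℝ G]
    [FiniteDimensional ℝ G] {k : ℕ}
    {α : FormField E M G k} (hα : IsSmoothForm α) (x₀ : M) :
    DifferentiableAt ℝ (chartForm α x₀) (extChartAt 𝓘(ℝ, E) x₀ x₀) := by
  refine differentiableAt_alternating (Basis.ofVectorSpace ℝ E) fun c => ?_
  choose X hX using fun i => exists_vfield_chartField_eq (M := M) x₀ (Basis.ofVectorSpace ℝ E (c i))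
  refine ((contDiffAt_formApply hα x₀ X).differentiableAt (by simp)).congr_of_eventuallyEq ?_
  filter_upwards [eventually_all.2 hX] with y hy
  simp only [hy]

/-- The exterior derivative of a smooth form evaluated on smooth vector fields. -/
theorem d_apply_vfield {n : ℕ} {α : FormField E M ℝ (n + 1)} (hα : IsSmoothForm α)
    (X : Fin (n + 2) → VField E M) (x : M) :
    d α x (fun i => X i x) =
      (∑ i : Fin (n + 2), (-1) ^ i.val •
        dfun (fun y => α y (i.removeNth (fun j => X j y))) x (X i x)) -
      ∑ i : Fin (n + 1), ∑ j ≥ i, (-1) ^ (i + j : ℕ) •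
        α x (Matrix.vecCons (lie (X i.castSucc) (X j.succ) x)
          (j.removeNth <| i.castSucc.removeNth (fun j => X j x))) := by
  rw [d_apply_eq_extDeriv α x (fun i => X i),
    extDeriv_apply_vectorField (V := fun i => chartField (E := E) (X i) x)
    (differentiableAt_chartForm hα x)
    (fun i => (contDiffAt_chartField (X i) x).differentiableAt (by simp))]
  congr 1
  · refine Finset.sum_congr rfl fun i _ => ?_
    congr 1
    have hs : ContMDiff 𝓘(ℝ, E) 𝓘(ℝ, ℝ) ∞ (fun y => α y (i.removeNth (fun j => X j y))) :=
      hα (i.removeNth X)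
    rw [dfun_apply_self x (hs.mdifferentiable (by simp) x) (X i)]
    congr 1
    refine Filter.EventuallyEq.fderiv_eq ?_
    filter_upwards [extChartAt_target_mem_nhds (I := 𝓘(ℝ, E)) x] with y hy
    exact chartForm_apply_chartField α x hy (fun j => i.removeNth X j)
  · refine Finset.sum_congr rfl fun i _ => Finset.sum_congr rfl fun j _ => ?_
    congr 1
    -- The arguments of the bracket term are themselves values of smooth fields, since `lie` is
    -- again a smooth field; this lets the chart comparison apply to the whole tuple.
    let Y : Fin (n + 1) → VField E M :=
      Matrix.vecCons (lie (X i.castSucc) (X j.succ)) (j.removeNth <| i.castSucc.removeNth X)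
    have h := chartForm_apply_chartField α x (mem_extChartAt_target x) (fun j => Y j)
    have hx : (extChartAt 𝓘(ℝ, E) x).symm (extChartAt 𝓘(ℝ, E) x x) = x := extChartAt_to_inv x
    rw [hx] at h
    rw [← chartField_lie]
    convert h using 1
    · congr 1
      ext k
      refine Fin.cases ?_ (fun k => ?_) k <;> rfl
    · congr 1
      ext k
      refine Fin.cases ?_ (fun k => ?_) k <;> rfl

/-- The exterior derivative of a smooth 1-form. -/
theorem d_apply_one {α : FormField E M ℝ 1} (hα : IsSmoothForm α) (X Y : VField E M) (x : M) :
    d α x ![X x, Y x] = dfun (fun y => α y ![Y y]) x (X x) - dfun (fun y => α y ![X y]) x (Y x)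
      - α x ![lie X Y x] := by
  have h := d_apply_vfield hα ![X, Y] x
  have h0 : (fun i => (![X, Y] : Fin 2 → VField E M) i x) = ![X x, Y x] := by
    ext i; fin_cases i <;> rfl
  have a0 : ∀ y, (0 : Fin 2).removeNth (fun i => (![X, Y] : Fin 2 → VField E M) i y) =
      ![Y y] := by
    intro y; ext i; fin_cases i; rfl
  have a1 : ∀ y, (1 : Fin 2).removeNth (fun i => (![X, Y] : Fin 2 → VField E M) i y) =
      ![X y] := by
    intro y; ext i; fin_cases i; rfl
  have c0 : (Finset.Ici (0 : Fin 1)) = {0} := by decide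
  have b00 : Matrix.vecCons (lie (![X, Y] (Fin.castSucc 0)) (![X, Y] (Fin.succ 0)) x)
      ((0 : Fin 1).removeNth ((Fin.castSucc (0 : Fin 1)).removeNth ![X x, Y x])) =
      ![lie X Y x] := by
    ext i; fin_cases i; rfl
  rw [h0, Fin.sum_univ_two, Fin.sum_univ_one, c0, Finset.sum_singleton,
    b00] at h
  simp only [a0, a1] at h
  rw [h]
  simp [pow_succ]
  ring

/-- The exterior derivative of a smooth 2-form. -/
theorem d_apply_two {α : FormField E M ℝ 2} (hα : IsSmoothForm α) (X Y Z : VField E M) (x : M) :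
    d α x ![X x, Y x, Z x] = dfun (fun y => α y ![Y y, Z y]) x (X x)
      - dfun (fun y => α y ![X y, Z y]) x (Y x) + dfun (fun y => α y ![X y, Y y]) x (Z x)
      - α x ![lie X Y x, Z x] + α x ![lie X Z x, Y x] - α x ![lie Y Z x, X x] := by
  have h := d_apply_vfield hα ![X, Y, Z] x
  have h0 : (fun i => (![X, Y, Z] : Fin 3 → VField E M) i x) = ![X x, Y x, Z x] := by
    ext i; fin_cases i <;> rfl
  have a0 : ∀ y, (0 : Fin 3).removeNth (fun i => (![X, Y, Z] : Fin 3 → VField E M) i y) =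
      ![Y y, Z y] := by
    intro y; ext i; fin_cases i <;> rfl
  have a1 : ∀ y, (1 : Fin 3).removeNth (fun i => (![X, Y, Z] : Fin 3 → VField E M) i y) =
      ![X y, Z y] := by
    intro y; ext i; fin_cases i <;> rfl
  have a2 : ∀ y, (2 : Fin 3).removeNth (fun i => (![X, Y, Z] : Fin 3 → VField E M) i y) =
      ![X y, Y y] := by
    intro y; ext i; fin_cases i <;> rfl
  have c0 : (Finset.Ici (0 : Fin 2)) = {0, 1} := by decide
  have b00 : Matrix.vecCons (lie (![X, Y, Z] (Fin.castSucc 0)) (![X, Y, Z] (Fin.succ 0)) x)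
      ((0 : Fin 2).removeNth ((Fin.castSucc (0 : Fin 2)).removeNth ![X x, Y x, Z x])) =
      ![lie X Y x, Z x] := by
    ext i; fin_cases i <;> rfl
  have b01 : Matrix.vecCons (lie (![X, Y, Z] (Fin.castSucc 0)) (![X, Y, Z] (Fin.succ 1)) x)
      ((1 : Fin 2).removeNth ((Fin.castSucc (0 : Fin 2)).removeNth ![X x, Y x, Z x])) =
      ![lie X Z x, Y x] := by
    ext i; fin_cases i <;> rfl
  have c1 : (Finset.Ici (1 : Fin 2)) = {1} := by decide
  have b11 : Matrix.vecCons (lie (![X, Y, Z] (Fin.castSucc 1)) (![X, Y, Z] (Fin.succ 1)) x)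
      ((1 : Fin 2).removeNth ((Fin.castSucc (1 : Fin 2)).removeNth ![X x, Y x, Z x])) =
      ![lie Y Z x, X x] := by
    ext i; fin_cases i <;> rfl
  rw [h0, Fin.sum_univ_three, Fin.sum_univ_two, c0, c1, Finset.sum_pair (by decide), Finset.sum_singleton,
    b00, b01, b11] at h
  simp only [a0, a1, a2] at h
  rw [h]
  simp [pow_succ]
  ring

/-- The exterior derivative of a smooth 3-form. -/
theorem d_apply_three {α : FormField E M ℝ 3} (hα : IsSmoothForm α) (X Y Z W : VField E M)
    (x : M) :
    d α x ![X x, Y x, Z x, W x] = dfun (fun y => α y ![Y y, Z y, W y]) x (X x)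
      - dfun (fun y => α y ![X y, Z y, W y]) x (Y x) + dfun (fun y => α y ![X y, Y y, W y]) x (Z x)
      - dfun (fun y => α y ![X y, Y y, Z y]) x (W x)
      - α x ![lie X Y x, Z x, W x] + α x ![lie X Z x, Y x, W x] - α x ![lie X W x, Y x, Z x]
      - α x ![lie Y Z x, X x, W x] + α x ![lie Y W x, X x, Z x] - α x ![lie Z W x, X x, Y x] := by
  have h := d_apply_vfield hα ![X, Y, Z, W] x
  have h0 : (fun i => (![X, Y, Z, W] : Fin 4 → VField E M) i x) = ![X x, Y x, Z x, W x] := by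
    ext i; fin_cases i <;> rfl
  have a0 : ∀ y, (0 : Fin 4).removeNth (fun i => (![X, Y, Z, W] : Fin 4 → VField E M) i y) =
      ![Y y, Z y, W y] := by
    intro y; ext i; fin_cases i <;> rfl
  have a1 : ∀ y, (1 : Fin 4).removeNth (fun i => (![X, Y, Z, W] : Fin 4 → VField E M) i y) =
      ![X y, Z y, W y] := by
    intro y; ext i; fin_cases i <;> rfl
  have a2 : ∀ y, (2 : Fin 4).removeNth (fun i => (![X, Y, Z, W] : Fin 4 → VField E M) i y) =
      ![X y, Y y, W y] := by
    intro y; ext i; fin_cases i <;> rfl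
  have a3 : ∀ y, (3 : Fin 4).removeNth (fun i => (![X, Y, Z, W] : Fin 4 → VField E M) i y) =
      ![X y, Y y, Z y] := by
    intro y; ext i; fin_cases i <;> rfl
  have c0 : (Finset.Ici (0 : Fin 3)) = {0, 1, 2} := by decide
  have b00 : Matrix.vecCons (lie (![X, Y, Z, W] (Fin.castSucc 0)) (![X, Y, Z, W] (Fin.succ 0)) x)
      ((0 : Fin 3).removeNth ((Fin.castSucc (0 : Fin 3)).removeNth ![X x, Y x, Z x, W x])) =
      ![lie X Y x, Z x, W x] := by
    ext i; fin_cases i <;> rfl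
  have b01 : Matrix.vecCons (lie (![X, Y, Z, W] (Fin.castSucc 0)) (![X, Y, Z, W] (Fin.succ 1)) x)
      ((1 : Fin 3).removeNth ((Fin.castSucc (0 : Fin 3)).removeNth ![X x, Y x, Z x, W x])) =
      ![lie X Z x, Y x, W x] := by
    ext i; fin_cases i <;> rfl
  have b02 : Matrix.vecCons (lie (![X, Y, Z, W] (Fin.castSucc 0)) (![X, Y, Z, W] (Fin.succ 2)) x)
      ((2 : Fin 3).removeNth ((Fin.castSucc (0 : Fin 3)).removeNth ![X x, Y x, Z x, W x])) =
      ![lie X W x, Y x, Z x] := by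
    ext i; fin_cases i <;> rfl
  have c1 : (Finset.Ici (1 : Fin 3)) = {1, 2} := by decide
  have b11 : Matrix.vecCons (lie (![X, Y, Z, W] (Fin.castSucc 1)) (![X, Y, Z, W] (Fin.succ 1)) x)
      ((1 : Fin 3).removeNth ((Fin.castSucc (1 : Fin 3)).removeNth ![X x, Y x, Z x, W x])) =
      ![lie Y Z x, X x, W x] := by
    ext i; fin_cases i <;> rfl
  have b12 : Matrix.vecCons (lie (![X, Y, Z, W] (Fin.castSucc 1)) (![X, Y, Z, W] (Fin.succ 2)) x)
      ((2 : Fin 3).removeNth ((Fin.castSucc (1 : Fin 3)).removeNth ![X x, Y x, Z x, W x])) =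
      ![lie Y W x, X x, Z x] := by
    ext i; fin_cases i <;> rfl
  have c2 : (Finset.Ici (2 : Fin 3)) = {2} := by decide
  have b22 : Matrix.vecCons (lie (![X, Y, Z, W] (Fin.castSucc 2)) (![X, Y, Z, W] (Fin.succ 2)) x)
      ((2 : Fin 3).removeNth ((Fin.castSucc (2 : Fin 3)).removeNth ![X x, Y x, Z x, W x])) =
      ![lie Z W x, X x, Y x] := by
    ext i; fin_cases i <;> rfl
  rw [h0, Fin.sum_univ_four, Fin.sum_univ_three, c0, c1, c2, Finset.sum_insert (by decide),
    Finset.sum_pair (by decide), Finset.sum_pair (by decide), Finset.sum_singleton,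
    b00, b01, b02, b11, b12, b22] at h
  simp only [a0, a1, a2, a3] at h
  rw [h]
  simp [pow_succ]
  ring

end Cartan

/-! ### Permutations of the arguments of alternating maps of low degree. -/

section Alternating

variable {W : Type*} {G : Type*} [AddCommGroup W] [Module ℝ W] [TopologicalSpace W]
  [AddCommGroup G] [Module ℝ G] [TopologicalSpace G]

theorem alternating_two_swap (α : W [⋀^Fin 2]→L[ℝ] G) (u v : W) : α ![v, u] = -α ![u, v] := by
  have h := α.toAlternatingMap.map_swap ![u, v] (i := 0) (j := 1) (by decide)
  have e : (![u, v] : Fin 2 → W) ∘ Equiv.swap 0 1 = ![v, u] := by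
    ext i; fin_cases i <;> rfl
  rw [e] at h
  exact h

theorem alternating_three_swap_zero_one (α : W [⋀^Fin 3]→L[ℝ] G) (u v w : W) :
    α ![v, u, w] = -α ![u, v, w] := by
  have h := α.toAlternatingMap.map_swap ![u, v, w] (i := 0) (j := 1) (by decide)
  have e : (![u, v, w] : Fin 3 → W) ∘ Equiv.swap 0 1 = ![v, u, w] := by
    ext i; fin_cases i <;> rfl
  rw [e] at h
  exact h

theorem alternating_three_swap_one_two (α : W [⋀^Fin 3]→L[ℝ] G) (u v w : W) :
    α ![u, w, v] = -α ![u, v, w] := by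
  have h := α.toAlternatingMap.map_swap ![u, v, w] (i := 1) (j := 2) (by decide)
  have e : (![u, v, w] : Fin 3 → W) ∘ Equiv.swap 1 2 = ![u, w, v] := by
    ext i; fin_cases i <;> rfl
  rw [e] at h
  exact h

theorem alternating_three_rotate (α : W [⋀^Fin 3]→L[ℝ] G) (u v w : W) :
    α ![v, w, u] = α ![u, v, w] := by
  rw [alternating_three_swap_one_two, alternating_three_swap_zero_one, neg_neg]

theorem alternating_three_neg_zero (α : W [⋀^Fin 3]→L[ℝ] G) (u v w : W) :
    α ![-u, v, w] = -α ![u, v, w] := by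
  have h := α.map_update_smul ![u, v, w] 0 (-1 : ℝ) u
  have e1 : Function.update ![u, v, w] 0 ((-1 : ℝ) • u) = ![-u, v, w] := by
    ext i; fin_cases i <;> simp
  have e2 : Function.update ![u, v, w] 0 u = ![u, v, w] := by
    ext i; fin_cases i <;> simp
  rw [e1, e2] at h
  simpa using h

theorem alternating_three_neg_one (α : W [⋀^Fin 3]→L[ℝ] G) (u v w : W) :
    α ![u, -v, w] = -α ![u, v, w] := by
  rw [alternating_three_swap_zero_one, alternating_three_neg_zero,
    alternating_three_swap_zero_one, neg_neg]

variable [IsTopologicalAddGroup G]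

theorem alternatization_two_apply (m : ContinuousMultilinearMap ℝ (fun _ : Fin 2 => W) G)
    (v : Fin 2 → W) :
    ContinuousMultilinearMap.alternatization m v = m ![v 0, v 1] - m ![v 1, v 0] := by
  rw [ContinuousMultilinearMap.alternatization_apply_apply]
  have hu : (Finset.univ : Finset (Equiv.Perm (Fin 2))) = {1, Equiv.swap 0 1} := by decide
  have e1 : v ∘ (1 : Equiv.Perm (Fin 2)) = ![v 0, v 1] := by
    ext i; fin_cases i <;> rfl
  have e2 : v ∘ (Equiv.swap 0 1 : Equiv.Perm (Fin 2)) = ![v 1, v 0] := by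
    ext i; fin_cases i <;> rfl
  rw [hu, Finset.sum_pair (by decide), e1, e2]
  simp [sub_eq_add_neg]

theorem alternatization_three_apply (m : ContinuousMultilinearMap ℝ (fun _ : Fin 3 => W) G)
    (v : Fin 3 → W) :
    ContinuousMultilinearMap.alternatization m v = m ![v 0, v 1, v 2] - m ![v 1, v 0, v 2]
      - m ![v 2, v 1, v 0] - m ![v 0, v 2, v 1] + m ![v 1, v 2, v 0] + m ![v 2, v 0, v 1] := by
  rw [ContinuousMultilinearMap.alternatization_apply_apply]
  have hu : (Finset.univ : Finset (Equiv.Perm (Fin 3))) = {1, Equiv.swap 0 1, Equiv.swap 0 2,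
      Equiv.swap 1 2, Equiv.swap 0 1 * Equiv.swap 1 2, Equiv.swap 1 2 * Equiv.swap 0 1} := by decide
  have e1 : v ∘ (1 : Equiv.Perm (Fin 3)) = ![v 0, v 1, v 2] := by
    ext i; fin_cases i <;> rfl
  have e2 : v ∘ (Equiv.swap 0 1 : Equiv.Perm (Fin 3)) = ![v 1, v 0, v 2] := by
    ext i; fin_cases i <;> rfl
  have e3 : v ∘ (Equiv.swap 0 2 : Equiv.Perm (Fin 3)) = ![v 2, v 1, v 0] := by
    ext i; fin_cases i <;> rfl
  have e4 : v ∘ (Equiv.swap 1 2 : Equiv.Perm (Fin 3)) = ![v 0, v 2, v 1] := by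
    ext i; fin_cases i <;> rfl
  have e5 : v ∘ (Equiv.swap 0 1 * Equiv.swap 1 2 : Equiv.Perm (Fin 3)) = ![v 1, v 2, v 0] := by
    ext i; fin_cases i <;> rfl
  have e6 : v ∘ (Equiv.swap 1 2 * Equiv.swap 0 1 : Equiv.Perm (Fin 3)) = ![v 2, v 0, v 1] := by
    ext i; fin_cases i <;> rfl
  rw [hu, Finset.sum_insert (by decide), Finset.sum_insert (by decide),
    Finset.sum_insert (by decide), Finset.sum_insert (by decide), Finset.sum_pair (by decide),
    e1, e2, e3, e4, e5, e6]
  simp [Equiv.Perm.sign_mul]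
  abel

end Alternating

/-! ### Decomposition of 2-forms and 3-forms by type. -/

section TypeParts

variable {E : Type*} [NormedAddCommGroup E] [NormedSpace ℝ E]
  {M : Type*} [TopologicalSpace M] [ChartedSpace E M]

/-- Slot `j` receives `(v + c_j J v) / 2`, with `c_j = -i` for a (1,0)-slot and `c_j = i` for a
(0,1)-slot. Keeping the constants abstract lets one expansion serve all `p`. -/
theorem evalType_two (J : EndField E M) (p : ℕ) (α : FormField E M ℂ 2) (x : M) (u v : T E M x)
    {c₀ c₁ : ℂ} (h₀ : (if 0 < p then -Complex.I else Complex.I) = c₀)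
    (h₁ : (if 1 < p then -Complex.I else Complex.I) = c₁) :
    evalType J p α x ![u, v] = (1 / 4 : ℂ) * (α x ![u, v] + c₀ * α x ![J x u, v]
      + c₁ * α x ![u, J x v] + c₀ * c₁ * α x ![J x u, J x v]) := by
  have hu : (Finset.univ : Finset (Finset (Fin 2))) = {∅, {0}, {1}, {0, 1}} := by decide
  have e : ∀ S : Finset (Fin 2), (fun j => (if j ∈ S then J x else
      ContinuousLinearMap.id ℝ (T E M x)) ((![u, v] : Fin 2 → T E M x) j)) =
      ![(if 0 ∈ S then J x else ContinuousLinearMap.id ℝ (T E M x)) u,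
        (if 1 ∈ S then J x else ContinuousLinearMap.id ℝ (T E M x)) v] := by
    intro S; ext i; fin_cases i <;> rfl
  have e' : ∀ S : Finset (Fin 2), ((α x).toContinuousMultilinearMap.compContinuousLinearMap
        (fun j => if j ∈ S then J x else ContinuousLinearMap.id ℝ (T E M x))) ![u, v] =
      α x ![(if 0 ∈ S then J x else ContinuousLinearMap.id ℝ (T E M x)) u,
        (if 1 ∈ S then J x else ContinuousLinearMap.id ℝ (T E M x)) v] := by
    intro S
    rw [← e S]
    rfl
  rw [evalType, sum_apply]
  simp only [smul_apply, e']
  rw [hu, Finset.sum_insert (by decide), Finset.sum_insert (by decide), Finset.sum_pair (by decide),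
    Finset.prod_pair (by decide), Finset.prod_singleton, Finset.prod_singleton, Finset.prod_empty]
  have h₀' : (if ((0 : Fin 2) : ℕ) < p then -Complex.I else Complex.I) = c₀ := h₀
  have h₁' : (if ((1 : Fin 2) : ℕ) < p then -Complex.I else Complex.I) = c₁ := h₁
  rw [h₀', h₁']
  simp
  ring

theorem evalType_three (J : EndField E M) (p : ℕ) (α : FormField E M ℂ 3) (x : M)
    (u v w : T E M x) {c₀ c₁ c₂ : ℂ} (h₀ : (if 0 < p then -Complex.I else Complex.I) = c₀)
    (h₁ : (if 1 < p then -Complex.I else Complex.I) = c₁)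
    (h₂ : (if 2 < p then -Complex.I else Complex.I) = c₂) :
    evalType J p α x ![u, v, w] = (1 / 8 : ℂ) * (α x ![u, v, w]
      + c₀ * α x ![J x u, v, w] + c₁ * α x ![u, J x v, w] + c₂ * α x ![u, v, J x w]
      + c₀ * c₁ * α x ![J x u, J x v, w] + c₀ * c₂ * α x ![J x u, v, J x w]
      + c₁ * c₂ * α x ![u, J x v, J x w] + c₀ * c₁ * c₂ * α x ![J x u, J x v, J x w]) := by
  have hu : (Finset.univ : Finset (Finset (Fin 3))) =
      {∅, {0}, {1}, {2}, {0, 1}, {0, 2}, {1, 2}, {0, 1, 2}} := by decide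
  have e : ∀ S : Finset (Fin 3), (fun j => (if j ∈ S then J x else
      ContinuousLinearMap.id ℝ (T E M x)) ((![u, v, w] : Fin 3 → T E M x) j)) =
      ![(if 0 ∈ S then J x else ContinuousLinearMap.id ℝ (T E M x)) u,
        (if 1 ∈ S then J x else ContinuousLinearMap.id ℝ (T E M x)) v,
        (if 2 ∈ S then J x else ContinuousLinearMap.id ℝ (T E M x)) w] := by
    intro S; ext i; fin_cases i <;> rfl
  have e' : ∀ S : Finset (Fin 3), ((α x).toContinuousMultilinearMap.compContinuousLinearMap
        (fun j => if j ∈ S then J x else ContinuousLinearMap.id ℝ (T E M x))) ![u, v, w] =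
      α x ![(if 0 ∈ S then J x else ContinuousLinearMap.id ℝ (T E M x)) u,
        (if 1 ∈ S then J x else ContinuousLinearMap.id ℝ (T E M x)) v,
        (if 2 ∈ S then J x else ContinuousLinearMap.id ℝ (T E M x)) w] := by
    intro S
    rw [← e S]
    rfl
  rw [evalType, sum_apply]
  simp only [smul_apply, e']
  rw [hu, Finset.sum_insert (by decide), Finset.sum_insert (by decide),
    Finset.sum_insert (by decide), Finset.sum_insert (by decide), Finset.sum_insert (by decide),
    Finset.sum_insert (by decide), Finset.sum_pair (by decide)]
  have p3 : ∀ f : Fin 3 → ℂ, ∏ j ∈ ({0, 1, 2} : Finset (Fin 3)), f j = f 0 * f 1 * f 2 := by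
    intro f
    rw [Finset.prod_insert (by decide), Finset.prod_pair (by decide), mul_assoc]
  rw [p3, Finset.prod_pair (by decide), Finset.prod_pair (by decide), Finset.prod_pair (by decide),
    Finset.prod_singleton, Finset.prod_singleton, Finset.prod_singleton, Finset.prod_empty]
  have h₀' : (if ((0 : Fin 3) : ℕ) < p then -Complex.I else Complex.I) = c₀ := h₀
  have h₁' : (if ((1 : Fin 3) : ℕ) < p then -Complex.I else Complex.I) = c₁ := h₁
  have h₂' : (if ((2 : Fin 3) : ℕ) < p then -Complex.I else Complex.I) = c₂ := h₂
  rw [h₀', h₁', h₂']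
  simp
  ring

theorem typePart_apply_two (J : EndField E M) (p : Fin 3) (α : FormField E M ℂ 2) (x : M)
    (v : Fin 2 → T E M x) :
    typePart J p α x v = (((p : ℕ).factorial * (2 - (p : ℕ)).factorial : ℂ)⁻¹) *
      (evalType J p α x ![v 0, v 1] - evalType J p α x ![v 1, v 0]) := by
  rw [← alternatization_two_apply]
  rfl

theorem typePart_apply_three (J : EndField E M) (p : Fin 4) (α : FormField E M ℂ 3) (x : M)
    (v : Fin 3 → T E M x) :
    typePart J p α x v = (((p : ℕ).factorial * (3 - (p : ℕ)).factorial : ℂ)⁻¹) *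
      (evalType J p α x ![v 0, v 1, v 2] - evalType J p α x ![v 1, v 0, v 2]
      - evalType J p α x ![v 2, v 1, v 0] - evalType J p α x ![v 0, v 2, v 1]
      + evalType J p α x ![v 1, v 2, v 0] + evalType J p α x ![v 2, v 0, v 1]) := by
  rw [← alternatization_three_apply]
  rfl

section InvariantTwoForm

variable {J : EndField E M} {α : FormField E M ℂ 2}

theorem vecTwo_eta {W : Type*} (v : Fin 2 → W) : v = ![v 0, v 1] := by
  ext i; fin_cases i <;> rfl

theorem vecThree_eta {W : Type*} (v : Fin 3 → W) : v = ![v 0, v 1, v 2] := by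
  ext i; fin_cases i <;> rfl

theorem apply_J_right (hJ : ∀ x (v : T E M x), J x (J x v) = -v)
    (hα : ∀ x (u v : T E M x), α x ![J x u, J x v] = α x ![u, v]) (x : M) (u v : T E M x) :
    α x ![u, J x v] = -α x ![J x u, v] := by
  rw [← hα x u (J x v), hJ]
  have h := (α x).map_update_smul ![J x u, v] 1 (-1 : ℝ) v
  have e1 : Function.update ![J x u, v] 1 ((-1 : ℝ) • v) = ![J x u, -v] := by
    ext i; fin_cases i <;> simp
  have e2 : Function.update ![J x u, v] 1 v = ![J x u, v] := by
    ext i; fin_cases i <;> simp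
  rw [e1, e2] at h
  simpa using h

/-- A `J`-invariant 2-form has type `(1, 1)`. -/
theorem typePart_of_invariant (hJ : ∀ x (v : T E M x), J x (J x v) = -v)
    (hα : ∀ x (u v : T E M x), α x ![J x u, J x v] = α x ![u, v]) :
    typePart J (0 : Fin 3) α = 0 ∧ typePart J (1 : Fin 3) α = α ∧
      typePart J (2 : Fin 3) α = 0 := by
  refine ⟨?_, ?_, ?_⟩ <;>
  · ext x v
    have h1 := alternating_two_swap (α x) (v 0) (v 1)
    have h2 := alternating_two_swap (α x) (J x (v 0)) (v 1)
    have h3 := alternating_two_swap (α x) (v 0) (J x (v 1))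
    have h4 := alternating_two_swap (α x) (J x (v 0)) (J x (v 1))
    have h5 := apply_J_right hJ hα x (v 0) (v 1)
    have h6 := hα x (v 0) (v 1)
    have h7 : α x v = α x ![v 0, v 1] := congrArg (α x) (vecTwo_eta v)
    -- Antisymmetry and invariance reduce all eight values to `α(v₀, v₁)` and `α(J v₀, v₁)`; the
    -- three types differ only in the constants.
    rw [typePart_apply_two, evalType_two _ _ _ _ _ _ rfl rfl, evalType_two _ _ _ _ _ _ rfl rfl,
      h1, h2, h3, h4, h5, h6]
    simp [Nat.factorial, h7] <;> ring

end InvariantTwoForm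

/-- The slot constants are `(-i, -i, i)` for the (2,1)-part and `(-i, i, i)` for the (1,2)-part.
Their second elementary symmetric functions agree, while the first and third change sign, so only
terms with an odd number of `J`'s survive. These are the terms that d^c needs. -/
theorem typePart_two_sub_one (J : EndField E M) (α : FormField E M ℂ 3) (x : M)
    (u v w : T E M x) :
    typePart J (2 : Fin 4) α x ![u, v, w] - typePart J (1 : Fin 4) α x ![u, v, w] =
      -(Complex.I / 4) * (α x ![J x u, v, w] + α x ![u, J x v, w] + α x ![u, v, J x w]
        + 3 * α x ![J x u, J x v, J x w]) := by
  have hI : Complex.I ^ 2 = -1 := Complex.I_sq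
  have hI3 : Complex.I ^ 3 = -Complex.I := by rw [pow_succ, hI]; ring
  have s1 : ∀ a b c : T E M x, α x ![b, a, c] = -α x ![a, b, c] :=
    fun a b c => alternating_three_swap_zero_one _ a b c
  have s2 : ∀ a b c : T E M x, α x ![c, b, a] = -α x ![a, b, c] := fun a b c => by
    rw [alternating_three_swap_zero_one, alternating_three_rotate]
  have s3 : ∀ a b c : T E M x, α x ![a, c, b] = -α x ![a, b, c] :=
    fun a b c => alternating_three_swap_one_two _ a b c
  have s4 : ∀ a b c : T E M x, α x ![b, c, a] = α x ![a, b, c] :=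
    fun a b c => alternating_three_rotate _ a b c
  have s5 : ∀ a b c : T E M x, α x ![c, a, b] = α x ![a, b, c] := fun a b c => by
    rw [s4 c a b |>.symm]
  have key : ∀ (p : ℕ) (c₀ c₁ c₂ : ℂ), (if 0 < p then -Complex.I else Complex.I) = c₀ →
      (if 1 < p then -Complex.I else Complex.I) = c₁ →
      (if 2 < p then -Complex.I else Complex.I) = c₂ →
      evalType J p α x ![u, v, w] - evalType J p α x ![v, u, w]
      - evalType J p α x ![w, v, u] - evalType J p α x ![u, w, v]
      + evalType J p α x ![v, w, u] + evalType J p α x ![w, u, v] =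
      (1 / 4 : ℂ) * (3 * α x ![u, v, w] + (c₀ + c₁ + c₂) * (α x ![J x u, v, w]
        + α x ![u, J x v, w] + α x ![u, v, J x w]) + (c₀ * c₁ + c₀ * c₂ + c₁ * c₂) *
        (α x ![J x u, J x v, w] + α x ![J x u, v, J x w] + α x ![u, J x v, J x w]) +
        3 * c₀ * c₁ * c₂ * α x ![J x u, J x v, J x w]) := by
    intro p c₀ c₁ c₂ h₀ h₁ h₂
    simp only [evalType_three J p α x _ _ _ h₀ h₁ h₂]
    rw [s1 u v w, s2 u v w, s3 u v w, s4 u v w, s5 u v w,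
      s1 (J x u) v w, s2 (J x u) v w, s3 (J x u) v w, s4 (J x u) v w, s5 (J x u) v w,
      s1 u (J x v) w, s2 u (J x v) w, s3 u (J x v) w, s4 u (J x v) w, s5 u (J x v) w,
      s1 u v (J x w), s2 u v (J x w), s3 u v (J x w), s4 u v (J x w), s5 u v (J x w),
      s1 (J x u) (J x v) w, s2 (J x u) (J x v) w, s3 (J x u) (J x v) w, s4 (J x u) (J x v) w,
      s5 (J x u) (J x v) w, s1 (J x u) v (J x w), s2 (J x u) v (J x w), s3 (J x u) v (J x w),
      s4 (J x u) v (J x w), s5 (J x u) v (J x w), s1 u (J x v) (J x w), s2 u (J x v) (J x w),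
      s3 u (J x v) (J x w), s4 u (J x v) (J x w), s5 u (J x v) (J x w),
      s1 (J x u) (J x v) (J x w), s2 (J x u) (J x v) (J x w), s3 (J x u) (J x v) (J x w),
      s4 (J x u) (J x v) (J x w), s5 (J x u) (J x v) (J x w)]
    ring
  rw [typePart_apply_three, typePart_apply_three]
  have k2 := key 2 (-Complex.I) (-Complex.I) Complex.I (by simp) (by simp) (by simp)
  have k1 := key 1 (-Complex.I) (Complex.I) Complex.I (by simp) (by simp) (by simp)
  change _ * (evalType J 2 α x ![u, v, w] - evalType J 2 α x ![v, u, w]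
      - evalType J 2 α x ![w, v, u] - evalType J 2 α x ![u, w, v]
      + evalType J 2 α x ![v, w, u] + evalType J 2 α x ![w, u, v]) -
    _ * (evalType J 1 α x ![u, v, w] - evalType J 1 α x ![v, u, w]
      - evalType J 1 α x ![w, v, u] - evalType J 1 α x ![u, w, v]
      + evalType J 1 α x ![v, w, u] + evalType J 1 α x ![w, u, v]) = _
  rw [k1, k2]
  have f2 : (((((2 : Fin 4) : ℕ).factorial : ℂ) * ((3 - ((2 : Fin 4) : ℕ)).factorial : ℂ))⁻¹) = 1 / 2 := by
    norm_num [Nat.factorial]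
  have f1 : (((((1 : Fin 4) : ℕ).factorial : ℂ) * ((3 - ((1 : Fin 4) : ℕ)).factorial : ℂ))⁻¹) = 1 / 2 := by
    norm_num [Nat.factorial]
  rw [f1, f2]
  ring_nf
  rw [hI3]
  ring

end TypeParts

/-! ### Calculus of differentials and smooth forms. -/

section FormCalculus

variable {E : Type*} [NormedAddCommGroup E] [NormedSpace ℝ E] [FiniteDimensional ℝ E]
  {M : Type*} [TopologicalSpace M] [ChartedSpace E M] [IsManifold 𝓘(ℝ, E) ∞ M] [T2Space M]

theorem exists_vfield (x : M) (v : T E M x) : ∃ X : VField E M, X x = v :=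
  exists_sec_apply_eq x v

theorem dfun_neg (f : M → ℝ) (x : M) : dfun (E := E) (fun y => -f y) x = -dfun f x :=
  mfderiv_neg

theorem dfun_add {f g : M → ℝ} (hf : ContMDiff 𝓘(ℝ, E) 𝓘(ℝ, ℝ) ∞ f)
    (hg : ContMDiff 𝓘(ℝ, E) 𝓘(ℝ, ℝ) ∞ g) (x : M) :
    dfun (E := E) (fun y => f y + g y) x = dfun f x + dfun g x :=
  mfderiv_add (hf.mdifferentiable (by simp) x) (hg.mdifferentiable (by simp) x)

theorem dfun_sub {f g : M → ℝ} (hf : ContMDiff 𝓘(ℝ, E) 𝓘(ℝ, ℝ) ∞ f)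
    (hg : ContMDiff 𝓘(ℝ, E) 𝓘(ℝ, ℝ) ∞ g) (x : M) :
    dfun (E := E) (fun y => f y - g y) x = dfun f x - dfun g x :=
  mfderiv_sub (hf.mdifferentiable (by simp) x) (hg.mdifferentiable (by simp) x)

theorem dfun_const (c : ℝ) (x : M) : dfun (E := E) (fun _ : M => c) x = 0 :=
  mfderiv_const

theorem dfun_mul {f g : M → ℝ} (hf : ContMDiff 𝓘(ℝ, E) 𝓘(ℝ, ℝ) ∞ f)
    (hg : ContMDiff 𝓘(ℝ, E) 𝓘(ℝ, ℝ) ∞ g) (x : M) :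
    dfun (E := E) (fun y => f y * g y) x = f x • dfun g x + g x • dfun f x :=
  (((hf.mdifferentiable (by simp) x).hasMFDerivAt).mul
    ((hg.mdifferentiable (by simp) x).hasMFDerivAt)).mfderiv

theorem dfun_const_mul (c : ℝ) {g : M → ℝ}
    (hg : ContMDiff 𝓘(ℝ, E) 𝓘(ℝ, ℝ) ∞ g) (x : M) :
    dfun (E := E) (fun y => c * g y) x = c • dfun g x := by
  rw [dfun_mul contMDiff_const hg, dfun_const, smul_zero, add_zero]

/-- Forms that agree on smooth vector fields are equal. -/
theorem formField_ext {G : Type*} [NormedAddCommGroup G] [NormedSpace ℝ G] {k : ℕ}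
    {α β : FormField E M G k}
    (h : ∀ (X : Fin k → VField E M) x, α x (fun i => X i x) = β x (fun i => X i x)) : α = β := by
  ext x v
  choose X hX using fun i => exists_vfield x (v i)
  have := h X x
  simpa only [hX] using this

theorem isSmoothForm_two {G : Type*} [NormedAddCommGroup G] [NormedSpace ℝ G]
    {α : FormField E M G 2} (h : ∀ X Y : VField E M,
      ContMDiff 𝓘(ℝ, E) 𝓘(ℝ, G) ∞ (fun x => α x ![X x, Y x])) : IsSmoothForm α := by
  intro X
  have := h (X 0) (X 1)
  have e : ∀ x, (fun i => X i x) = ![X 0 x, X 1 x] := fun x => vecTwo_eta _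
  simpa only [e] using this

theorem isSmoothForm_three {G : Type*} [NormedAddCommGroup G] [NormedSpace ℝ G]
    {α : FormField E M G 3} (h : ∀ X Y Z : VField E M,
      ContMDiff 𝓘(ℝ, E) 𝓘(ℝ, G) ∞ (fun x => α x ![X x, Y x, Z x])) : IsSmoothForm α := by
  intro X
  have := h (X 0) (X 1) (X 2)
  have e : ∀ x, (fun i => X i x) = ![X 0 x, X 1 x, X 2 x] := fun x => vecThree_eta _
  simpa only [e] using this

theorem IsSmoothForm.apply_two {G : Type*} [NormedAddCommGroup G] [NormedSpace ℝ G]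
    {α : FormField E M G 2} (h : IsSmoothForm α) (X Y : VField E M) :
    ContMDiff 𝓘(ℝ, E) 𝓘(ℝ, G) ∞ (fun x => α x ![X x, Y x]) := by
  have := h ![X, Y]
  have e : ∀ x, (fun i => (![X, Y] : Fin 2 → VField E M) i x) = ![X x, Y x] := fun x => vecTwo_eta _
  simpa only [e] using this

theorem IsSmoothForm.apply_three {G : Type*} [NormedAddCommGroup G] [NormedSpace ℝ G]
    {α : FormField E M G 3} (h : IsSmoothForm α) (X Y Z : VField E M) :
    ContMDiff 𝓘(ℝ, E) 𝓘(ℝ, G) ∞ (fun x => α x ![X x, Y x, Z x]) := by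
  have := h ![X, Y, Z]
  have e : ∀ x, (fun i => (![X, Y, Z] : Fin 3 → VField E M) i x) = ![X x, Y x, Z x] :=
    fun x => vecThree_eta _
  simpa only [e] using this

theorem formField_ext_four {G : Type*} [NormedAddCommGroup G] [NormedSpace ℝ G]
    {α β : FormField E M G 4}
    (h : ∀ (X Y Z W : VField E M) x,
      α x ![X x, Y x, Z x, W x] = β x ![X x, Y x, Z x, W x]) : α = β := by
  refine formField_ext fun X x => ?_
  have e : (fun i => X i x) = ![X 0 x, X 1 x, X 2 x, X 3 x] := by
    ext i; fin_cases i <;> rfl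
  rw [e]
  exact h _ _ _ _ _

theorem IsSmoothForm.neg {k : ℕ} {α : FormField E M ℝ k} (h : IsSmoothForm α) :
    IsSmoothForm (-α) := fun X => (h X).neg

theorem IsSmoothForm.add {k : ℕ} {α β : FormField E M ℝ k} (h : IsSmoothForm α)
    (h' : IsSmoothForm β) : IsSmoothForm (α + β) := fun X => (h X).add (h' X)

/-- The exterior derivative of a smooth 2-form is smooth. -/
theorem IsSmoothForm.d_two {α : FormField E M ℝ 2} (h : IsSmoothForm α) : IsSmoothForm (d α) := by
  refine isSmoothForm_three fun X Y Z => ?_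
  simp only [d_apply_two h]
  exact ((((((contMDiff_dfun (h.apply_two Y Z) X).sub (contMDiff_dfun (h.apply_two X Z) Y)).add
    (contMDiff_dfun (h.apply_two X Y) Z)).sub (h.apply_two (lie X Y) Z)).add
    (h.apply_two (lie X Z) Y)).sub (h.apply_two (lie Y Z) X))

theorem d_zero {G : Type*} [NormedAddCommGroup G] [NormedSpace ℝ G] {k : ℕ} :
    d (0 : FormField E M G k) = 0 := by
  have h : ∀ x₀, chartForm (0 : FormField E M G k) x₀ = fun _ => 0 := fun x₀ => by
    ext y v
    rfl
  funext x₀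
  rw [d, h]
  have h0 : extDeriv (fun _ : E => (0 : E [⋀^Fin k]→L[ℝ] G)) (extChartAt 𝓘(ℝ, E) x₀ x₀) = 0 := by
    ext v
    rw [extDeriv_apply (differentiableAt_const _)]
    simp
  rw [h0]
  rfl

theorem d_smul {k : ℕ} (c : ℝ) (α : FormField E M ℝ k) : d (c • α) = c • d α := by
  have h : ∀ x₀, chartForm (c • α) x₀ = c • chartForm α x₀ := fun x₀ => by
    ext y v
    rfl
  funext x₀
  rw [d, h, extDeriv_smul]
  rfl

theorem d_neg {k : ℕ} (α : FormField E M ℝ k) : d (-α) = -d α := by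
  rw [← neg_one_smul ℝ α, d_smul, neg_one_smul]

theorem d_toComplex {k : ℕ} {α : FormField E M ℝ k} (hα : IsSmoothForm α) :
    d (toComplex α) = toComplex (d α) := by
  refine formField_ext fun X x => ?_
  have hC : IsSmoothForm (toComplex α) := fun X =>
    Complex.ofRealCLM.contDiff.contMDiff.comp (hα X)
  rw [d_apply_eq_extDeriv _ x (fun i => X i), extDeriv_apply (differentiableAt_chartForm hC x)]
  change _ = ((d α x (fun i => X i x) : ℝ) : ℂ)
  rw [d_apply_eq_extDeriv α x (fun i => X i), extDeriv_apply (differentiableAt_chartForm hα x),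
    Complex.ofReal_sum]
  refine Finset.sum_congr rfl fun i _ => ?_
  set m := i.removeNth fun i => chartField (E := E) (X i) x (extChartAt 𝓘(ℝ, E) x x)
  have hd : DifferentiableAt ℝ (fun y => chartForm α x y m) (extChartAt 𝓘(ℝ, E) x x) :=
    (differentiableAt_chartForm hα x).continuousAlternatingMap_apply
      fun _ => differentiableAt_const _
  have hf : fderiv ℝ (fun y => chartForm (toComplex α) x y m) (extChartAt 𝓘(ℝ, E) x x) =
      Complex.ofRealCLM.comp (fderiv ℝ (fun y => chartForm α x y m) (extChartAt 𝓘(ℝ, E) x x)) :=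
    (Complex.ofRealCLM.hasFDerivAt.comp _ hd.hasFDerivAt).fderiv
  rw [hf]
  simp

end FormCalculus

/-! ### Hermitian geometry: the Nijenhuis tensor, dω and d^cω. -/

section Hermitian

variable {E : Type*} [NormedAddCommGroup E] [NormedSpace ℝ E] [FiniteDimensional ℝ E]
  {M : Type*} [TopologicalSpace M] [ChartedSpace E M] [IsManifold 𝓘(ℝ, E) ∞ M] [T2Space M]

theorem contMDiff_inner (g : ContMDiffRiemannianMetric 𝓘(ℝ, E) ∞ E (T E M)) (X Y : VField E M) :
    ContMDiff 𝓘(ℝ, E) 𝓘(ℝ, ℝ) ∞ (fun x => g.inner x (X x) (Y x)) := by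
  have : ContMDiff 𝓘(ℝ, E) (𝓘(ℝ, E).prod 𝓘(ℝ)) ∞
      (fun x => TotalSpace.mk' ℝ (E := Bundle.Trivial M ℝ) x (g.inner x (X x) (Y x))) :=
    ContMDiff.clm_bundle_apply₂ (F₁ := E) (F₂ := E) g.contMDiff X.contMDiff Y.contMDiff
  intro x
  exact (contMDiffAt_totalSpace.1 (this x)).2

namespace HermitianStructure

variable (S : HermitianStructure E M)

/-- The vector field `J X`. -/
def Jf (X : VField E M) : VField E M := ⟨fun x => S.J x (X x), S.smooth_J X⟩

theorem Jf_apply (X : VField E M) (x : M) : S.Jf X x = S.J x (X x) := rfl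

theorem Jf_Jf (X : VField E M) : S.Jf (S.Jf X) = -X := by
  ext x
  exact S.J_sq x (X x)

theorem lie_neg_left (X Y : VField E M) (x : M) : lie (-X) Y x = -lie X Y x := by
  have h := VectorField.mlieBracket_const_smul_left (I := 𝓘(ℝ, E)) (c := (-1 : ℝ)) (V := X) (W := Y)
    (x := x) (X.contMDiff.mdifferentiable (by simp) x)
  rw [neg_one_smul, neg_one_smul] at h
  exact h

theorem lie_neg_right (X Y : VField E M) (x : M) : lie X (-Y) x = -lie X Y x := by
  have h := VectorField.mlieBracket_const_smul_right (I := 𝓘(ℝ, E)) (c := (-1 : ℝ)) (V := X) (W := Y)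
    (x := x) (Y.contMDiff.mdifferentiable (by simp) x)
  rw [neg_one_smul, neg_one_smul] at h
  exact h

theorem inner_J_left (x : M) (u v : T E M x) : S.g.inner x (S.J x u) v = -S.g.inner x u (S.J x v) := by
  have h := S.hermitian x u (S.J x v)
  rw [S.J_sq, map_neg] at h
  linarith

theorem omega_apply (x : M) (u v : T E M x) : S.omega x ![u, v] = S.g.inner x (S.J x u) v := rfl

theorem omega_J_right (x : M) (u v : T E M x) : S.omega x ![u, S.J x v] = S.g.inner x u v := by
  rw [omega_apply, S.hermitian]

theorem isSmoothForm_omega : IsSmoothForm S.omega :=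
  isSmoothForm_two fun X Y => contMDiff_inner S.g (S.Jf X) Y

/-- The Nijenhuis tensor of `J` vanishes. -/
theorem lie_Jf_Jf (X Y : VField E M) (x : M) :
    lie (S.Jf X) (S.Jf Y) x = lie X Y x + S.J x (lie (S.Jf X) Y x) + S.J x (lie X (S.Jf Y) x) := by
  -- The field `X - i J X` is twice the (1,0)-part of `X`. The imaginary part of the bracket of two
  -- such fields gives the Nijenhuis identity.
  have hX : ∀ X : VField E M, IsHolField S.J X (-S.Jf X : VField E M) := by
    intro X x
    refine ⟨?_, ?_⟩
    · change _ = - - S.J x (X x)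
      rw [neg_neg]
    · change S.J x (-(S.J x (X x))) = X x
      rw [map_neg, S.J_sq, neg_neg]
  have h := (S.integrable X (-S.Jf X) Y (-S.Jf Y) (hX X) (hX Y) x).2
  change S.J x (lie X (-S.Jf Y) x + lie (-S.Jf X) Y x) =
    lie X Y x - lie (-S.Jf X) (-S.Jf Y) x at h
  rw [lie_neg_left, lie_neg_left, lie_neg_right, lie_neg_right, map_add, map_neg, map_neg,
    neg_neg] at h
  have h2 : lie (S.Jf X) (S.Jf Y) x = lie X Y x - (-S.J x (lie X (S.Jf Y) x) +
      -S.J x (lie (S.Jf X) Y x)) := by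
    rw [h]; abel
  rw [h2]; abel

/-- The derivative of the function `g(Y, Z)` along `X`. -/
def dg (X Y Z : VField E M) (x : M) : ℝ := dfun (fun y => S.g.inner y (Y y) (Z y)) x (X x)

/-- With `J` in the last slot, ω(·, J·) = g turns terms of the invariant formula for dω into terms
in the metric, which can be compared with the Koszul expression. -/
theorem d_omega_J (X Y Z : VField E M) (x : M) :
    d S.omega x ![X x, Y x, S.J x (Z x)] = S.dg X Y Z x - S.dg Y X Z x + S.dg (S.Jf Z) (S.Jf X) Y x
      - S.g.inner x (lie X Y x) (Z x) + S.g.inner x (S.J x (lie X (S.Jf Z) x)) (Y x)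
      - S.g.inner x (S.J x (lie Y (S.Jf Z) x)) (X x) := by
  have h := d_apply_two S.isSmoothForm_omega X Y (S.Jf Z) x
  simp only [Jf_apply, omega_J_right] at h
  rw [h]
  rfl

theorem d_omega_JJJ (X Y Z : VField E M) (x : M) :
    d S.omega x ![S.J x (X x), S.J x (Y x), S.J x (Z x)] = S.dg (S.Jf X) (S.Jf Y) Z x
      - S.dg (S.Jf Y) (S.Jf X) Z x + S.dg (S.Jf Z) (S.Jf X) Y x
      - S.g.inner x (lie (S.Jf X) (S.Jf Y) x) (Z x)
      + S.g.inner x (lie (S.Jf X) (S.Jf Z) x) (Y x)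
      - S.g.inner x (lie (S.Jf Y) (S.Jf Z) x) (X x) := by
  have h := d_apply_two S.isSmoothForm_omega (S.Jf X) (S.Jf Y) (S.Jf Z) x
  simp only [Jf_apply, omega_J_right] at h
  rw [h]
  rfl

/-- This says that dω has no (3,0)- or (0,3)-part: on type (2,1) both sides multiply by `i`, on type
(3,0) by `3i` and `-i`. For the (1,1)-form ω it expresses integrability, which enters through the
three Nijenhuis identities. -/
theorem d_omega_J_cyclic (X Y Z : VField E M) (x : M) :
    d S.omega x ![S.J x (X x), Y x, Z x] + d S.omega x ![X x, S.J x (Y x), Z x]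
      + d S.omega x ![X x, Y x, S.J x (Z x)] =
    d S.omega x ![S.J x (X x), S.J x (Y x), S.J x (Z x)] := by
  have r1 : d S.omega x ![S.J x (X x), Y x, Z x] = d S.omega x ![Y x, Z x, S.J x (X x)] :=
    (alternating_three_rotate _ _ _ _).symm
  have r2 : d S.omega x ![X x, S.J x (Y x), Z x] = d S.omega x ![Z x, X x, S.J x (Y x)] :=
    alternating_three_rotate _ _ _ _
  have sym : ∀ W X Y : VField E M, S.dg W X Y x = S.dg W Y X x := fun W X Y => by
    simp only [dg, S.g.symm _ (X _)]
  have anti : ∀ W X Y : VField E M, S.dg W (S.Jf X) Y x = -S.dg W (S.Jf Y) X x := fun W X Y => by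
    simp only [dg, Jf_apply, S.inner_J_left _ (X _), S.g.symm _ (X _)]
    rw [dfun_neg]
    rfl
  have lswap : ∀ X Y : VField E M, lie X Y x = -lie Y X x :=
    fun X Y => VectorField.mlieBracket_swap_apply
  have nXY := congrArg (fun v => S.g.inner x v (Z x)) (S.lie_Jf_Jf X Y x)
  have nXZ := congrArg (fun v => S.g.inner x v (Y x)) (S.lie_Jf_Jf X Z x)
  have nYZ := congrArg (fun v => S.g.inner x v (X x)) (S.lie_Jf_Jf Y Z x)
  rw [r1, r2, d_omega_J, d_omega_J, d_omega_J, d_omega_JJJ]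
  rw [sym Y Z X, sym Z Y X, sym X Z Y, anti (S.Jf Y) Z X, lswap Y (S.Jf X), lswap Z (S.Jf X),
    lswap Z X, lswap Z (S.Jf Y)]
  simp only [map_add, map_neg, _root_.add_apply, _root_.neg_apply] at nXY nXZ nYZ ⊢
  linarith

/-- As ω is `J`-invariant, it has type (1,1), so ∂ω and ∂̄ω are the (2,1)- and (1,2)-parts of dω. In
their difference the cyclic sum equals the term with three `J`'s, and the factor 1 + 3 cancels the 4
in the denominator. -/
theorem dc_omega_apply (x : M) (u v w : T E M x) :
    dc S.J S.omega x ![u, v, w] = -d S.omega x ![S.J x u, S.J x v, S.J x w] := by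
  have hinv : ∀ x (u v : T E M x),
      toComplex S.omega x ![S.J x u, S.J x v] = toComplex S.omega x ![u, v] := by
    intro x u v
    change ((S.omega x ![S.J x u, S.J x v] : ℝ) : ℂ) = ((S.omega x ![u, v] : ℝ) : ℂ)
    rw [omega_J_right, omega_apply]
  obtain ⟨h0, h1, h2⟩ := typePart_of_invariant S.J_sq hinv
  have hz : ∀ p : Fin 4, typePart S.J p (0 : FormField E M ℂ 3) = 0 := by
    intro p
    funext y
    have : evalType S.J p (0 : FormField E M ℂ 3) y = 0 := by
      ext m
      simp [evalType]
    rw [typePart, this]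
    ext m
    simp
  have hdel : del S.J (toComplex S.omega) = typePart S.J (2 : Fin 4) (toComplex (d S.omega)) := by
    rw [del, Fin.sum_univ_three, h0, h1, h2, d_zero, d_toComplex S.isSmoothForm_omega, hz, hz,
      zero_add, add_zero]
    rfl
  have hdelbar : delbar S.J (toComplex S.omega) =
      typePart S.J (1 : Fin 4) (toComplex (d S.omega)) := by
    rw [delbar, Fin.sum_univ_three, h0, h1, h2, d_zero, d_toComplex S.isSmoothForm_omega, hz, hz,
      zero_add, add_zero]
    rfl
  change ((-Complex.I) * (del S.J (toComplex S.omega) x ![u, v, w] -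
    delbar S.J (toComplex S.omega) x ![u, v, w])).re = _
  rw [hdel, hdelbar, typePart_two_sub_one]
  obtain ⟨X, rfl⟩ := exists_vfield x u
  obtain ⟨Y, rfl⟩ := exists_vfield x v
  obtain ⟨Z, rfl⟩ := exists_vfield x w
  have hc := S.d_omega_J_cyclic X Y Z x
  change ((-Complex.I) * (-(Complex.I / 4) * (
    ((d S.omega x ![S.J x (X x), Y x, Z x] : ℝ) : ℂ) + ((d S.omega x ![X x, S.J x (Y x), Z x] : ℝ) : ℂ)
      + ((d S.omega x ![X x, Y x, S.J x (Z x)] : ℝ) : ℂ) +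
    3 * ((d S.omega x ![S.J x (X x), S.J x (Y x), S.J x (Z x)] : ℝ) : ℂ)))).re = _
  rw [← Complex.ofReal_add, ← Complex.ofReal_add, hc]
  have : (-Complex.I) * (-(Complex.I / 4) * (
      ((d S.omega x ![S.J x (X x), S.J x (Y x), S.J x (Z x)] : ℝ) : ℂ) +
      3 * ((d S.omega x ![S.J x (X x), S.J x (Y x), S.J x (Z x)] : ℝ) : ℂ))) =
      ((-d S.omega x ![S.J x (X x), S.J x (Y x), S.J x (Z x)] : ℝ) : ℂ) := by
    push_cast
    linear_combination ((d S.omega x ![S.J x (X x), S.J x (Y x), S.J x (Z x)] : ℝ) : ℂ) *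
      Complex.I_mul_I
  rw [this, Complex.ofReal_re]

theorem isSmoothForm_dc_omega : IsSmoothForm (dc S.J S.omega) := by
  refine isSmoothForm_three fun X Y Z => ?_
  simp only [dc_omega_apply]
  exact ((S.isSmoothForm_omega.d_two).apply_three (S.Jf X) (S.Jf Y) (S.Jf Z)).neg

/-- The combination of Lie derivatives of `g` that occurs in the bracket of lifts to `V₊`. -/
def koszul (X Y Z : VField E M) (x : M) : ℝ :=
  S.dg X Y Z x - S.dg Y X Z x + S.dg Z X Y x - S.g.inner x (lie X Y x) (Z x)
    - S.g.inner x (Y x) (lie X Z x) + S.g.inner x (X x) (lie Y Z x)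

/-- The torsion `-d^c ω` is characterized by the failure of the Levi-Civita connection to preserve
`J`. -/
theorem koszul_sub_koszul (X Y Z : VField E M) (x : M) :
    S.koszul X Y Z x - S.koszul (S.Jf X) (S.Jf Y) Z x =
      dc S.J S.omega x ![X x, Y x, Z x] - dc S.J S.omega x ![S.J x (X x), S.J x (Y x), Z x] := by
  have h1 : d S.omega x ![S.J x (S.J x (X x)), S.J x (S.J x (Y x)), S.J x (Z x)] =
      d S.omega x ![X x, Y x, S.J x (Z x)] := by
    rw [S.J_sq, S.J_sq, alternating_three_neg_zero, alternating_three_neg_one, neg_neg]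
  have inv : ∀ W X Y : VField E M, S.dg W (S.Jf X) (S.Jf Y) x = S.dg W X Y x := fun W X Y => by
    simp only [dg, Jf_apply, S.hermitian]
  have nXZ := congrArg (fun v => S.g.inner x v (Y x)) (S.lie_Jf_Jf X Z x)
  have nYZ := congrArg (fun v => S.g.inner x v (X x)) (S.lie_Jf_Jf Y Z x)
  -- In classical terms `koszul X Y Z` is 2g(D_Z X, Y) for the Levi-Civita connection D, so the left
  -- side is −2g((D_Z J)X, JY). After the expansion only the Nijenhuis identities for (X, Z) and (Y,
  -- Z) are needed.
  rw [dc_omega_apply, dc_omega_apply, h1, d_omega_J, d_omega_JJJ, koszul, koszul, inv]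
  simp only [map_add, _root_.add_apply, S.inner_J_left _ (lie _ _ _)] at nXZ nYZ ⊢
  rw [S.g.symm x (Y x), S.g.symm x (X x), S.g.symm x (S.Jf Y x), S.g.symm x (S.Jf X x)]
  simp only [Jf_apply]
  linarith

end HermitianStructure

end Hermitian

/-! ### Two-forms from alternating bilinear forms. -/

section TwoForm

variable {E : Type*} [NormedAddCommGroup E] [NormedSpace ℝ E] [FiniteDimensional ℝ E]
  {M : Type*} [TopologicalSpace M] [ChartedSpace E M]

/-- The form defined by an alternating bilinear form on each tangent space. -/
def twoForm (b : ∀ x, T E M x →ₗ[ℝ] T E M x →ₗ[ℝ] ℝ) (hb : ∀ x v, b x v v = 0) :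
    FormField E M ℝ 2 := fun x =>
  { toFun := fun v => b x (v 0) (v 1)
    map_update_add' := by
      intro _ m i a b
      fin_cases i <;> simp [Function.update]
    map_update_smul' := by
      intro _ m i c a
      fin_cases i <;> simp [Function.update]
    cont := by
      let B : E →ₗ[ℝ] E →ₗ[ℝ] ℝ := b x
      have hc : Continuous fun v : Fin 2 → E => ((v 0, v 1) : E × E) := by fun_prop
      exact (LinearMap.toContinuousBilinearMap B).continuous₂.comp hc
    map_eq_zero_of_eq' := by
      intro v i j h hij
      have h01 : v 0 = v 1 := by
        fin_cases i <;> fin_cases j <;> simp_all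
      simpa [h01] using hb x (v 1) }

end TwoForm

/-! ### Exact Courant algebroids: curvature and characteristic class. -/

namespace CourantAlgebroid

variable {E : Type*} [NormedAddCommGroup E] [NormedSpace ℝ E] [FiniteDimensional ℝ E]
  {M : Type*} [TopologicalSpace M] [ChartedSpace E M] [IsManifold 𝓘(ℝ, E) ∞ M] [T2Space M]
  {F : Type*} [NormedAddCommGroup F] [NormedSpace ℝ F]
  {V : M → Type*} [TopologicalSpace (TotalSpace F V)]
  [∀ x, AddCommGroup (V x)] [∀ x, Module ℝ (V x)] [∀ x, TopologicalSpace (V x)]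
  [FiberBundle F V] [VectorBundle ℝ F V]

variable (A : CourantAlgebroid E F V)

/-- The vector field `π e` of a section `e`. -/
def anchorField (e : Sec E F V) : VField E M := ⟨fun x => A.anchor x (e x), A.smooth_anchor e⟩

theorem anchorField_apply (e : Sec E F V) (x : M) : A.anchorField e x = A.anchor x (e x) := rfl

theorem anchor_bracket_apply (a b : Sec E F V) (x : M) :
    A.anchor x (A.bracket a b x) = lie (A.anchorField a) (A.anchorField b) x :=
  A.anchor_bracket a b x

theorem bracket_add_add_apply (a b a' b' : Sec E F V) (x : M) :
    A.bracket (a + b) (a' + b') x = A.bracket a a' x + A.bracket a b' x +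
      (A.bracket b a' x + A.bracket b b' x) := by
  have h : A.bracket (a + b) (a' + b') = A.bracket a a' + A.bracket a b' +
      (A.bracket b a' + A.bracket b b') := by
    rw [LinearMap.map_add₂, map_add, map_add]
  rw [h]
  rfl

/-- The symmetric part of the bracket. -/
theorem pairing_bracket_add_swap (a b c : Sec E F V) (x : M) :
    A.pairing x (A.bracket a b x) (c x) + A.pairing x (A.bracket b a x) (c x) =
      dfun (fun y => A.pairing y (a y) (b y)) x (A.anchor x (c x)) := by
  have key : ∀ e : Sec E F V, A.pairing x (A.bracket e e x) (c x) =
      1 / 2 * dfun (fun y => A.pairing y (e y) (e y)) x (A.anchor x (c x)) := by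
    intro e
    rw [A.bracket_self, map_smul, LinearMap.smul_apply, A.pairing_coanchor, smul_eq_mul]
  -- Polarization of the axiom for `[e, e]`.
  have h := key (a + b)
  have e2 : (fun y => A.pairing y ((a + b) y) ((a + b) y)) = fun y =>
      (A.pairing y (a y) (a y) + A.pairing y (b y) (b y)) + 2 * A.pairing y (a y) (b y) := by
    funext y
    change A.pairing y (a y + b y) (a y + b y) = _
    simp only [map_add, LinearMap.add_apply]
    rw [A.symm y (b y) (a y)]
    ring
  rw [A.bracket_add_add_apply, e2, dfun_add
    (f := fun y => A.pairing y (a y) (a y) + A.pairing y (b y) (b y))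
    (g := fun y => 2 * A.pairing y (a y) (b y))
    ((A.smooth_pairing a a).add (A.smooth_pairing b b))
    (contMDiff_const.mul (A.smooth_pairing a b)), dfun_add (A.smooth_pairing a a)
    (A.smooth_pairing b b), dfun_const_mul 2 (A.smooth_pairing a b)] at h
  simp only [map_add, LinearMap.add_apply, key] at h
  simp only [_root_.add_apply, _root_.smul_apply, smul_eq_mul] at h
  linarith

/-- Exactness writes a vertical vector as π*ξ, and pairing with π*ξ is ξ ∘ π. In particular the
kernel of the anchor is isotropic, a fact used throughout. -/
theorem pairing_anchor_congr {A : CourantAlgebroid E F V} (hA : A.IsExact) {x : M} {u e e' : V x}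
    (hu : A.anchor x u = 0) (he : A.anchor x e = A.anchor x e') :
    A.pairing x u e = A.pairing x u e' := by
  obtain ⟨ξ, rfl⟩ := ((hA x).2.2 u).1 hu
  rw [A.pairing_coanchor, A.pairing_coanchor, he]

theorem pairing_eq_zero {A : CourantAlgebroid E F V} (hA : A.IsExact) {x : M} {u w : V x}
    (hu : A.anchor x u = 0) (hw : A.anchor x w = 0) : A.pairing x u w = 0 := by
  rw [pairing_anchor_congr hA hu (hw.trans (map_zero (A.anchor x)).symm), map_zero]

/-- A vertical vector that pairs to zero with enough vectors vanishes. -/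
theorem eq_zero_of_pairing {A : CourantAlgebroid E F V} (hA : A.IsExact) {x : M} {u : V x}
    (hu : A.anchor x u = 0) (h : ∀ v : T E M x, ∃ e, A.anchor x e = v ∧ A.pairing x u e = 0) :
    u = 0 := by
  refine A.nondegenerate x u fun e => ?_
  obtain ⟨e', he', h0⟩ := h (A.anchor x e)
  rw [pairing_anchor_congr hA hu he'.symm, h0]

namespace IsotropicSplitting

variable {A}

theorem anchorField_lift (N : A.IsotropicSplitting) (X : VField E M) :
    A.anchorField (N.lift X) = X := by
  ext x
  exact N.anchor_nab x (X x)

theorem lift_apply (N : A.IsotropicSplitting) (X : VField E M) (x : M) :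
    N.lift X x = N.nab x (X x) := rfl

/-- The curvature `2 ⟨[∇X, ∇Y], ∇Z⟩` as a function of vector fields. -/
def curv (N : A.IsotropicSplitting) (X Y Z : VField E M) (x : M) : ℝ :=
  2 * A.pairing x (A.bracket (N.lift X) (N.lift Y) x) (N.nab x (Z x))

/-- The symmetric part of the bracket is the differential of a pairing, which vanishes on isotropic
lifts. The companion `curv_swap'` follows in the same way from invariance of the pairing. -/
theorem curv_swap (N : A.IsotropicSplitting) (X Y Z : VField E M) (x : M) :
    N.curv X Y Z x = -N.curv Y X Z x := by
  have h := A.pairing_bracket_add_swap (N.lift X) (N.lift Y) (N.lift Z) x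
  simp only [lift_apply, N.isotropic, dfun_const] at h
  have h' : (0 : T E M x →L[ℝ] ℝ) (A.anchor x (N.nab x (Z x))) = 0 := rfl
  rw [h'] at h
  simp only [curv]
  linarith

theorem curv_swap' (N : A.IsotropicSplitting) (X Y Z : VField E M) (x : M) :
    N.curv X Y Z x = -N.curv X Z Y x := by
  have h := A.invariance (N.lift X) (N.lift Y) (N.lift Z) x
  simp only [lift_apply, N.isotropic, dfun_const] at h
  have h' : (0 : T E M x →L[ℝ] ℝ) (A.anchor x (N.nab x (X x))) = 0 := rfl
  rw [h', A.symm x (N.nab x (Y x))] at h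
  simp only [curv]
  linarith

theorem anchor_bracket_lift (N : A.IsotropicSplitting) (X Y : VField E M) (x : M) :
    A.anchor x (A.bracket (N.lift X) (N.lift Y) x) = lie X Y x := by
  rw [A.anchor_bracket_apply, N.anchorField_lift, N.anchorField_lift]

/-- Each bracket differs from the lift of the Lie bracket by a vertical vector, and two vertical
vectors pair to zero. -/
theorem pairing_bracket_bracket (hA : A.IsExact) (N : A.IsotropicSplitting)
    (X Y Z W : VField E M) (x : M) :
    2 * A.pairing x (A.bracket (N.lift X) (N.lift Y) x) (A.bracket (N.lift Z) (N.lift W) x) =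
      N.curv X Y (lie Z W) x + N.curv Z W (lie X Y) x := by
  have h0 : A.pairing x (A.bracket (N.lift X) (N.lift Y) x - N.nab x (lie X Y x))
      (A.bracket (N.lift Z) (N.lift W) x - N.nab x (lie Z W x)) = 0 :=
    pairing_eq_zero hA
      (by rw [map_sub, N.anchor_bracket_lift, N.anchor_nab, sub_self])
      (by rw [map_sub, N.anchor_bracket_lift, N.anchor_nab, sub_self])
  simp only [map_sub, LinearMap.sub_apply, N.isotropic] at h0
  rw [A.symm x (N.nab x (lie X Y x))] at h0
  simp only [curv]
  linarith

/-- The curvature of a splitting is closed. -/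
theorem d_eq_zero_of_isCurvature (hA : A.IsExact) (N : A.IsotropicSplitting)
    {H : FormField E M ℝ 3} (hH : N.IsCurvature H) (hs : IsSmoothForm H) : d H = 0 := by
  have hc : ∀ (X Y Z : VField E M) x, H x ![X x, Y x, Z x] = N.curv X Y Z x := hH
  refine formField_ext_four fun X Y Z W x => ?_
  have h0 : (0 : FormField E M ℝ 4) x ![X x, Y x, Z x, W x] = 0 := rfl
  rw [h0, d_apply_three hs]
  simp only [hc]
  -- Pair the Jacobi identity with ∇W. Invariance turns a nested bracket into a derivative of the
  -- curvature minus a pairing of two brackets, which is again expressed by curvature.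
  have main : ∀ X Y Z W : VField E M,
      2 * A.pairing x (A.bracket (N.lift X) (A.bracket (N.lift Y) (N.lift Z)) x) (N.lift W x) =
      dfun (N.curv Y Z W) x (X x) - N.curv Y Z (lie X W) x - N.curv X W (lie Y Z) x := by
    intro X Y Z W
    have h1 := A.invariance (N.lift X) (A.bracket (N.lift Y) (N.lift Z)) (N.lift W) x
    have h2 := N.pairing_bracket_bracket hA Y Z X W x
    have h3 : dfun (N.curv Y Z W) x (X x) = 2 * dfun (fun y =>
        A.pairing y (A.bracket (N.lift Y) (N.lift Z) y) (N.lift W y)) x (X x) := by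
      have := dfun_const_mul (E := E) 2 (A.smooth_pairing (A.bracket (N.lift Y) (N.lift Z)) (N.lift W)) x
      exact DFunLike.congr_fun this (X x)
    rw [lift_apply, N.anchor_nab] at h1
    linarith
  have j := congrArg (fun e : Sec E F V => A.pairing x (e x) (N.lift W x))
    (A.jacobi (N.lift X) (N.lift Y) (N.lift Z))
  change A.pairing x (A.bracket (N.lift X) (A.bracket (N.lift Y) (N.lift Z)) x) (N.lift W x) =
    A.pairing x (A.bracket (A.bracket (N.lift X) (N.lift Y)) (N.lift Z) x +
      A.bracket (N.lift Y) (A.bracket (N.lift X) (N.lift Z)) x) (N.lift W x) at j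
  -- The term [[∇X, ∇Y], ∇Z] is nested on the left. Swapping its entries brings it to the form
  -- handled by `main` and produces the missing derivative of H(X, Y, Z) along W.
  have hsw := A.pairing_bracket_add_swap (A.bracket (N.lift X) (N.lift Y)) (N.lift Z) (N.lift W) x
  have h3 : dfun (N.curv X Y Z) x (W x) = 2 * dfun (fun y =>
      A.pairing y (A.bracket (N.lift X) (N.lift Y) y) (N.lift Z y)) x (W x) := by
    have := dfun_const_mul (E := E) 2 (A.smooth_pairing (A.bracket (N.lift X) (N.lift Y)) (N.lift Z)) x
    exact DFunLike.congr_fun this (W x)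
  have h4 : A.anchor x (N.lift W x) = W x := N.anchor_nab x _
  rw [h4] at hsw
  rw [map_add, LinearMap.add_apply] at j
  have m1 := main X Y Z W
  have m2 := main Y X Z W
  have m3 := main Z X Y W
  have rot : ∀ X Y Z : VField E M, N.curv X Y Z x = N.curv Y Z X x := fun X Y Z => by
    rw [N.curv_swap, N.curv_swap', neg_neg]
  rw [rot (lie X Y) Z W, rot (lie X Z) Y W, rot (lie X W) Y Z, rot (lie Y Z) X W,
    rot (lie Y W) X Z, rot (lie Z W) X Y]
  linarith

/-- The bracket of perturbed lifts. -/
theorem pairing_bracket_lift_add (hA : A.IsExact) (N : A.IsotropicSplitting) (X Y Z : VField E M)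
    (u v w : Sec E F V) (hu : ∀ x, A.anchor x (u x) = 0) (hv : ∀ x, A.anchor x (v x) = 0)
    (hw : ∀ x, A.anchor x (w x) = 0) (x : M) :
    2 * A.pairing x (A.bracket (N.lift X + u) (N.lift Y + v) x) ((N.lift Z + w) x) =
      N.curv X Y Z x + 2 * (A.pairing x (w x) (N.nab x (lie X Y x))
        + dfun (fun y => A.pairing y (v y) (N.nab y (Z y))) x (X x)
        - A.pairing x (v x) (N.nab x (lie X Z x))
        - dfun (fun y => A.pairing y (u y) (N.nab y (Z y))) x (Y x)
        + A.pairing x (u x) (N.nab x (lie Y Z x))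
        + dfun (fun y => A.pairing y (u y) (N.nab y (Y y))) x (Z x)) := by
  have hz : ∀ (e u : Sec E F V), (∀ x, A.anchor x (u x) = 0) →
      A.anchor x (A.bracket e u x) = 0 := by
    intro e u hu
    have : A.anchorField u = 0 := by ext x; exact hu x
    rw [A.anchor_bracket_apply, this]
    change VectorField.mlieBracket 𝓘(ℝ, E) _ 0 x = 0
    rw [VectorField.mlieBracket_zero_right]
    rfl
  have hz' : ∀ (e u : Sec E F V), (∀ x, A.anchor x (u x) = 0) →
      A.anchor x (A.bracket u e x) = 0 := by
    intro e u hu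
    have : A.anchorField u = 0 := by ext x; exact hu x
    rw [A.anchor_bracket_apply, this]
    change VectorField.mlieBracket 𝓘(ℝ, E) 0 _ x = 0
    rw [VectorField.mlieBracket_zero_left]
    rfl
  -- For v = π*η this says that [∇X, π*η] pairs like the Lie derivative of η along X.
  have r1 : ∀ (X Z : VField E M) (v : Sec E F V), (∀ x, A.anchor x (v x) = 0) →
      A.pairing x (A.bracket (N.lift X) v x) (N.lift Z x) =
      dfun (fun y => A.pairing y (v y) (N.nab y (Z y))) x (X x) -
        A.pairing x (v x) (N.nab x (lie X Z x)) := by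
    intro X Z v hv
    have h := A.invariance (N.lift X) v (N.lift Z) x
    rw [lift_apply N X, N.anchor_nab] at h
    rw [pairing_anchor_congr hA (e := N.nab x (lie X Z x)) (hv x)
      ((N.anchor_nab x _).trans (N.anchor_bracket_lift X Z x).symm)]
    simp only [lift_apply] at h ⊢
    linarith
  have r2 := A.pairing_bracket_add_swap u (N.lift Y) (N.lift Z) x
  rw [lift_apply N Z, N.anchor_nab] at r2
  -- Invariance moves `u` to the other argument, leaving a pairing of two vertical vectors.
  have r3 : A.pairing x (A.bracket u v x) (N.lift Z x) = 0 := by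
    have h := A.invariance u v (N.lift Z) x
    rw [hu, map_zero, pairing_eq_zero hA (hv x) (hz' _ _ hu), add_zero] at h
    exact h.symm
  have r4 : A.pairing x (A.bracket (N.lift X) (N.lift Y) x) (w x) =
      A.pairing x (w x) (N.nab x (lie X Y x)) := by
    rw [A.symm]
    exact pairing_anchor_congr hA (hw x)
      ((N.anchor_bracket_lift X Y x).trans (N.anchor_nab x _).symm)
  have e2 : (N.lift Z + w) x = N.nab x (Z x) + w x := rfl
  rw [A.bracket_add_add_apply, e2]
  simp only [map_add, LinearMap.add_apply]
  rw [r4, pairing_eq_zero hA (hz _ _ hv) (hw x), pairing_eq_zero hA (hz' _ _ hu) (hw x),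
    pairing_eq_zero hA (hz _ _ hv) (hw x)]
  have s1 := r1 X Z v hv
  have s2 := r1 Y Z u hu
  simp only [lift_apply] at s1 s2 r2 r3
  rw [s1, r3]
  simp only [curv]
  linarith

/-- The difference of two splittings as a 2-form. -/
def diffForm (hA : A.IsExact) (N N' : A.IsotropicSplitting) : FormField E M ℝ 2 :=
  twoForm (fun x => (A.pairing x).compl₁₂ (N'.nab x) (N.nab x)) fun x v => by
    have h := pairing_eq_zero hA (x := x) (u := N'.nab x v - N.nab x v) (w := N'.nab x v - N.nab x v)
      (by rw [map_sub, N.anchor_nab, N'.anchor_nab, sub_self])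
      (by rw [map_sub, N.anchor_nab, N'.anchor_nab, sub_self])
    simp only [map_sub, LinearMap.sub_apply, N.isotropic, N'.isotropic] at h
    rw [A.symm x (N.nab x v)] at h
    rw [LinearMap.compl₁₂_apply]
    linarith

theorem diffForm_apply (hA : A.IsExact) (N N' : A.IsotropicSplitting) (x : M) (v w : T E M x) :
    diffForm hA N N' x ![v, w] = A.pairing x (N'.nab x v) (N.nab x w) := rfl

theorem isSmoothForm_diffForm (hA : A.IsExact) (N N' : A.IsotropicSplitting) :
    IsSmoothForm (diffForm hA N N') :=
  isSmoothForm_two fun X Y => A.smooth_pairing (N'.lift X) (N.lift Y)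

/-- A change of the splitting changes the curvature by an exact form. -/
theorem curv_eq_add_d_diffForm (hA : A.IsExact) (N N' : A.IsotropicSplitting) (X Y Z : VField E M)
    (x : M) :
    N'.curv X Y Z x = N.curv X Y Z x + 2 * d (diffForm hA N N') x ![X x, Y x, Z x] := by
  have hv : ∀ (X : VField E M) x, A.anchor x ((N'.lift X - N.lift X) x) = 0 := fun X x => by
    change A.anchor x (N'.nab x (X x) - N.nab x (X x)) = 0
    rw [map_sub, N.anchor_nab, N'.anchor_nab, sub_self]
  have h := N.pairing_bracket_lift_add hA X Y Z _ _ _ (hv X) (hv Y) (hv Z) x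
  have e : ∀ (X : VField E M) y w, A.pairing y ((N'.lift X - N.lift X) y) (N.nab y w) =
      diffForm hA N N' y ![X y, w] := fun X y w => by
    change A.pairing y (N'.nab y (X y) - N.nab y (X y)) (N.nab y w) = _
    rw [map_sub, LinearMap.sub_apply, N.isotropic, sub_zero]
    rfl
  have e' : ∀ X, N.lift X + (N'.lift X - N.lift X) = N'.lift X := fun X => by abel
  rw [e', e', e'] at h
  simp only [e] at h
  rw [curv, d_apply_two (isSmoothForm_diffForm hA N N')]
  rw [alternating_two_swap _ (Z x) (lie X Y x), alternating_two_swap _ (Y x) (lie X Z x),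
    alternating_two_swap _ (X x) (lie Y Z x)]
  rw [lift_apply] at h
  linarith

/-- The characteristic class can be computed with any splitting. -/
theorem hasCharacteristicClass_of_isCurvature (hA : A.IsExact) (N : A.IsotropicSplitting)
    {H : FormField E M ℝ 3} (hH : N.IsCurvature H) (hs : IsSmoothForm H) :
    A.HasCharacteristicClass H := by
  refine ⟨⟨N⟩, fun N' => ?_⟩
  have hb := isSmoothForm_diffForm hA N N'
  -- The factor 2 comes from the factor in the definition of the curvature.
  have hb2 : IsSmoothForm ((2 : ℝ) • diffForm hA N N') := fun X => contMDiff_const.mul (hb X)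
  have hc' : N'.IsCurvature (H + d ((2 : ℝ) • diffForm hA N N')) := by
    intro X Y Z x
    have := N.curv_eq_add_d_diffForm hA N' X Y Z x
    rw [d_smul]
    change H x ![X x, Y x, Z x] + 2 * d (diffForm hA N N') x ![X x, Y x, Z x] = _
    rw [hH X Y Z x]
    exact this.symm
  have hs' := hs.add hb2.d_two
  exact ⟨_, hc', hs', hs, N'.d_eq_zero_of_isCurvature hA hc' hs', N.d_eq_zero_of_isCurvature hA hH hs,
    _, hb2, add_sub_cancel_left _ _⟩

end IsotropicSplitting

end CourantAlgebroid

/-! ### Lifts to V₊ and the torsion identity H = −d^cω. -/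

/-- An alternating function of three arguments that is unchanged when `J` is applied to two of
them vanishes if `J² = -1`. -/
theorem eq_zero_of_alternating_of_invariant {α : Type*} [Neg α] (J : α → α)
    (hJ : ∀ a, J (J a) = -a) (D : α → α → α → ℝ) (sw : ∀ a b c, D a b c = -D b a c)
    (sw' : ∀ a b c, D a b c = -D a c b) (ng : ∀ a b c, D a (-b) c = -D a b c)
    (inv : ∀ a b c, D a b c = D (J a) (J b) c) (a b c : α) : D a b c = 0 := by
  have rot : ∀ a b c, D a b c = D b c a := fun a b c => by rw [sw, sw', neg_neg]
  -- Apply `J` to slots 1 and 2, then to 2 and 3, then undo it on 1 and 3: slot 2 has received J² =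
  -- −1 and the others are unchanged.
  have h : D a b c = -D a b c := by
    calc D a b c = D (J a) (J b) c := inv a b c
      _ = D (J b) c (J a) := rot _ _ _
      _ = D (J (J b)) (J c) (J a) := inv _ _ _
      _ = D (J a) (-b) (J c) := by rw [hJ, sw', sw (J a), rot (-b) (J a)]
      _ = -D (J c) (J a) b := by rw [ng, rot (J c)]
      _ = -D c a b := by rw [← inv]
      _ = -D a b c := by rw [rot c]
  linarith

namespace CourantAlgebroid

variable {E : Type*} [NormedAddCommGroup E] [NormedSpace ℝ E] [FiniteDimensional ℝ E]
  {M : Type*} [TopologicalSpace M] [ChartedSpace E M] [IsManifold 𝓘(ℝ, E) ∞ M] [T2Space M]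
  {F : Type*} [NormedAddCommGroup F] [NormedSpace ℝ F]
  {V : M → Type*} [TopologicalSpace (TotalSpace F V)]
  [∀ x, AddCommGroup (V x)] [∀ x, Module ℝ (V x)] [∀ x, TopologicalSpace (V x)]
  [FiberBundle F V] [VectorBundle ℝ F V]

variable {A : CourantAlgebroid E F V}

theorem IsotropicSplitting.curv_neg (N : A.IsotropicSplitting) (X Y Z : VField E M) (x : M) :
    N.curv (-X) Y Z x = -N.curv X Y Z x := by
  have h : N.lift (-X) = -N.lift X := by
    ext x
    exact map_neg (N.nab x) (X x)
  simp only [curv, h]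
  rw [LinearMap.map_neg₂]
  change 2 * A.pairing x (-(A.bracket (N.lift X) (N.lift Y) x)) (N.nab x (Z x)) = _
  rw [LinearMap.map_neg₂]
  ring

/-- A splitting of the anchor whose image is the graph of the metric `g`, with respect to the
isotropic splitting `N`. -/
structure MetricLift (S : HermitianStructure E M) (N : A.IsotropicSplitting) where
  s : ∀ x, T E M x →ₗ[ℝ] V x
  smooth_s : ∀ X : VField E M,
    ContMDiff 𝓘(ℝ, E) (𝓘(ℝ, E).prod 𝓘(ℝ, F)) ∞ (fun x => TotalSpace.mk' F x (s x (X x)))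
  anchor_s : ∀ x v, A.anchor x (s x v) = v
  pairing_s_nab : ∀ x v w, A.pairing x (s x v) (N.nab x w) = 1 / 2 * S.g.inner x v w

namespace MetricLift

variable {S : HermitianStructure E M} {N : A.IsotropicSplitting} (L : MetricLift S N)

/-- The section `s X`. -/
def lift (X : VField E M) : Sec E F V := ⟨fun x => L.s x (X x), L.smooth_s X⟩

theorem lift_apply (X : VField E M) (x : M) : L.lift X x = L.s x (X x) := rfl

theorem anchor_sub_nab (x : M) (v : T E M x) : A.anchor x (L.s x v - N.nab x v) = 0 := by
  rw [map_sub, L.anchor_s, N.anchor_nab, sub_self]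

theorem pairing_sub_nab (x : M) (v w : T E M x) :
    A.pairing x (L.s x v - N.nab x v) (N.nab x w) = 1 / 2 * S.g.inner x v w := by
  rw [map_sub, LinearMap.sub_apply, L.pairing_s_nab, N.isotropic, sub_zero]

/-- The vertical parts s − ∇ pair to zero, so the two mixed terms contribute ½g each. This is why
the graph carries the factor ½. -/
theorem pairing_s_s (hA : A.IsExact) (x : M) (v w : T E M x) :
    A.pairing x (L.s x v) (L.s x w) = S.g.inner x v w := by
  have h1 := L.pairing_s_nab x v w
  have h2 := L.pairing_s_nab x w v
  have h3 : A.pairing x (L.s x v - N.nab x v) (L.s x w - N.nab x w) = 0 :=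
    pairing_eq_zero hA (L.anchor_sub_nab x v) (L.anchor_sub_nab x w)
  simp only [map_sub, LinearMap.sub_apply, N.isotropic] at h3
  rw [A.symm x (N.nab x v)] at h3
  have h4 := S.g.symm x v w
  linarith

theorem anchorField_lift (X : VField E M) : A.anchorField (L.lift X) = X := by
  ext x
  exact L.anchor_s x (X x)

theorem anchor_bracket_lift (X Y : VField E M) (x : M) :
    A.anchor x (A.bracket (L.lift X) (L.lift Y) x) = lie X Y x := by
  rw [A.anchor_bracket_apply, L.anchorField_lift, L.anchorField_lift]

/-- Insert the vertical perturbation s − ∇, whose pairing with ∇ is ½g, into the bracket of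
perturbed lifts. The last term is kept apart because it is g(π[sX, sY], Z), the value required for
membership in the image of s. -/
theorem pairing_bracket_lift (hA : A.IsExact) (X Y Z : VField E M) (x : M) :
    2 * A.pairing x (A.bracket (L.lift X) (L.lift Y) x) (L.s x (Z x)) =
      N.curv X Y Z x + S.koszul X Y Z x + 2 * S.g.inner x (lie X Y x) (Z x) := by
  have h := N.pairing_bracket_lift_add hA X Y Z (L.lift X - N.lift X) (L.lift Y - N.lift Y)
    (L.lift Z - N.lift Z) (fun y => L.anchor_sub_nab y (X y)) (fun y => L.anchor_sub_nab y (Y y))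
    (fun y => L.anchor_sub_nab y (Z y)) x
  have e : ∀ (X : VField E M) y w, A.pairing y ((L.lift X - N.lift X) y) (N.nab y w) =
      1 / 2 * S.g.inner y (X y) w := fun X y w => L.pairing_sub_nab y (X y) w
  have e' : ∀ X, N.lift X + (L.lift X - N.lift X) = L.lift X := fun X => by abel
  rw [e', e', e'] at h
  simp only [e, dfun_const_mul (1 / 2) (contMDiff_inner S.g _ _), _root_.smul_apply,
    smul_eq_mul] at h
  rw [lift_apply L Z] at h
  have h4 := S.g.symm x (Z x) (lie X Y x)
  simp only [HermitianStructure.koszul, HermitianStructure.dg]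
  linarith

/-- A vector of `V` lies in the image of `s` if its pairings with that image are those of its
anchor. -/
theorem s_anchor_eq_iff (hA : A.IsExact) {x : M} (e : V x) :
    L.s x (A.anchor x e) = e ↔
      ∀ w, A.pairing x e (L.s x w) = S.g.inner x (A.anchor x e) w := by
  constructor
  · intro h w
    conv_lhs => rw [← h]
    exact L.pairing_s_s hA x _ _
  · intro h
    refine (sub_eq_zero.1 (eq_zero_of_pairing hA (u := e - L.s x (A.anchor x e)) ?_ fun v =>
      ⟨L.s x v, L.anchor_s x v, ?_⟩)).symm
    · rw [map_sub, L.anchor_s, sub_self]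
    · rw [map_sub, LinearMap.sub_apply, h, L.pairing_s_s hA, sub_self]

/-- The difference `[sX, sY] - [sJX, sJY]` lies in the image of `s` if and only if `H + d^c ω` is
unchanged when `J` is applied to its first two arguments. -/
theorem bracket_sub_bracket_mem_iff (hA : A.IsExact) (X Y : VField E M) (x : M) :
    L.s x (A.anchor x (A.bracket (L.lift X) (L.lift Y) x -
        A.bracket (L.lift (S.Jf X)) (L.lift (S.Jf Y)) x)) =
      A.bracket (L.lift X) (L.lift Y) x - A.bracket (L.lift (S.Jf X)) (L.lift (S.Jf Y)) x ↔
    ∀ Z : VField E M, N.curv X Y Z x + dc S.J S.omega x ![X x, Y x, Z x] =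
      N.curv (S.Jf X) (S.Jf Y) Z x + dc S.J S.omega x ![S.J x (X x), S.J x (Y x), Z x] := by
  rw [L.s_anchor_eq_iff hA]
  have key : ∀ Z : VField E M,
      2 * (A.pairing x (A.bracket (L.lift X) (L.lift Y) x -
        A.bracket (L.lift (S.Jf X)) (L.lift (S.Jf Y)) x) (L.s x (Z x)) -
        S.g.inner x (A.anchor x (A.bracket (L.lift X) (L.lift Y) x -
          A.bracket (L.lift (S.Jf X)) (L.lift (S.Jf Y)) x)) (Z x)) =
      (N.curv X Y Z x + dc S.J S.omega x ![X x, Y x, Z x]) -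
      (N.curv (S.Jf X) (S.Jf Y) Z x + dc S.J S.omega x ![S.J x (X x), S.J x (Y x), Z x]) := by
    intro Z
    have h1 := L.pairing_bracket_lift hA X Y Z x
    have h2 := L.pairing_bracket_lift hA (S.Jf X) (S.Jf Y) Z x
    have h3 := S.koszul_sub_koszul X Y Z x
    simp only [map_sub, LinearMap.sub_apply, _root_.sub_apply, L.anchor_bracket_lift]
    linarith
  constructor
  · intro h Z
    have := key Z
    rw [h] at this
    linarith
  · intro h w
    obtain ⟨Z, rfl⟩ := exists_vfield x w
    have := key Z
    have := h Z
    linarith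

/-- If the brackets `[sX, sY] - [sJX, sJY]` all lie in the image of `s`, then the curvature of the
isotropic splitting is `-d^c ω`. -/
theorem isCurvature_of_bracket_mem (hA : A.IsExact)
    (h : ∀ (X Y : VField E M) x,
      L.s x (A.anchor x (A.bracket (L.lift X) (L.lift Y) x -
        A.bracket (L.lift (S.Jf X)) (L.lift (S.Jf Y)) x)) =
      A.bracket (L.lift X) (L.lift Y) x - A.bracket (L.lift (S.Jf X)) (L.lift (S.Jf Y)) x) :
    N.IsCurvature (-dc S.J S.omega) := by
  intro X Y Z x
  change -(dc S.J S.omega x ![X x, Y x, Z x]) = N.curv X Y Z x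
  -- The argument runs over vector fields instead of tangent vectors at `x`, since `curv` is given
  -- only as a function of fields; only additive inverses and `Jf` are needed, not tensoriality.
  have h2 := eq_zero_of_alternating_of_invariant S.Jf S.Jf_Jf
    (fun X Y Z => N.curv X Y Z x + dc S.J S.omega x ![X x, Y x, Z x]) ?_ ?_ ?_ ?_ X Y Z
  · linarith
  · intro X Y Z
    rw [N.curv_swap, alternating_three_swap_zero_one _ (Y x)]
    ring
  · intro X Y Z
    rw [N.curv_swap', alternating_three_swap_one_two _ (X x) (Z x)]
    ring
  · intro X Y Z
    have h2 : (-Y) x = -Y x := rfl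
    rw [h2, alternating_three_neg_one, N.curv_swap, N.curv_neg, N.curv_swap X]
    ring
  · intro X Y Z
    simp only [HermitianStructure.Jf_apply]
    exact (L.bracket_sub_bracket_mem_iff hA X Y x).1 (h X Y x) Z

/-- If the curvature of the isotropic splitting is `-d^c ω`, then the brackets `[sX, sY] - [sJX, sJY]`
lie in the image of `s`. -/
theorem bracket_mem_of_isCurvature (hA : A.IsExact) (h : N.IsCurvature (-dc S.J S.omega))
    (X Y : VField E M) (x : M) :
    L.s x (A.anchor x (A.bracket (L.lift X) (L.lift Y) x -
        A.bracket (L.lift (S.Jf X)) (L.lift (S.Jf Y)) x)) =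
      A.bracket (L.lift X) (L.lift Y) x - A.bracket (L.lift (S.Jf X)) (L.lift (S.Jf Y)) x := by
  refine (L.bracket_sub_bracket_mem_iff hA X Y x).2 fun Z => ?_
  have key : ∀ X Y Z : VField E M, N.curv X Y Z x = -dc S.J S.omega x ![X x, Y x, Z x] :=
    fun X Y Z => (h X Y Z x).symm
  rw [key, key]
  simp [HermitianStructure.Jf_apply]

end MetricLift

end CourantAlgebroid

/-! ### Riemannian metrics from smooth positive bilinear forms. -/

section Metric

variable {E : Type*} [NormedAddCommGroup E] [NormedSpace ℝ E] [FiniteDimensional ℝ E]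

/-- Compactness of the unit sphere gives b(v, v) ≥ c‖v‖² with c > 0. -/
theorem isVonNBounded_of_pos (b : E →ₗ[ℝ] E →ₗ[ℝ] ℝ) (hb : ∀ v, v ≠ 0 → 0 < b v v) :
    Bornology.IsVonNBounded ℝ {v : E | b v v < 1} := by
  have hcont : Continuous fun v => b v v := by
    have hc : Continuous fun v : E => ((v, v) : E × E) := by fun_prop
    exact (LinearMap.toContinuousBilinearMap b).continuous₂.comp hc
  obtain ⟨c, hc, hcb⟩ : ∃ c > 0, ∀ v, c * ‖v‖ ^ 2 ≤ b v v := by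
    rcases subsingleton_or_nontrivial E with hE | hE
    · refine ⟨1, one_pos, fun v => ?_⟩
      rw [Subsingleton.elim v 0]
      simp
    · obtain ⟨v₀, hv₀, hmin⟩ := (isCompact_sphere (0 : E) 1).exists_isMinOn
        (NormedSpace.sphere_nonempty.2 zero_le_one) hcont.continuousOn
      have hv₀' : v₀ ≠ 0 := by
        rintro rfl
        simp at hv₀
      refine ⟨b v₀ v₀, hb _ hv₀', fun v => ?_⟩
      rcases eq_or_ne v 0 with rfl | hv
      · simp
      · have hn : ‖v‖ ≠ 0 := norm_ne_zero_iff.2 hv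
        have h := hmin (a := ‖v‖⁻¹ • v) (by simp [norm_smul, hn])
        simp only [Set.mem_ofPred_eq, map_smul, LinearMap.smul_apply, smul_eq_mul] at h
        calc b v₀ v₀ * ‖v‖ ^ 2 ≤ ‖v‖⁻¹ * (‖v‖⁻¹ * b v v) * ‖v‖ ^ 2 := by gcongr
          _ = b v v := by field_simp
  rw [NormedSpace.isVonNBounded_iff, isBounded_iff_forall_norm_le]
  -- If ‖v‖ exceeded this bound, both c‖v‖ and ‖v‖ would exceed 1, and so would c‖v‖².
  refine ⟨1 + 1 / c, fun v hv => ?_⟩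
  have h1 : c * ‖v‖ ^ 2 < 1 := (hcb v).trans_lt hv
  by_contra! h2
  have h3 : 1 < c * ‖v‖ := by
    have : c * (1 + 1 / c) = c + 1 := by field_simp
    nlinarith
  have h4 : 1 < ‖v‖ := lt_trans (by have := one_div_pos.2 hc; linarith) h2
  nlinarith

variable {M : Type*} [TopologicalSpace M] [ChartedSpace E M] [IsManifold 𝓘(ℝ, E) ∞ M] [T2Space M]

/-- The Riemannian metric defined by positive definite symmetric bilinear forms on the tangent spaces
that are smooth on smooth vector fields. -/
def riemannianMetric (b : ∀ x, T E M x →ₗ[ℝ] T E M x →ₗ[ℝ] ℝ) (hsymm : ∀ x v w, b x v w = b x w v)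
    (hpos : ∀ x v, v ≠ 0 → 0 < b x v v)
    (hb : ∀ X Y : VField E M, ContMDiff 𝓘(ℝ, E) 𝓘(ℝ, ℝ) ∞ (fun x => b x (X x) (Y x))) :
    ContMDiffRiemannianMetric 𝓘(ℝ, E) ∞ E (T E M) where
  inner x := LinearMap.toContinuousBilinearMap (E := E) (F := E) (G := ℝ) (𝕜 := ℝ) (b x)
  symm x v w := hsymm x v w
  pos x v hv := hpos x v hv
  isVonNBounded x := isVonNBounded_of_pos (E := E) (b x) (hpos x)
  contMDiff := by
    intro x
    refine contMDiffAt_section_of_functionals (E := E) (F := E →L[ℝ] E →L[ℝ] ℝ)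
      (V := fun x : M => T E M x →L[ℝ] T E M x →L[ℝ] Bundle.Trivial M ℝ x) _ x fun B hB => ?_
    have : ∃ v w, B v w ≠ 0 := by
      by_contra! h
      exact hB (by ext v w; exact h v w)
    obtain ⟨v, w, h⟩ := this
    obtain ⟨X, rfl⟩ := exists_vfield x v
    obtain ⟨Y, rfl⟩ := exists_vfield x w
    refine ⟨fun y =>
      { toFun := fun B => B (X y) (Y y)
        map_add' := fun _ _ => rfl
        map_smul' := fun _ _ => rfl }, fun s => ?_, hb X Y x, h⟩
    have : ContMDiff 𝓘(ℝ, E) (𝓘(ℝ, E).prod 𝓘(ℝ)) ∞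
        (fun x => TotalSpace.mk' ℝ (E := Bundle.Trivial M ℝ) x (s x (X x) (Y x))) :=
      ContMDiff.clm_bundle_apply₂ (F₁ := E) (F₂ := E) s.contMDiff X.contMDiff Y.contMDiff
    exact (contMDiffAt_totalSpace.1 (this x)).2

end Metric

theorem HermitianStructure.ext_of_apply {E : Type*} [NormedAddCommGroup E] [NormedSpace ℝ E]
    {M : Type*} [TopologicalSpace M] [ChartedSpace E M] [IsManifold 𝓘(ℝ, E) ∞ M]
    {S S' : HermitianStructure E M}
    (hg : ∀ x v w, S.g.inner x v w = S'.g.inner x v w) (hJ : ∀ x v, S.J x v = S'.J x v) :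
    S = S' := by
  obtain ⟨⟨i, _, _, _, _⟩, J, _, _, _, _⟩ := S
  obtain ⟨⟨i', _, _, _, _⟩, J', _, _, _, _⟩ := S'
  have h1 : i = i' := by
    funext x
    ext v w
    exact hg x v w
  have h2 : J = J' := by
    funext x
    ext v
    exact hJ x v
  subst h1 h2
  rfl

theorem StrongKT.ext_of_apply {E : Type*} [NormedAddCommGroup E] [NormedSpace ℝ E]
    {M : Type*} [TopologicalSpace M] [ChartedSpace E M] [IsManifold 𝓘(ℝ, E) ∞ M]
    {S S' : StrongKT E M}
    (hg : ∀ x v w, S.g.inner x v w = S'.g.inner x v w) (hJ : ∀ x v, S.J x v = S'.J x v) :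
    S = S' := by
  obtain ⟨S, _⟩ := S
  obtain ⟨S', _⟩ := S'
  have h : S = S' := HermitianStructure.ext_of_apply hg hJ
  subst h
  rfl

/-! ### From a strong KT structure on the algebroid to one on the manifold. -/

namespace CourantAlgebroid

variable {E : Type*} [NormedAddCommGroup E] [NormedSpace ℝ E] [FiniteDimensional ℝ E]
  {M : Type*} [TopologicalSpace M] [ChartedSpace E M] [IsManifold 𝓘(ℝ, E) ∞ M] [T2Space M]
  {F : Type*} [NormedAddCommGroup F] [NormedSpace ℝ F] [FiniteDimensional ℝ F]
  {V : M → Type*} [TopologicalSpace (TotalSpace F V)]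
  [∀ x, AddCommGroup (V x)] [∀ x, Module ℝ (V x)] [∀ x, TopologicalSpace (V x)]
  [FiberBundle F V] [VectorBundle ℝ F V] [ContMDiffVectorBundle ∞ F V 𝓘(ℝ, E)]

variable {A : CourantAlgebroid E F V}

namespace GeneralizedMetric

variable (K : A.GeneralizedMetric)

theorem G_G (x : M) (e : V x) : K.G x (K.G x e) = e := by
  refine sub_eq_zero.1 (A.nondegenerate x _ fun e' => ?_)
  rw [map_sub, LinearMap.sub_apply, K.selfAdjoint, K.orthogonal, sub_self]

theorem mem_Vplus {x : M} {e : V x} : e ∈ K.Vplus x ↔ K.G x e = e := by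
  simp [Vplus, sub_eq_zero]

/-- Otherwise ⟨Ge, e⟩ > 0 for two vertical vectors. This gives both injectivity of the anchor on V₊
and invertibility of πGπ*. -/
theorem eq_zero_of_anchor (hA : A.IsExact) {x : M} {e : V x} (h1 : A.anchor x e = 0)
    (h2 : A.anchor x (K.G x e) = 0) : e = 0 := by
  by_contra h
  have := K.pos x e h
  rw [pairing_eq_zero hA h2 h1] at this
  exact lt_irrefl _ this

theorem eq_of_anchor_eq (hA : A.IsExact) {x : M} {e e' : V x} (he : e ∈ K.Vplus x)
    (he' : e' ∈ K.Vplus x) (h : A.anchor x e = A.anchor x e') : e = e' := by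
  have h0 : A.anchor x (e - e') = 0 := by rw [map_sub, h, sub_self]
  refine sub_eq_zero.1 (K.eq_zero_of_anchor hA h0 ?_)
  rw [map_sub, K.mem_Vplus.1 he, K.mem_Vplus.1 he', h0]

/-- The isomorphism `π G π* : T*M → TM`. -/
def dualEquiv (hA : A.IsExact) (x : M) : (T E M x →L[ℝ] ℝ) ≃ₗ[ℝ] T E M x :=
  haveI : FiniteDimensional ℝ (T E M x) := inferInstanceAs (FiniteDimensional ℝ E)
  haveI : FiniteDimensional ℝ (T E M x →L[ℝ] ℝ) := inferInstanceAs (FiniteDimensional ℝ (E →L[ℝ] ℝ))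
  LinearMap.linearEquivOfInjective ((A.anchor x).comp ((K.G x).comp (A.coanchor x)))
    (by
      rw [injective_iff_map_eq_zero]
      intro ξ hξ
      refine (hA x).1 ?_
      rw [map_zero]
      exact K.eq_zero_of_anchor hA (((hA x).2.2 _).2 ⟨ξ, rfl⟩) hξ)
    (by
      have h1 : finrank ℝ (E →L[ℝ] ℝ) = finrank ℝ (Dual ℝ E) :=
        (LinearMap.toContinuousLinearMap (𝕜 := ℝ) (E := E) (F' := ℝ)).finrank_eq.symm
      exact h1.trans Subspace.dual_finrank_eq)

/-- The vertical lift of a tangent vector: half of its metric dual. -/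
def vert (hA : A.IsExact) (x : M) : T E M x →ₗ[ℝ] V x :=
  (A.coanchor x).comp (K.dualEquiv hA x).symm.toLinearMap

theorem anchor_vert (hA : A.IsExact) (x : M) (v : T E M x) : A.anchor x (K.vert hA x v) = 0 :=
  ((hA x).2.2 _).2 ⟨_, rfl⟩

theorem anchor_G_vert (hA : A.IsExact) (x : M) (v : T E M x) :
    A.anchor x (K.G x (K.vert hA x v)) = v :=
  (K.dualEquiv hA x).apply_symm_apply v

/-- Smoothness of the inverse of πGπ* is avoided: π and πG are jointly injective and send the
section to 0 and X. -/
theorem smooth_vert (hA : A.IsExact) (X : VField E M) :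
    ContMDiff 𝓘(ℝ, E) (𝓘(ℝ, E).prod 𝓘(ℝ, F)) ∞
      (fun x => TotalSpace.mk' F x (K.vert hA x (X x))) := by
  refine contMDiff_section_of_injective (F' := E) (W := T E M)
    (fun (i : Bool) x => if i then A.anchor x else (A.anchor x).comp (K.G x)) ?_ ?_ _ ?_
  · rintro (_ | _) s
    · exact A.smooth_anchor ⟨_, K.smooth_G s⟩
    · exact A.smooth_anchor s
  · intro x v h
    exact K.eq_zero_of_anchor hA (h true) (h false)
  · rintro (_ | _)
    · have h : ∀ x, A.anchor x (K.G x (K.vert hA x (X x))) = X x := fun x => K.anchor_G_vert hA x _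
      change ContMDiff 𝓘(ℝ, E) (𝓘(ℝ, E).prod 𝓘(ℝ, E)) ∞
        (fun x => TotalSpace.mk' E x (A.anchor x (K.G x (K.vert hA x (X x)))))
      simp only [h]
      exact X.contMDiff
    · have h : ∀ x, A.anchor x (K.vert hA x (X x)) = (0 : VField E M) x :=
        fun x => K.anchor_vert hA x _
      change ContMDiff 𝓘(ℝ, E) (𝓘(ℝ, E).prod 𝓘(ℝ, E)) ∞
        (fun x => TotalSpace.mk' E x (A.anchor x (K.vert hA x (X x))))
      simp only [h]
      exact (0 : VField E M).contMDiff

/-- The isotropic splitting defined by a generalized metric, with image `G(T*M)`. -/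
def splitting (hA : A.IsExact) : A.IsotropicSplitting where
  nab x := (K.G x).comp (K.vert hA x)
  smooth_nab X := K.smooth_G ⟨_, K.smooth_vert hA X⟩
  anchor_nab x v := K.anchor_G_vert hA x v
  isotropic x v w := by
    rw [LinearMap.comp_apply, LinearMap.comp_apply, K.orthogonal]
    exact pairing_eq_zero hA (K.anchor_vert hA x v) (K.anchor_vert hA x w)

/-- The lift of tangent vectors to `V₊`. -/
def plus (hA : A.IsExact) (x : M) : T E M x →ₗ[ℝ] V x :=
  (K.G x).comp (K.vert hA x) + K.vert hA x

theorem plus_apply (hA : A.IsExact) (x : M) (v : T E M x) :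
    K.plus hA x v = K.G x (K.vert hA x v) + K.vert hA x v := rfl

theorem plus_mem (hA : A.IsExact) (x : M) (v : T E M x) : K.plus hA x v ∈ K.Vplus x := by
  rw [K.mem_Vplus, plus_apply, map_add, K.G_G, add_comm]

theorem anchor_plus (hA : A.IsExact) (x : M) (v : T E M x) : A.anchor x (K.plus hA x v) = v := by
  rw [plus_apply, map_add, K.anchor_vert, K.anchor_G_vert, add_zero]

theorem plus_anchor (hA : A.IsExact) {x : M} {e : V x} (he : e ∈ K.Vplus x) :
    K.plus hA x (A.anchor x e) = e :=
  K.eq_of_anchor_eq hA (K.plus_mem hA x _) he (K.anchor_plus hA x _)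

theorem smooth_plus (hA : A.IsExact) (X : VField E M) :
    ContMDiff 𝓘(ℝ, E) (𝓘(ℝ, E).prod 𝓘(ℝ, F)) ∞
      (fun x => TotalSpace.mk' F x (K.plus hA x (X x))) :=
  (K.smooth_G ⟨_, K.smooth_vert hA X⟩).add_section (K.smooth_vert hA X)

theorem pairing_plus_plus (hA : A.IsExact) (x : M) (v w : T E M x) :
    A.pairing x (K.plus hA x v) (K.plus hA x w) =
      2 * A.pairing x (K.vert hA x v) (K.G x (K.vert hA x w)) := by
  have h1 : A.pairing x (K.vert hA x v) (K.vert hA x w) = 0 :=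
    pairing_eq_zero hA (K.anchor_vert hA x v) (K.anchor_vert hA x w)
  simp only [plus_apply, map_add, LinearMap.add_apply, K.orthogonal, h1, K.selfAdjoint]
  ring

/-- The Riemannian metric induced by a generalized metric. -/
def metric (hA : A.IsExact) : ContMDiffRiemannianMetric 𝓘(ℝ, E) ∞ E (T E M) :=
  riemannianMetric (fun x => (A.pairing x).compl₁₂ (K.plus hA x) (K.plus hA x))
    (fun x v w => A.symm x _ _)
    (fun x v hv => by
      have h0 : K.plus hA x v ≠ 0 := by
        intro h
        apply hv
        rw [← K.anchor_plus hA x v, h, map_zero]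
      have := K.pos x _ h0
      rwa [K.mem_Vplus.1 (K.plus_mem hA x v)] at this)
    (fun X Y => A.smooth_pairing ⟨_, K.smooth_plus hA X⟩ ⟨_, K.smooth_plus hA Y⟩)

end GeneralizedMetric

namespace StrongKT

variable (K : A.StrongKT)

/-- The complex structure on `M` induced by a strong KT structure, on tangent vectors. -/
def complexStructureLin (hA : A.IsExact) (x : M) : T E M x →ₗ[ℝ] T E M x :=
  (A.anchor x).comp ((K.Vplus x).subtype.comp
    ((K.J x).comp ((K.plus hA x).codRestrict (K.Vplus x) (K.plus_mem hA x))))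

theorem complexStructureLin_apply (hA : A.IsExact) (x : M) (v : T E M x) :
    K.complexStructureLin hA x v =
      A.anchor x (K.J x ⟨K.plus hA x v, K.plus_mem hA x v⟩ : V x) := rfl

theorem plus_complexStructureLin (hA : A.IsExact) (x : M) (v : T E M x) :
    K.plus hA x (K.complexStructureLin hA x v) = K.J x ⟨K.plus hA x v, K.plus_mem hA x v⟩ :=
  K.plus_anchor hA (Subtype.prop _)

/-- The section of `V₊` over a vector field. -/
def plusLift (hA : A.IsExact) (X : VField E M) : Sec E F V := ⟨_, K.smooth_plus hA X⟩

theorem anchorField_plusLift (hA : A.IsExact) (X : VField E M) :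
    A.anchorField (K.plusLift hA X) = X := by
  ext x
  exact K.anchor_plus hA x (X x)

theorem isEigenSection_plusLift (hA : A.IsExact) {X Y : VField E M}
    (h : ∀ x, K.complexStructureLin hA x (X x) = -Y x ∧ K.complexStructureLin hA x (Y x) = X x) :
    K.IsEigenSection K.J (K.plusLift hA X) (K.plusLift hA Y) := by
  intro x
  refine ⟨K.plus_mem hA x _, K.plus_mem hA x _, Subtype.ext ?_, Subtype.ext ?_⟩
  · change _ = -K.plus hA x (Y x)
    rw [← map_neg, ← (h x).1, K.plus_complexStructureLin]
    rfl
  · change _ = K.plus hA x (X x)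
    rw [← (h x).2, K.plus_complexStructureLin]
    rfl

theorem complexStructureLin_anchor (hA : A.IsExact) {x : M} (e : K.Vplus x) :
    K.complexStructureLin hA x (A.anchor x e) = A.anchor x (K.J x e) := by
  have : (⟨K.plus hA x (A.anchor x e), K.plus_mem hA x _⟩ : K.Vplus x) = e :=
    Subtype.ext (K.plus_anchor hA e.2)
  rw [complexStructureLin_apply, this]

/-- The Hermitian structure on `M` induced by a strong KT structure on `A`. -/
def hermitianStructure (hA : A.IsExact) : HermitianStructure E M where
  g := K.metric hA
  J x := LinearMap.toContinuousLinearMap (𝕜 := ℝ) (E := E) (F' := E) (K.complexStructureLin hA x)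
  smooth_J X := A.smooth_anchor ⟨_, K.smooth_J (K.plusLift hA X) fun x => K.plus_mem hA x _⟩
  J_sq x v := by
    change K.complexStructureLin hA x (K.complexStructureLin hA x v) = -v
    rw [K.complexStructureLin_apply hA x v, K.complexStructureLin_anchor, K.J_sq]
    change A.anchor x (-K.plus hA x v) = -v
    rw [map_neg, K.anchor_plus]
  integrable X Y X' Y' h h' := by
    -- Integrability on M is the image under the anchor of involutivity in V₊, because the anchor is
    -- a bracket homomorphism and intertwines the complex structures.
    have hE := K.involutive _ _ _ _ (K.isEigenSection_plusLift hA h)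
      (K.isEigenSection_plusLift hA h')
    intro x
    obtain ⟨ha, hb, h1, h2⟩ := hE x
    have ea : A.anchor x ((A.bracket (K.plusLift hA X) (K.plusLift hA X') -
        A.bracket (K.plusLift hA Y) (K.plusLift hA Y')) x) = lie X X' x - lie Y Y' x := by
      change A.anchor x (A.bracket (K.plusLift hA X) (K.plusLift hA X') x -
        A.bracket (K.plusLift hA Y) (K.plusLift hA Y') x) = _
      simp only [map_sub, A.anchor_bracket_apply, anchorField_plusLift]
    have eb : A.anchor x ((A.bracket (K.plusLift hA X) (K.plusLift hA Y') +
        A.bracket (K.plusLift hA Y) (K.plusLift hA X')) x) = lie X Y' x + lie Y X' x := by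
      change A.anchor x (A.bracket (K.plusLift hA X) (K.plusLift hA Y') x +
        A.bracket (K.plusLift hA Y) (K.plusLift hA X') x) = _
      simp only [map_add, A.anchor_bracket_apply, anchorField_plusLift]
    change K.complexStructureLin hA x (lie X X' x - lie Y Y' x) = -(lie X Y' x + lie Y X' x) ∧
      K.complexStructureLin hA x (lie X Y' x + lie Y X' x) = lie X X' x - lie Y Y' x
    rw [← ea, ← eb]
    constructor
    · rw [K.complexStructureLin_anchor hA ⟨_, ha⟩, h1]
      exact map_neg _ _
    · rw [K.complexStructureLin_anchor hA ⟨_, hb⟩, h2]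
  hermitian x v w := by
    change A.pairing x (K.plus hA x (K.complexStructureLin hA x v))
      (K.plus hA x (K.complexStructureLin hA x w)) = _
    rw [K.plus_complexStructureLin, K.plus_complexStructureLin, K.orthogonal_J]
    rfl

/-- The lift to `V₊` as a metric lift. -/
def metricLift (hA : A.IsExact) :
    MetricLift (K.hermitianStructure hA) (K.splitting hA) where
  s := K.plus hA
  smooth_s := K.smooth_plus hA
  anchor_s := K.anchor_plus hA
  pairing_s_nab x v w := by
    change A.pairing x (K.plus hA x v) (K.G x (K.vert hA x w)) =
      1 / 2 * A.pairing x (K.plus hA x v) (K.plus hA x w)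
    rw [K.pairing_plus_plus, K.plus_apply, map_add, LinearMap.add_apply, K.orthogonal,
      pairing_eq_zero hA (K.anchor_vert hA x v) (K.anchor_vert hA x w)]
    ring

/-- Of the involutivity of the sections sX − i sJX only one consequence is needed here: the real
part of their bracket lies in V₊, that is, in the image of s. -/
theorem isCurvature_splitting (hA : A.IsExact) :
    (K.splitting hA).IsCurvature
      (-dc (K.hermitianStructure hA).J (K.hermitianStructure hA).omega) := by
  refine (K.metricLift hA).isCurvature_of_bracket_mem hA fun X Y x => K.plus_anchor hA ?_
  have hX : ∀ X : VField E M, K.IsEigenSection K.J (K.plusLift hA X)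
      (-K.plusLift hA ((K.hermitianStructure hA).Jf X)) := by
    intro X
    have := K.isEigenSection_plusLift hA (X := X) (Y := -(K.hermitianStructure hA).Jf X) ?_
    · have e : K.plusLift hA (-(K.hermitianStructure hA).Jf X) =
          -K.plusLift hA ((K.hermitianStructure hA).Jf X) := by
        ext x
        exact map_neg (K.plus hA x) _
      rwa [e] at this
    · intro x
      constructor
      · change _ = - -(K.hermitianStructure hA).J x (X x)
        rw [neg_neg]
        rfl
      · change (K.hermitianStructure hA).J x (-(K.hermitianStructure hA).J x (X x)) = X x
        rw [map_neg, (K.hermitianStructure hA).J_sq, neg_neg]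
  obtain ⟨ha, -⟩ := K.involutive _ _ _ _ (hX X) (hX Y) x
  rw [LinearMap.map_neg₂, map_neg, neg_neg] at ha
  exact ha

/-- The strong KT structure on `M` induced by a strong KT structure on `A`. -/
def induced (hA : A.IsExact) : SKT.StrongKT E M where
  toHermitianStructure := K.hermitianStructure hA
  closed := by
    have h := (K.splitting hA).d_eq_zero_of_isCurvature hA (K.isCurvature_splitting hA)
      (K.hermitianStructure hA).isSmoothForm_dc_omega.neg
    rwa [d_neg, neg_eq_zero] at h

theorem induces_induced (hA : A.IsExact) : K.Induces (K.induced hA) := by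
  intro x
  refine ⟨fun e e' => ?_, fun e => K.complexStructureLin_anchor hA e⟩
  change A.pairing x (K.plus hA x (A.anchor x e)) (K.plus hA x (A.anchor x e')) = _
  rw [K.plus_anchor hA e.2, K.plus_anchor hA e'.2]

theorem eq_induced (hA : A.IsExact) {S : SKT.StrongKT E M} (hS : K.Induces S) :
    S = K.induced hA := by
  refine StrongKT.ext_of_apply (fun x v w => ?_) fun x v => ?_
  · have h1 := (hS x).1 ⟨_, K.plus_mem hA x v⟩ ⟨_, K.plus_mem hA x w⟩
    simp only [K.anchor_plus] at h1
    exact h1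
  · have h1 := (hS x).2 ⟨_, K.plus_mem hA x v⟩
    simp only [K.anchor_plus] at h1
    exact h1

theorem hasCharacteristicClass_of_induces (hA : A.IsExact) {S : SKT.StrongKT E M}
    (hS : K.Induces S) : A.HasCharacteristicClass (-dc S.J S.omega) := by
  have e : S.toHermitianStructure = K.hermitianStructure hA := by
    rw [K.eq_induced hA hS]
    rfl
  rw [e]
  exact (K.splitting hA).hasCharacteristicClass_of_isCurvature hA (K.isCurvature_splitting hA)
    (K.hermitianStructure hA).isSmoothForm_dc_omega.neg

end StrongKT

end CourantAlgebroid

/-! ### Bilinear forms and metric duality on tangent spaces. -/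

section Bilinear

variable {E : Type*} [NormedAddCommGroup E] [NormedSpace ℝ E] [FiniteDimensional ℝ E]
  {M : Type*} [TopologicalSpace M] [ChartedSpace E M] [IsManifold 𝓘(ℝ, E) ∞ M]

/-- A 2-form as a bilinear form on tangent vectors. -/
def formBilin (γ : FormField E M ℝ 2) (x : M) : T E M x →ₗ[ℝ] T E M x →ₗ[ℝ] ℝ :=
  have hadd : ∀ u u' v : T E M x, γ x ![u + u', v] = γ x ![u, v] + γ x ![u', v] := fun u u' v =>
    (γ x).toAlternatingMap.map_vecCons_add ![v] u u'
  have hsmul : ∀ (c : ℝ) (u v : T E M x), γ x ![c • u, v] = c • γ x ![u, v] := fun c u v =>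
    (γ x).toAlternatingMap.map_vecCons_smul ![v] c u
  LinearMap.mk₂ ℝ (fun v w => γ x ![v, w]) hadd hsmul
    (fun u v v' => by
      rw [alternating_two_swap _ (v + v') u, hadd, alternating_two_swap _ u v,
        alternating_two_swap _ u v', neg_add, neg_neg, neg_neg])
    (fun c u v => by
      rw [alternating_two_swap _ (c • v) u, hsmul, alternating_two_swap _ u v, smul_neg, neg_neg])

theorem formBilin_apply (γ : FormField E M ℝ 2) (x : M) (v w : T E M x) :
    formBilin γ x v w = γ x ![v, w] := rfl

/-- A bilinear form on tangent vectors as a map to cotangent vectors. -/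
def covector (b : ∀ x, T E M x →ₗ[ℝ] T E M x →ₗ[ℝ] ℝ) (x : M) :
    T E M x →L[ℝ] T E M x →L[ℝ] ℝ :=
  LinearMap.toContinuousBilinearMap (E := E) (F := E) (G := ℝ) (𝕜 := ℝ) (b x)

/-- The metric as a bilinear form on tangent vectors. -/
def HermitianStructure.gBilin (S : HermitianStructure E M) (x : M) :
    T E M x →ₗ[ℝ] T E M x →ₗ[ℝ] ℝ :=
  LinearMap.mk₂ ℝ (fun v w => S.g.inner x v w) (by simp) (by simp) (by simp) (by simp)

theorem HermitianStructure.gBilin_apply (S : HermitianStructure E M) (x : M) (v w : T E M x) :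
    S.gBilin x v w = S.g.inner x v w := rfl

/-- The isomorphism of a tangent space with its dual given by the metric. -/
def HermitianStructure.dualEquiv (S : HermitianStructure E M) (x : M) :
    T E M x ≃ₗ[ℝ] Dual ℝ (T E M x) :=
  haveI : FiniteDimensional ℝ (T E M x) := inferInstanceAs (FiniteDimensional ℝ E)
  LinearMap.linearEquivOfInjective (S.gBilin x)
    (by
      rw [injective_iff_map_eq_zero]
      intro v hv
      by_contra h
      have h1 := S.g.pos x v h
      have h2 : S.g.inner x v v = 0 := DFunLike.congr_fun hv v
      exact h1.ne' h2)
    Subspace.dual_finrank_eq.symm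

theorem HermitianStructure.inner_dualEquiv_symm (S : HermitianStructure E M) (x : M)
    (l : Dual ℝ (T E M x)) (w : T E M x) : S.g.inner x ((S.dualEquiv x).symm l) w = l w :=
  DFunLike.congr_fun ((S.dualEquiv x).apply_symm_apply l) w

end Bilinear

/-! ### From a strong KT manifold back to the algebroid. -/

namespace CourantAlgebroid

variable {E : Type*} [NormedAddCommGroup E] [NormedSpace ℝ E] [FiniteDimensional ℝ E]
  {M : Type*} [TopologicalSpace M] [ChartedSpace E M] [IsManifold 𝓘(ℝ, E) ∞ M] [T2Space M]
  {F : Type*} [NormedAddCommGroup F] [NormedSpace ℝ F] [FiniteDimensional ℝ F]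
  {V : M → Type*} [TopologicalSpace (TotalSpace F V)]
  [∀ x, AddCommGroup (V x)] [∀ x, Module ℝ (V x)] [∀ x, TopologicalSpace (V x)]
  [FiberBundle F V] [VectorBundle ℝ F V] [ContMDiffVectorBundle ∞ F V 𝓘(ℝ, E)]

section Vertical

variable (A : CourantAlgebroid E F V)

/-- The map `v ↦ π*(b(v, ·))`. -/
def vertical (b : ∀ x, T E M x →ₗ[ℝ] T E M x →ₗ[ℝ] ℝ) (x : M) : T E M x →ₗ[ℝ] V x :=
  (A.coanchor x).comp (covector b x).toLinearMap

theorem pairing_vertical (b : ∀ x, T E M x →ₗ[ℝ] T E M x →ₗ[ℝ] ℝ) (x : M) (v : T E M x) (e : V x) :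
    A.pairing x (A.vertical b x v) e = b x v (A.anchor x e) := A.pairing_coanchor x _ e

variable {A} in
theorem anchor_vertical (hA : A.IsExact) (b : ∀ x, T E M x →ₗ[ℝ] T E M x →ₗ[ℝ] ℝ) (x : M)
    (v : T E M x) : A.anchor x (A.vertical b x v) = 0 :=
  ((hA x).2.2 _).2 ⟨_, rfl⟩

theorem smooth_vertical {b : ∀ x, T E M x →ₗ[ℝ] T E M x →ₗ[ℝ] ℝ}
    (hb : ∀ X Y : VField E M, ContMDiff 𝓘(ℝ, E) 𝓘(ℝ, ℝ) ∞ (fun x => b x (X x) (Y x)))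
    (X : VField E M) :
    ContMDiff 𝓘(ℝ, E) (𝓘(ℝ, E).prod 𝓘(ℝ, F)) ∞
      (fun x => TotalSpace.mk' F x (A.vertical b x (X x))) := by
  refine contMDiff_section_of_pairing (E := E) A.pairing A.smooth_pairing A.nondegenerate _ fun t => ?_
  simp only [pairing_vertical]
  exact hb X (A.anchorField t)

end Vertical

variable {A : CourantAlgebroid E F V}

namespace IsotropicSplitting

variable (N : A.IsotropicSplitting)

/-- The splitting `N + π* γ`. -/
def addForm (hA : A.IsExact) {γ : FormField E M ℝ 2} (hγ : IsSmoothForm γ) :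
    A.IsotropicSplitting where
  nab x := N.nab x + A.vertical (formBilin γ) x
  smooth_nab X := (N.smooth_nab X).add_section (A.smooth_vertical (fun X Y => hγ.apply_two X Y) X)
  anchor_nab x v := by
    rw [LinearMap.add_apply, map_add, N.anchor_nab, anchor_vertical hA, add_zero]
  isotropic x v w := by
    have h : A.pairing x (N.nab x v) (A.vertical (formBilin γ) x w) = γ x ![w, v] := by
      rw [A.symm, pairing_vertical, N.anchor_nab, formBilin_apply]
    simp only [LinearMap.add_apply, map_add, N.isotropic, pairing_vertical, N.anchor_nab,
      anchor_vertical hA, formBilin_apply, map_zero, h]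
    rw [alternating_two_swap _ v w]
    ring

theorem diffForm_addForm (hA : A.IsExact) {γ : FormField E M ℝ 2} (hγ : IsSmoothForm γ) :
    diffForm hA N (N.addForm hA hγ) = γ := by
  refine formField_ext fun X x => ?_
  rw [vecTwo_eta (fun i => X i x), diffForm_apply]
  change A.pairing x (N.nab x (X 0 x) + A.vertical (formBilin γ) x (X 0 x)) _ = _
  rw [map_add, LinearMap.add_apply, N.isotropic, pairing_vertical, N.anchor_nab, zero_add]
  rfl

/-- Every form in the characteristic class is the curvature of a splitting. -/
theorem exists_isCurvature (hA : A.IsExact) {η : FormField E M ℝ 3}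
    (h : A.HasCharacteristicClass η) : ∃ N : A.IsotropicSplitting, N.IsCurvature η := by
  obtain ⟨⟨N⟩, hN⟩ := h
  obtain ⟨H, hH, -, -, -, -, γ, hγ, hd⟩ := hN N
  -- Adding π*B changes the curvature by 2dB, and H − η = dγ, so B = −γ/2 replaces H by η.
  have hγ' : IsSmoothForm ((-(1 / 2) : ℝ) • γ) := fun X => contMDiff_const.mul (hγ X)
  refine ⟨N.addForm hA hγ', fun X Y Z x => ?_⟩
  have h1 := N.curv_eq_add_d_diffForm hA (N.addForm hA hγ') X Y Z x
  rw [N.diffForm_addForm hA hγ', d_smul, ← hd] at h1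
  have h2 : N.curv X Y Z x = H x ![X x, Y x, Z x] := (hH X Y Z x).symm
  have h3 : ((-(1 / 2) : ℝ) • (H - η)) x ![X x, Y x, Z x] =
    -(1 / 2) * (H x ![X x, Y x, Z x] - η x ![X x, Y x, Z x]) := rfl
  change _ = (N.addForm hA hγ').curv X Y Z x
  rw [h1, h2, h3]
  ring

end IsotropicSplitting

namespace MetricLift

/-- The metric lift over an isotropic splitting. -/
def ofSplitting (hA : A.IsExact) (S : HermitianStructure E M) (N : A.IsotropicSplitting) :
    MetricLift S N where
  s x := N.nab x + (1 / 2 : ℝ) • A.vertical S.gBilin x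
  smooth_s X := (N.smooth_nab X).add_section
    (ContMDiff.const_smul_section (A.smooth_vertical (fun X Y => contMDiff_inner S.g X Y) X))
  anchor_s x v := by
    simp only [LinearMap.add_apply, LinearMap.smul_apply, map_add, map_smul, N.anchor_nab,
      anchor_vertical hA, smul_zero, add_zero]
  pairing_s_nab x v w := by
    simp only [LinearMap.add_apply, LinearMap.smul_apply, map_add, map_smul, N.isotropic,
      pairing_vertical, N.anchor_nab, zero_add, smul_eq_mul]
    rfl

variable {S : HermitianStructure E M} {N : A.IsotropicSplitting} (L : MetricLift S N)

/-- The vertical part `s - N` of the lift. -/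
def vert (x : M) : T E M x →ₗ[ℝ] V x := L.s x - N.nab x

theorem vert_apply (x : M) (v : T E M x) : L.vert x v = L.s x v - N.nab x v := rfl

theorem nab_add_vert (x : M) (v : T E M x) : N.nab x v + L.vert x v = L.s x v := by
  rw [vert_apply, add_sub_cancel]

theorem anchor_vert (x : M) (v : T E M x) : A.anchor x (L.vert x v) = 0 := L.anchor_sub_nab x v

theorem pairing_vert_nab (x : M) (v w : T E M x) :
    A.pairing x (L.vert x v) (N.nab x w) = 1 / 2 * S.g.inner x v w := L.pairing_sub_nab x v w

variable (S N) in
/-- The tangent vector `w` with `g(w, y) = 2 ⟨e, N y⟩`. -/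
def dualPart (x : M) : V x →ₗ[ℝ] T E M x :=
  (S.dualEquiv x).symm.toLinearMap.comp ((2 : ℝ) • (A.pairing x).compl₂ (N.nab x))

theorem inner_dualPart (x : M) (e : V x) (w : T E M x) :
    S.g.inner x (dualPart S N x e) w = 2 * A.pairing x e (N.nab x w) :=
  S.inner_dualEquiv_symm x _ w

theorem smooth_dualPart (e : Sec E F V) :
    ContMDiff 𝓘(ℝ, E) (𝓘(ℝ, E).prod 𝓘(ℝ, E)) ∞
      (fun x => TotalSpace.mk' E x (dualPart S N x (e x))) := by
  refine contMDiff_section_of_pairing (E := E) S.gBilin (fun X Y => contMDiff_inner S.g X Y) ?_ _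
    fun Y => ?_
  · intro x v h
    by_contra hv
    exact (S.g.pos x v hv).ne' (h v)
  · simp only [HermitianStructure.gBilin_apply, inner_dualPart]
    exact contMDiff_const.mul (A.smooth_pairing e (N.lift Y))

/-- This is the decomposition of the fibre into two isotropic copies of TM, the images of ∇ and s −
∇, with coordinates `A.anchor x e` and `dualPart S N x e`. In them the pairing is the polarized
product of the two coordinates, and the generalized metric exchanges them. -/
theorem nab_add_vert_dualPart (hA : A.IsExact) (x : M) (e : V x) :
    N.nab x (A.anchor x e) + L.vert x (dualPart S N x e) = e := by
  refine sub_eq_zero.1 (eq_zero_of_pairing hA ?_ fun v => ⟨N.nab x v, N.anchor_nab x v, ?_⟩)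
  · rw [map_sub, map_add, N.anchor_nab, L.anchor_vert, add_zero, sub_self]
  · rw [map_sub, LinearMap.sub_apply, map_add, LinearMap.add_apply, N.isotropic,
      L.pairing_vert_nab, inner_dualPart]
    ring

theorem pairing_nab_add_vert (hA : A.IsExact) (x : M) (v w v' w' : T E M x) :
    A.pairing x (N.nab x v + L.vert x w) (N.nab x v' + L.vert x w') =
      1 / 2 * (S.g.inner x w v' + S.g.inner x w' v) := by
  simp only [map_add, LinearMap.add_apply, N.isotropic, L.pairing_vert_nab,
    pairing_eq_zero hA (L.anchor_vert x w) (L.anchor_vert x w'), A.symm x (N.nab x v)]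
  ring

/-- The generalized metric that exchanges `N v` and `(s - N) v`. -/
def reflection (x : M) : V x →ₗ[ℝ] V x :=
  (N.nab x).comp (dualPart S N x) + (L.vert x).comp (A.anchor x)

theorem reflection_apply (x : M) (e : V x) :
    L.reflection x e = N.nab x (dualPart S N x e) + L.vert x (A.anchor x e) := rfl

theorem pairing_eq (L : MetricLift S N) (hA : A.IsExact) (x : M) (e e' : V x) :
    A.pairing x e e' = 1 / 2 * (S.g.inner x (dualPart S N x e) (A.anchor x e') +
      S.g.inner x (dualPart S N x e') (A.anchor x e)) := by
  conv_lhs => rw [← L.nab_add_vert_dualPart hA x e, ← L.nab_add_vert_dualPart hA x e']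
  exact L.pairing_nab_add_vert hA x _ _ _ _

theorem pairing_reflection (hA : A.IsExact) (x : M) (e e' : V x) :
    A.pairing x (L.reflection x e) e' =
      1 / 2 * (S.g.inner x (A.anchor x e) (A.anchor x e') +
        S.g.inner x (dualPart S N x e) (dualPart S N x e')) := by
  conv_lhs => rw [← L.nab_add_vert_dualPart hA x e', L.reflection_apply]
  rw [L.pairing_nab_add_vert hA, S.g.symm x (dualPart S N x e')]

/-- The generalized metric of a metric lift. -/
def generalizedMetric (hA : A.IsExact) : A.GeneralizedMetric where
  G := L.reflection
  smooth_G e := (N.smooth_nab ⟨_, smooth_dualPart e⟩).add_section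
    ((L.smooth_s (A.anchorField e)).sub_section (N.smooth_nab (A.anchorField e)))
  orthogonal x e e' := by
    rw [L.reflection_apply, L.reflection_apply, L.pairing_nab_add_vert hA, L.pairing_eq hA,
      S.g.symm x (A.anchor x e), S.g.symm x (A.anchor x e')]
    ring
  selfAdjoint x e e' := by
    rw [A.symm x e, L.pairing_reflection hA, L.pairing_reflection hA, S.g.symm x (A.anchor x e),
      S.g.symm x (dualPart S N x e)]
  pos x e he := by
    rw [L.pairing_reflection hA]
    have h0 : ∀ v, 0 ≤ S.g.inner x v v := fun v => by
      rcases eq_or_ne v 0 with rfl | hv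
      · simp
      · exact (S.g.pos x v hv).le
    -- Here ⟨Ge, e⟩ is half the sum of the g-squares of the two coordinates of `e`, which cannot
    -- both vanish.
    by_cases h1 : A.anchor x e = 0
    · have h2 : dualPart S N x e ≠ 0 := by
        intro h2
        apply he
        rw [← L.nab_add_vert_dualPart hA x e, h1, h2, map_zero, map_zero, add_zero]
      have := h0 (A.anchor x e)
      have := S.g.pos x _ h2
      linarith
    · have := S.g.pos x _ h1
      have := h0 (dualPart S N x e)
      linarith

/-- The vectors fixed by exchanging the two coordinates are those with equal coordinates, and these
are ∇v + (s − ∇)v = sv. -/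
theorem mem_Vplus_iff (hA : A.IsExact) {x : M} {e : V x} :
    e ∈ (L.generalizedMetric hA).Vplus x ↔ L.s x (A.anchor x e) = e := by
  rw [GeneralizedMetric.mem_Vplus]
  change L.reflection x e = e ↔ _
  have h := L.nab_add_vert_dualPart hA x e
  constructor
  · intro h1
    have h2 : dualPart S N x e = A.anchor x e := by
      have := congrArg (A.anchor x) h1
      rwa [L.reflection_apply, map_add, N.anchor_nab, L.anchor_vert, add_zero] at this
    rw [h2] at h
    rw [← L.nab_add_vert, h]
  · intro h1
    rw [← L.nab_add_vert] at h1
    have h2 : L.vert x (dualPart S N x e) = L.vert x (A.anchor x e) :=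
      add_left_cancel (h.trans h1.symm)
    have h3 : dualPart S N x e = A.anchor x e := by
      refine sub_eq_zero.1 ?_
      by_contra h4
      refine (S.g.pos x _ h4).ne' ?_
      have h5 := L.pairing_vert_nab x (dualPart S N x e - A.anchor x e)
        (dualPart S N x e - A.anchor x e)
      rw [map_sub (L.vert x), h2, sub_self, map_zero, LinearMap.zero_apply] at h5
      linarith
    rw [L.reflection_apply, h3, h1]

theorem s_mem_Vplus (hA : A.IsExact) (x : M) (v : T E M x) :
    L.s x v ∈ (L.generalizedMetric hA).Vplus x :=
  (L.mem_Vplus_iff hA).2 (by rw [L.anchor_s])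

/-- The complex structure on `V₊` that corresponds to the one of `M`. -/
def plusJ (hA : A.IsExact) (x : M) :
    (L.generalizedMetric hA).Vplus x →ₗ[ℝ] (L.generalizedMetric hA).Vplus x :=
  ((L.s x).comp ((S.J x).toLinearMap.comp
    ((A.anchor x).comp ((L.generalizedMetric hA).Vplus x).subtype))).codRestrict _
      fun _ => L.s_mem_Vplus hA x _

theorem plusJ_apply (hA : A.IsExact) (x : M) (e : (L.generalizedMetric hA).Vplus x) :
    (L.plusJ hA x e : V x) = L.s x (S.J x (A.anchor x e)) := rfl

theorem lift_neg (X : VField E M) : L.lift (-X) = -L.lift X := by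
  ext x
  exact map_neg (L.s x) (X x)

theorem isEigenSection_iff (hA : A.IsExact) (a b : Sec E F V) :
    (L.generalizedMetric hA).IsEigenSection (L.plusJ hA) a b ↔
      (∀ x, L.s x (A.anchor x (a x)) = a x ∧ L.s x (A.anchor x (b x)) = b x) ∧
      IsHolField S.J (A.anchorField a) (A.anchorField b) := by
  constructor
  · intro h
    refine ⟨fun x => ?_, fun x => ?_⟩
    · obtain ⟨ha, hb, -, -⟩ := h x
      exact ⟨(L.mem_Vplus_iff hA).1 ha, (L.mem_Vplus_iff hA).1 hb⟩
    · obtain ⟨ha, hb, h1, h2⟩ := h x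
      have h1' : L.s x (S.J x (A.anchor x (a x))) = -b x := congrArg Subtype.val h1
      have h2' : L.s x (S.J x (A.anchor x (b x))) = a x := congrArg Subtype.val h2
      constructor
      · have := congrArg (A.anchor x) h1'
        rwa [L.anchor_s, map_neg] at this
      · have := congrArg (A.anchor x) h2'
        rwa [L.anchor_s] at this
  · rintro ⟨h1, h2⟩ x
    refine ⟨(L.mem_Vplus_iff hA).2 (h1 x).1, (L.mem_Vplus_iff hA).2 (h1 x).2, Subtype.ext ?_,
      Subtype.ext ?_⟩
    · change L.s x (S.J x (A.anchorField a x)) = -b x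
      rw [(h2 x).1, map_neg, A.anchorField_apply, (h1 x).2]
    · change L.s x (S.J x (A.anchorField b x)) = a x
      rw [(h2 x).2, A.anchorField_apply, (h1 x).1]

/-- Eigensections have the form sX − i sJX. Membership of the bracket in V₊ ⊗ ℂ comes from the
curvature condition, the eigenvalue equation from integrability of J on M. -/
theorem involutive (hA : A.IsExact) (hN : N.IsCurvature (-dc S.J S.omega)) (a b a' b' : Sec E F V)
    (h : (L.generalizedMetric hA).IsEigenSection (L.plusJ hA) a b)
    (h' : (L.generalizedMetric hA).IsEigenSection (L.plusJ hA) a' b') :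
    (L.generalizedMetric hA).IsEigenSection (L.plusJ hA) (A.bracket a a' - A.bracket b b')
      (A.bracket a b' + A.bracket b a') := by
  rw [L.isEigenSection_iff hA] at h h' ⊢
  have key : ∀ {a b : Sec E F V}, (∀ x, L.s x (A.anchor x (a x)) = a x ∧
      L.s x (A.anchor x (b x)) = b x) ∧ IsHolField S.J (A.anchorField a) (A.anchorField b) →
      a = L.lift (A.anchorField a) ∧ b = -L.lift (S.Jf (A.anchorField a)) := by
    rintro a b ⟨h1, h2⟩
    constructor
    · ext x
      exact (h1 x).1.symm
    · ext x
      change b x = -L.s x (S.J x (A.anchorField a x))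
      rw [(h2 x).1, map_neg, neg_neg, A.anchorField_apply, (h1 x).2]
  refine ⟨fun x => ⟨?_, ?_⟩, fun x => ?_⟩
  · have hb := L.bracket_mem_of_isCurvature hA hN (A.anchorField a) (A.anchorField a') x
    obtain ⟨ha, hb1⟩ := key h
    obtain ⟨ha', hb1'⟩ := key h'
    have e : (A.bracket a a' - A.bracket b b') x =
        A.bracket (L.lift (A.anchorField a)) (L.lift (A.anchorField a')) x -
        A.bracket (L.lift (S.Jf (A.anchorField a))) (L.lift (S.Jf (A.anchorField a'))) x := by
      rw [hb1, hb1', ← ha, ← ha', LinearMap.map_neg₂, map_neg, neg_neg]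
      rfl
    rw [e]
    exact hb
  -- The imaginary part reduces to the real one: with JY in place of Y, J² = −1 turns the difference
  -- of brackets into [sX, sJY] + [sJX, sY].
  · have hb := L.bracket_mem_of_isCurvature hA hN (A.anchorField a) (S.Jf (A.anchorField a')) x
    obtain ⟨ha, hb1⟩ := key h
    obtain ⟨ha', hb1'⟩ := key h'
    have e : (A.bracket a b' + A.bracket b a') x =
        -(A.bracket (L.lift (A.anchorField a)) (L.lift (S.Jf (A.anchorField a'))) x -
        A.bracket (L.lift (S.Jf (A.anchorField a))) (L.lift (S.Jf (S.Jf (A.anchorField a')))) x) := by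
      rw [hb1, hb1', ← ha, S.Jf_Jf, L.lift_neg, ← ha', LinearMap.map_neg₂, map_neg, map_neg]
      have : ∀ P Q : Sec E F V, (-P + -Q) x = -(P x - (-Q) x) := fun P Q => by
        change -P x + -Q x = -(P x - -Q x)
        abel
      exact this _ _
    rw [e, map_neg, map_neg, hb]
  · have hi := S.integrable _ _ _ _ h.2 h'.2 x
    have ea : A.anchorField (A.bracket a a' - A.bracket b b') x =
        lie (A.anchorField a) (A.anchorField a') x - lie (A.anchorField b) (A.anchorField b') x := by
      rw [← A.anchor_bracket_apply, ← A.anchor_bracket_apply, ← map_sub]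
      rfl
    have eb : A.anchorField (A.bracket a b' + A.bracket b a') x =
        lie (A.anchorField a) (A.anchorField b') x + lie (A.anchorField b) (A.anchorField a') x := by
      rw [← A.anchor_bracket_apply, ← A.anchor_bracket_apply, ← map_add]
      rfl
    rw [ea, eb]
    exact hi

/-- The strong KT structure on `A` of a metric lift over a splitting with curvature `-d^c ω`. -/
def strongKT (hA : A.IsExact) (hN : N.IsCurvature (-dc S.J S.omega)) : A.StrongKT where
  toGeneralizedMetric := L.generalizedMetric hA
  J := L.plusJ hA
  smooth_J e _ := L.smooth_s (S.Jf (A.anchorField e))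
  J_sq x e := by
    refine Subtype.ext ?_
    rw [L.plusJ_apply, L.plusJ_apply, L.anchor_s, S.J_sq, map_neg, (L.mem_Vplus_iff hA).1 e.2]
    rfl
  orthogonal_J x e e' := by
    rw [L.plusJ_apply, L.plusJ_apply, L.pairing_s_s hA, S.hermitian, ← L.pairing_s_s hA,
      (L.mem_Vplus_iff hA).1 e.2, (L.mem_Vplus_iff hA).1 e'.2]
  involutive := L.involutive hA hN

end MetricLift

/-- A splitting whose curvature is −d^cω itself, and not just a cohomologous form, is chosen first;
V₊ is then the graph of g over it. -/
theorem exists_strongKT (hA : A.IsExact) (S : SKT.StrongKT E M)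
    (h : A.HasCharacteristicClass (-dc S.J S.omega)) : ∃ K : A.StrongKT, K.Induces S := by
  obtain ⟨N, hN⟩ := IsotropicSplitting.exists_isCurvature hA h
  let L := MetricLift.ofSplitting hA S.toHermitianStructure N
  refine ⟨L.strongKT hA hN, fun x => ⟨fun e e' => ?_, fun e => ?_⟩⟩
  · have he : L.s x (A.anchor x e) = e := (L.mem_Vplus_iff hA).1 e.2
    have he' : L.s x (A.anchor x e') = e' := (L.mem_Vplus_iff hA).1 e'.2
    rw [← L.pairing_s_s hA, he, he']
  · exact (L.anchor_s x _).symm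

end CourantAlgebroid

/-! ### Lie bracket identities and contractions of forms. -/

section LieCalculus

variable {E : Type*} [NormedAddCommGroup E] [NormedSpace ℝ E] [FiniteDimensional ℝ E]
  {M : Type*} [TopologicalSpace M] [ChartedSpace E M] [IsManifold 𝓘(ℝ, E) ∞ M] [T2Space M]

theorem VField.mdifferentiableAt (X : VField E M) (x : M) :
    MDifferentiableAt 𝓘(ℝ, E) (𝓘(ℝ, E).prod 𝓘(ℝ, E)) (fun x => TotalSpace.mk' E x (X x)) x :=
  X.contMDiff.mdifferentiable (by simp) x

theorem lie_swap (X Y : VField E M) (x : M) : lie X Y x = -lie Y X x :=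
  VectorField.mlieBracket_swap_apply

theorem lie_self (X : VField E M) (x : M) : lie X X x = 0 :=
  congrFun VectorField.mlieBracket_self x

theorem lie_add_left (X X' Y : VField E M) : lie (X + X') Y = lie X Y + lie X' Y := by
  ext x
  exact VectorField.mlieBracket_add_left (X.mdifferentiableAt x) (X'.mdifferentiableAt x)

theorem lie_add_right (X Y Y' : VField E M) : lie X (Y + Y') = lie X Y + lie X Y' := by
  ext x
  exact VectorField.mlieBracket_add_right (Y.mdifferentiableAt x) (Y'.mdifferentiableAt x)

theorem lie_smul_left (c : ℝ) (X Y : VField E M) : lie (c • X) Y = c • lie X Y := by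
  ext x
  exact VectorField.mlieBracket_const_smul_left (X.mdifferentiableAt x)

theorem lie_smul_right (c : ℝ) (X Y : VField E M) : lie X (c • Y) = c • lie X Y := by
  ext x
  exact VectorField.mlieBracket_const_smul_right (Y.mdifferentiableAt x)

theorem lie_fsmul_right (f : C^∞⟮𝓘(ℝ, E), M; ℝ⟯) (X Y : VField E M) (x : M) :
    lie X (fsmul f Y) x = f x • lie X Y x + dfun f x (X x) • Y x := by
  rw [add_comm]
  exact VectorField.mlieBracket_smul_right (f.contMDiff.mdifferentiable (by simp) x)
    (Y.mdifferentiableAt x)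

theorem lie_jacobi (X Y Z : VField E M) :
    lie X (lie Y Z) = lie (lie X Y) Z + lie Y (lie X Z) := by
  have h2 : (minSmoothness ℝ 2 : WithTop ℕ∞) ≤ ∞ := by
    rw [minSmoothness_of_isRCLikeNormedField]
    norm_cast
  have : IsManifold 𝓘(ℝ, E) (minSmoothness ℝ 3) M := by
    rw [minSmoothness_of_isRCLikeNormedField]
    exact IsManifold.of_le (n := ∞) (by norm_cast)
  ext x
  exact VectorField.leibniz_identity_mlieBracket_apply ((X.contMDiff x).of_le h2)
    ((Y.contMDiff x).of_le h2) ((Z.contMDiff x).of_le h2)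

/-- The covector `γ(u, ·)`. -/
def contractTwo (γ : FormField E M ℝ 2) (x : M) (u : T E M x) : T E M x →L[ℝ] ℝ :=
  (γ x).toContinuousMultilinearMap.toContinuousLinearMap ![u, 0] 1

theorem contractTwo_apply (γ : FormField E M ℝ 2) (x : M) (u w : T E M x) :
    contractTwo γ x u w = γ x ![u, w] := by
  change γ x (Function.update ![u, 0] 1 w) = _
  congr 1
  ext i
  fin_cases i <;> rfl

/-- The covector `H(u, v, ·)`. -/
def contractThree (H : FormField E M ℝ 3) (x : M) (u v : T E M x) : T E M x →L[ℝ] ℝ :=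
  (H x).toContinuousMultilinearMap.toContinuousLinearMap ![u, v, 0] 2

theorem contractThree_apply (H : FormField E M ℝ 3) (x : M) (u v w : T E M x) :
    contractThree H x u v w = H x ![u, v, w] := by
  change H x (Function.update ![u, v, 0] 2 w) = _
  congr 1
  ext i
  fin_cases i <;> rfl

/-- A field of covectors as a 1-form. -/
def oneForm (ξ : ∀ x, T E M x →L[ℝ] ℝ) : FormField E M ℝ 1 := fun x =>
  ContinuousAlternatingMap.ofSubsingleton ℝ (T E M x) ℝ (0 : Fin 1) (ξ x)

end LieCalculus

/-! ### Sections of TM ⊕ T*M and the standard pairing. -/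

section Sections

variable {E : Type*} [NormedAddCommGroup E] [NormedSpace ℝ E] [FiniteDimensional ℝ E]
  {M : Type*} [TopologicalSpace M] [ChartedSpace E M] [IsManifold 𝓘(ℝ, E) ∞ M] [T2Space M]

variable (E M) in
/-- The smooth sections of `TM ⊕ T*M`. -/
abbrev TTSec : Type _ := Sec E (E × (E →L[ℝ] ℝ)) (TTstar E M)

namespace TTSec

/-- The vector field of a section of `TM ⊕ T*M`. -/
def fld (a : TTSec E M) : VField E M where
  toFun x := (a x).1
  contMDiff_toFun := by
    intro x
    have h := (contMDiffAt_totalSpace.1 (a.contMDiff x)).2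
    exact contMDiffAt_totalSpace.2 ⟨contMDiffAt_id, contDiff_fst.contMDiff.contMDiffAt.comp x h⟩

/-- The field of covectors of a section of `TM ⊕ T*M`. -/
def cov (a : TTSec E M) (x : M) : T E M x →L[ℝ] ℝ := (a x).2

theorem contMDiff_cov (a : TTSec E M) (Y : VField E M) :
    ContMDiff 𝓘(ℝ, E) 𝓘(ℝ, ℝ) ∞ (fun x => a.cov x (Y x)) := by
  have h1 : ContMDiff 𝓘(ℝ, E) (𝓘(ℝ, E).prod 𝓘(ℝ, E →L[ℝ] ℝ)) ∞
      (fun x => TotalSpace.mk' (E →L[ℝ] ℝ) (E := Tstar E M) x (a x).2) := by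
    intro x
    have h := (contMDiffAt_totalSpace.1 (a.contMDiff x)).2
    have h' : ContMDiffAt 𝓘(ℝ, E) 𝓘(ℝ, E →L[ℝ] ℝ) ∞ _ x :=
      (contDiff_snd (𝕜 := ℝ) (E := E) (F := E →L[ℝ] ℝ)).contMDiff.contMDiffAt.comp x h
    exact contMDiffAt_totalSpace.2 ⟨contMDiffAt_id, h'⟩
  have h2 : ContMDiff 𝓘(ℝ, E) (𝓘(ℝ, E).prod 𝓘(ℝ)) ∞
      (fun x => TotalSpace.mk' ℝ (E := Bundle.Trivial M ℝ) x ((a x).2 (Y x))) :=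
    ContMDiff.clm_bundle_apply (F₁ := E) h1 Y.contMDiff
  intro x
  exact (contMDiffAt_totalSpace.1 (h2 x)).2

variable (E) in
/-- The pairing `(η(X) + ξ(Y)) / 2` of `X + ξ` and `Y + η`. -/
def stdPairing (x : M) : TTstar E M x →ₗ[ℝ] TTstar E M x →ₗ[ℝ] ℝ :=
  LinearMap.mk₂ ℝ (fun e e' => (1 / 2 : ℝ) * ((e'.2 e.1 : ℝ) + (e.2 e'.1 : ℝ)))
    (fun e₁ e₂ e' => by
      change (1 / 2 : ℝ) * ((e'.2 (e₁.1 + e₂.1) : ℝ) + ((e₁.2 e'.1 : ℝ) + (e₂.2 e'.1 : ℝ))) = _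
      rw [map_add]
      change (1 / 2 : ℝ) * (((e'.2 e₁.1 : ℝ) + (e'.2 e₂.1 : ℝ)) + _) = _
      ring)
    (fun c e e' => by
      change (1 / 2 : ℝ) * ((e'.2 (c • e.1) : ℝ) + c * (e.2 e'.1 : ℝ)) = c * _
      rw [map_smul]
      change (1 / 2 : ℝ) * (c * (e'.2 e.1 : ℝ) + _) = _
      ring)
    (fun e e₁ e₂ => by
      change (1 / 2 : ℝ) * (((e₁.2 e.1 : ℝ) + (e₂.2 e.1 : ℝ)) + (e.2 (e₁.1 + e₂.1) : ℝ)) = _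
      rw [map_add]
      change (1 / 2 : ℝ) * (_ + ((e.2 e₁.1 : ℝ) + (e.2 e₂.1 : ℝ))) = _
      ring)
    (fun c e e' => by
      change (1 / 2 : ℝ) * (c * (e'.2 e.1 : ℝ) + (e.2 (c • e'.1) : ℝ)) = c * _
      rw [map_smul]
      change (1 / 2 : ℝ) * (_ + c * (e.2 e'.1 : ℝ)) = _
      ring)

theorem stdPairing_apply (x : M) (e e' : TTstar E M x) :
    stdPairing E x e e' = (1 / 2 : ℝ) * ((e'.2 e.1 : ℝ) + (e.2 e'.1 : ℝ)) := rfl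

theorem stdPairing_nondegenerate (x : M) (e : TTstar E M x)
    (h : ∀ e', stdPairing E x e e' = 0) : e = 0 := by
  have : FiniteDimensional ℝ (T E M x) := inferInstanceAs (FiniteDimensional ℝ E)
  have h1 : e.1 = 0 := by
    by_contra hv
    obtain ⟨l, hl⟩ : ∃ l : E →L[ℝ] ℝ, l e.1 ≠ 0 :=
      SeparatingDual.exists_ne_zero (R := ℝ) (V := E) hv
    have h2 := h (0, l)
    rw [stdPairing_apply] at h2
    change (1 / 2 : ℝ) * (l e.1 + (e.2 0 : ℝ)) = 0 at h2
    rw [map_zero] at h2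
    change (1 / 2 : ℝ) * (l e.1 + 0) = 0 at h2
    exact hl (by linarith)
  have h2 : e.2 = 0 := by
    ext w
    have h3 := h (w, 0)
    rw [stdPairing_apply] at h3
    change (1 / 2 : ℝ) * (0 + (e.2 w : ℝ)) = 0 at h3
    change (e.2 w : ℝ) = 0
    linarith
  exact Prod.ext h1 h2

theorem contMDiff_stdPairing (a b : TTSec E M) :
    ContMDiff 𝓘(ℝ, E) 𝓘(ℝ, ℝ) ∞ (fun x => stdPairing E x (a x) (b x)) :=
  contMDiff_const.mul ((b.contMDiff_cov a.fld).add (a.contMDiff_cov b.fld))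

/-- The section `X + ξ`. -/
def mk (X : VField E M) (ξ : ∀ x, T E M x →L[ℝ] ℝ)
    (hξ : ∀ Y : VField E M, ContMDiff 𝓘(ℝ, E) 𝓘(ℝ, ℝ) ∞ (fun x => ξ x (Y x))) : TTSec E M where
  toFun x := (X x, ξ x)
  -- Testing against the standard pairing reduces smoothness to that of ξ on vector fields, with no
  -- work in bundle coordinates.
  contMDiff_toFun := contMDiff_section_of_pairing (E := E) (V := TTstar E M) (W := TTstar E M)
    (stdPairing E) contMDiff_stdPairing stdPairing_nondegenerate _ fun t =>
      contMDiff_const.mul ((contMDiff_cov t X).add (hξ (fld t)))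

theorem ext_of_apply {a b : TTSec E M} (h1 : ∀ x, a.fld x = b.fld x)
    (h2 : ∀ (Z : VField E M) x, a.cov x (Z x) = b.cov x (Z x)) : a = b := by
  refine ContMDiffSection.ext fun x => ?_
  refine Prod.ext (h1 x) (ContinuousLinearMap.ext fun w => ?_)
  obtain ⟨Z, rfl⟩ := exists_vfield x w
  exact h2 Z x

end TTSec

end Sections

/-! ### The twisted bracket on TM ⊕ T*M. -/

section Standard

variable {E : Type*} [NormedAddCommGroup E] [NormedSpace ℝ E] [FiniteDimensional ℝ E]
  {M : Type*} [TopologicalSpace M] [ChartedSpace E M] [IsManifold 𝓘(ℝ, E) ∞ M] [T2Space M]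

/-- The derivative of a function along a vector field. -/
def der (X : VField E M) (f : M → ℝ) (x : M) : ℝ := dfun f x (X x)

theorem contMDiff_der {f : M → ℝ} (hf : ContMDiff 𝓘(ℝ, E) 𝓘(ℝ, ℝ) ∞ f) (X : VField E M) :
    ContMDiff 𝓘(ℝ, E) 𝓘(ℝ, ℝ) ∞ (der X f) := contMDiff_dfun hf X

theorem der_add {f g : M → ℝ} (hf : ContMDiff 𝓘(ℝ, E) 𝓘(ℝ, ℝ) ∞ f)
    (hg : ContMDiff 𝓘(ℝ, E) 𝓘(ℝ, ℝ) ∞ g) (X : VField E M) (x : M) :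
    der X (f + g) x = der X f x + der X g x :=
  DFunLike.congr_fun (dfun_add hf hg x) (X x)

theorem der_sub {f g : M → ℝ} (hf : ContMDiff 𝓘(ℝ, E) 𝓘(ℝ, ℝ) ∞ f)
    (hg : ContMDiff 𝓘(ℝ, E) 𝓘(ℝ, ℝ) ∞ g) (X : VField E M) (x : M) :
    der X (f - g) x = der X f x - der X g x :=
  DFunLike.congr_fun (dfun_sub hf hg x) (X x)

theorem der_smul {f : M → ℝ} (c : ℝ) (hf : ContMDiff 𝓘(ℝ, E) 𝓘(ℝ, ℝ) ∞ f) (X : VField E M)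
    (x : M) : der X (c • f) x = c * der X f x :=
  DFunLike.congr_fun (dfun_const_mul c hf x) (X x)

theorem der_mul {f g : M → ℝ} (hf : ContMDiff 𝓘(ℝ, E) 𝓘(ℝ, ℝ) ∞ f)
    (hg : ContMDiff 𝓘(ℝ, E) 𝓘(ℝ, ℝ) ∞ g) (X : VField E M) (x : M) :
    der X (f * g) x = f x * der X g x + g x * der X f x :=
  DFunLike.congr_fun (dfun_mul hf hg x) (X x)

theorem der_add_left (X Y : VField E M) (f : M → ℝ) (x : M) :
    der (X + Y) f x = der X f x + der Y f x := map_add (dfun f x) (X x) (Y x)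

theorem der_smul_left (c : ℝ) (X : VField E M) (f : M → ℝ) (x : M) :
    der (c • X) f x = c * der X f x := map_smul (dfun f x) c (X x)

theorem der_lie {f : M → ℝ} (hf : ContMDiff 𝓘(ℝ, E) 𝓘(ℝ, ℝ) ∞ f) (X Y : VField E M) (x : M) :
    der (lie X Y) f x = der X (der Y f) x - der Y (der X f) x := dfun_lie hf X Y x

/-- The value of a 3-form on vector fields. -/
def evalThree (H : FormField E M ℝ 3) (X Y Z : VField E M) (x : M) : ℝ := H x ![X x, Y x, Z x]

theorem evalThree_swap (H : FormField E M ℝ 3) (X Y Z : VField E M) (x : M) :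
    evalThree H X Y Z x = -evalThree H Y X Z x := alternating_three_swap_zero_one _ _ _ _

theorem evalThree_rotate (H : FormField E M ℝ 3) (X Y Z : VField E M) (x : M) :
    evalThree H X Y Z x = evalThree H Z X Y x := alternating_three_rotate _ _ _ _

theorem evalThree_self (H : FormField E M ℝ 3) (X Z : VField E M) (x : M) :
    evalThree H X X Z x = 0 := by
  have := evalThree_swap H X X Z x
  linarith

theorem evalThree_add (H : FormField E M ℝ 3) (X X' Y Z : VField E M) (x : M) :
    evalThree H (X + X') Y Z x = evalThree H X Y Z x + evalThree H X' Y Z x :=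
  (H x).toAlternatingMap.map_vecCons_add ![Y x, Z x] (X x) (X' x)

theorem evalThree_smul (H : FormField E M ℝ 3) (c : ℝ) (X Y Z : VField E M) (x : M) :
    evalThree H (c • X) Y Z x = c * evalThree H X Y Z x :=
  (H x).toAlternatingMap.map_vecCons_smul ![Y x, Z x] c (X x)

theorem evalThree_fsmul (H : FormField E M ℝ 3) (f : C^∞⟮𝓘(ℝ, E), M; ℝ⟯) (X Y Z : VField E M)
    (x : M) : evalThree H (fsmul f X) Y Z x = f x * evalThree H X Y Z x :=
  (H x).toAlternatingMap.map_vecCons_smul ![Y x, Z x] (f x) (X x)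

/-- The value of a closed 3-form on brackets. -/
theorem evalThree_closed {H : FormField E M ℝ 3} (hs : IsSmoothForm H) (hd : d H = 0)
    (X Y Z W : VField E M) (x : M) :
    der X (evalThree H Y Z W) x - der Y (evalThree H X Z W) x + der Z (evalThree H X Y W) x
      - der W (evalThree H X Y Z) x - evalThree H (lie X Y) Z W x + evalThree H (lie X Z) Y W x
      - evalThree H (lie X W) Y Z x - evalThree H (lie Y Z) X W x + evalThree H (lie Y W) X Z x
      - evalThree H (lie Z W) X Y x = 0 := by
  have h := d_apply_three hs X Y Z W x
  rw [hd] at h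
  exact h.symm

namespace TTSec

/-- The function `ξ(Z)` for a section `X + ξ`. -/
def ev (a : TTSec E M) (Z : VField E M) (x : M) : ℝ := cov a x (Z x)

theorem contMDiff_ev (a : TTSec E M) (Z : VField E M) :
    ContMDiff 𝓘(ℝ, E) 𝓘(ℝ, ℝ) ∞ (ev a Z) := contMDiff_cov a Z

theorem ev_add_right (a : TTSec E M) (Y Z : VField E M) (x : M) :
    ev a (Y + Z) x = ev a Y x + ev a Z x := map_add (cov a x) (Y x) (Z x)

theorem ev_smul_right (a : TTSec E M) (c : ℝ) (Z : VField E M) (x : M) :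
    ev a (c • Z) x = c * ev a Z x := map_smul (cov a x) c (Z x)

theorem ev_lie_swap (a : TTSec E M) (Y Z : VField E M) (x : M) :
    ev a (lie Y Z) x = -ev a (lie Z Y) x := by
  rw [ev, lie_swap, map_neg]
  rfl

theorem isSmoothForm_oneForm (a : TTSec E M) : IsSmoothForm (oneForm (cov a)) :=
  fun X => contMDiff_cov a (X 0)

/-- The covector part `L_X η - i_Y dξ + i_Y i_X H` of the bracket of `X + ξ` and `Y + η`. -/
def bracketCov (H : FormField E M ℝ 3) (a b : TTSec E M) (x : M) : T E M x →L[ℝ] ℝ :=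
  -- The first two terms are L_X η, by Cartan's formula i_X dη + d(η(X)).
  contractTwo (d (oneForm (cov b))) x (fld a x) + dfun (ev b (fld a)) x
    - contractTwo (d (oneForm (cov a))) x (fld b x) + contractThree H x (fld a x) (fld b x)

theorem bracketCov_apply (H : FormField E M ℝ 3) (a b : TTSec E M) (Z : VField E M) (x : M) :
    bracketCov H a b x (Z x) = der (fld a) (ev b Z) x - ev b (lie (fld a) Z) x
      - der (fld b) (ev a Z) x + der Z (ev a (fld b)) x + ev a (lie (fld b) Z) x
      + evalThree H (fld a) (fld b) Z x := by
  have h1 := d_apply_one (isSmoothForm_oneForm b) (fld a) Z x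
  have h2 := d_apply_one (isSmoothForm_oneForm a) (fld b) Z x
  have e : ∀ (a : TTSec E M) (Z : VField E M) y, oneForm (cov a) y ![Z y] = ev a Z y :=
    fun _ _ _ => rfl
  simp only [e] at h1 h2
  change contractTwo (d (oneForm (cov b))) x (fld a x) (Z x) + dfun (ev b (fld a)) x (Z x)
    - contractTwo (d (oneForm (cov a))) x (fld b x) (Z x) +
      contractThree H x (fld a x) (fld b x) (Z x) = _
  rw [contractTwo_apply, contractTwo_apply, contractThree_apply, h1, h2]
  simp only [der, evalThree]
  ring

variable {H : FormField E M ℝ 3}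

/-- The bracket of two sections of `TM ⊕ T*M`. -/
def bracketSec (hs : IsSmoothForm H) (a b : TTSec E M) : TTSec E M :=
  mk (lie (fld a) (fld b)) (bracketCov H a b) fun Z => by
    simp only [bracketCov_apply]
    exact (((((contMDiff_der (contMDiff_ev b Z) _).sub (contMDiff_ev b _)).sub
      (contMDiff_der (contMDiff_ev a Z) _)).add (contMDiff_der (contMDiff_ev a _) Z)).add
      (contMDiff_ev a _)).add (hs.apply_three _ _ Z)

theorem fld_bracketSec (hs : IsSmoothForm H) (a b : TTSec E M) :
    fld (bracketSec hs a b) = lie (fld a) (fld b) := rfl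

theorem ev_bracketSec (hs : IsSmoothForm H) (a b : TTSec E M) (Z : VField E M) :
    ev (bracketSec hs a b) Z = der (fld a) (ev b Z) - ev b (lie (fld a) Z)
      - der (fld b) (ev a Z) + der Z (ev a (fld b)) + ev a (lie (fld b) Z)
      + evalThree H (fld a) (fld b) Z :=
  funext fun x => bracketCov_apply H a b Z x

theorem ext_of_ev {a b : TTSec E M} (h1 : ∀ x, fld a x = fld b x)
    (h2 : ∀ (Z : VField E M) x, ev a Z x = ev b Z x) : a = b := ext_of_apply h1 h2

theorem fld_add (a b : TTSec E M) : fld (a + b) = fld a + fld b := rfl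

theorem fld_smul (c : ℝ) (a : TTSec E M) : fld (c • a) = c • fld a := rfl

theorem ev_add (a b : TTSec E M) (Z : VField E M) : ev (a + b) Z = ev a Z + ev b Z := rfl

theorem ev_smul (c : ℝ) (a : TTSec E M) (Z : VField E M) : ev (c • a) Z = c • ev a Z := rfl

theorem bracketSec_add_left (hs : IsSmoothForm H) (a a' b : TTSec E M) :
    bracketSec hs (a + a') b = bracketSec hs a b + bracketSec hs a' b := by
  refine ext_of_ev (fun x => ?_) fun Z x => ?_
  · rw [fld_bracketSec, fld_add, lie_add_left]
    rfl
  · simp only [ev_add, ev_bracketSec, fld_add, lie_add_left, Pi.add_apply, Pi.sub_apply,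
      der_add_left, ev_add_right, evalThree_add, der_add (contMDiff_ev a _) (contMDiff_ev a' _)]
    ring

theorem bracketSec_smul_left (hs : IsSmoothForm H) (c : ℝ) (a b : TTSec E M) :
    bracketSec hs (c • a) b = c • bracketSec hs a b := by
  refine ext_of_ev (fun x => ?_) fun Z x => ?_
  · rw [fld_bracketSec, fld_smul, lie_smul_left]
    rfl
  · simp only [ev_smul, ev_bracketSec, fld_smul, lie_smul_left, Pi.add_apply, Pi.sub_apply,
      der_smul_left, ev_smul_right, evalThree_smul, der_smul c (contMDiff_ev a _), Pi.smul_apply,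
      smul_eq_mul]
    ring

theorem bracketSec_add_right (hs : IsSmoothForm H) (a b b' : TTSec E M) :
    bracketSec hs a (b + b') = bracketSec hs a b + bracketSec hs a b' := by
  have h : ev a (fld b + fld b') = ev a (fld b) + ev a (fld b') := funext (ev_add_right a _ _)
  refine ext_of_ev (fun x => ?_) fun Z x => ?_
  · rw [fld_bracketSec, fld_add, lie_add_right]
    rfl
  · simp only [ev_add, ev_bracketSec, fld_add, lie_add_left, Pi.add_apply, Pi.sub_apply, h,
      der_add_left, ev_add_right, evalThree_swap H (fld a), evalThree_add,
      der_add (contMDiff_ev b _) (contMDiff_ev b' _), der_add (contMDiff_ev a _) (contMDiff_ev a _)]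
    ring

theorem bracketSec_smul_right (hs : IsSmoothForm H) (c : ℝ) (a b : TTSec E M) :
    bracketSec hs a (c • b) = c • bracketSec hs a b := by
  have h : ev a (c • fld b) = c • ev a (fld b) := funext (ev_smul_right a _ _)
  refine ext_of_ev (fun x => ?_) fun Z x => ?_
  · rw [fld_bracketSec, fld_smul, lie_smul_right]
    rfl
  · simp only [ev_smul, ev_bracketSec, fld_smul, lie_smul_left, Pi.add_apply, Pi.sub_apply, h,
      der_smul_left, ev_smul_right, evalThree_swap H (fld a), evalThree_smul,
      der_smul c (contMDiff_ev b _), der_smul c (contMDiff_ev a _), Pi.smul_apply, smul_eq_mul]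
    ring

/-- Nested brackets differentiate the covector part of the inner bracket, so the Jacobi identity
needs this expansion. All terms become `der`, `ev` and `evalThree` of vector fields, on which the
identity is linear. -/
theorem der_ev_bracketSec (hs : IsSmoothForm H) (a b : TTSec E M) (Z W : VField E M) (x : M) :
    der W (ev (bracketSec hs a b) Z) x = der W (der (fld a) (ev b Z)) x
      - der W (ev b (lie (fld a) Z)) x - der W (der (fld b) (ev a Z)) x
      + der W (der Z (ev a (fld b))) x + der W (ev a (lie (fld b) Z)) x
      + der W (evalThree H (fld a) (fld b) Z) x := by
  have h1 := contMDiff_der (contMDiff_ev b Z) (fld a)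
  have h2 := contMDiff_ev b (lie (fld a) Z)
  have h3 := contMDiff_der (contMDiff_ev a Z) (fld b)
  have h4 := contMDiff_der (contMDiff_ev a (fld b)) Z
  have h5 := contMDiff_ev a (lie (fld b) Z)
  have h6 : ContMDiff 𝓘(ℝ, E) 𝓘(ℝ, ℝ) ∞ (evalThree H (fld a) (fld b) Z) := hs.apply_three _ _ Z
  have h12 : ContMDiff 𝓘(ℝ, E) 𝓘(ℝ, ℝ) ∞ (der (fld a) (ev b Z) - ev b (lie (fld a) Z)) := h1.sub h2
  have h123 : ContMDiff 𝓘(ℝ, E) 𝓘(ℝ, ℝ) ∞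
      (der (fld a) (ev b Z) - ev b (lie (fld a) Z) - der (fld b) (ev a Z)) := h12.sub h3
  rw [ev_bracketSec, der_add ((h123.add h4).add h5) h6, der_add (h123.add h4) h5, der_add h123 h4,
    der_sub h12 h3, der_sub h1 h2]

theorem bracketSec_jacobi (hs : IsSmoothForm H) (hd : d H = 0) (a b c : TTSec E M) :
    bracketSec hs a (bracketSec hs b c) =
      bracketSec hs (bracketSec hs a b) c + bracketSec hs b (bracketSec hs a c) := by
  refine ext_of_ev (fun x => ?_) fun Z x => ?_
  · rw [fld_add, fld_bracketSec, fld_bracketSec, fld_bracketSec, fld_bracketSec, fld_bracketSec,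
      fld_bracketSec, lie_jacobi]
  · have jac : ∀ (a : TTSec E M) (X Y Z : VField E M), ev a (lie X (lie Y Z)) x =
        ev a (lie (lie X Y) Z) x + ev a (lie Y (lie X Z)) x := fun a X Y Z => by
      rw [lie_jacobi, ev_add_right]
    have hH := evalThree_closed hs hd (fld a) (fld b) (fld c) Z x
    rw [ev_add, Pi.add_apply, ev_bracketSec hs a (bracketSec hs b c),
      ev_bracketSec hs (bracketSec hs a b) c, ev_bracketSec hs b (bracketSec hs a c)]
    simp only [Pi.add_apply, Pi.sub_apply, der_ev_bracketSec, fld_bracketSec]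
    simp only [ev_bracketSec, Pi.add_apply, Pi.sub_apply]
    -- Derivatives along brackets become commutators and cancel the second derivatives, and the
    -- Jacobi identity for fields treats nested brackets. The remaining terms containing H are those
    -- of dH(X, Y, W, Z), which vanish by `hH`.
    rw [der_lie (contMDiff_ev c Z), der_lie (contMDiff_ev b Z), der_lie (contMDiff_ev a Z),
      der_lie (contMDiff_ev b (fld c)), der_lie (contMDiff_ev a (fld b)),
      der_lie (contMDiff_ev a (fld c)), jac c (fld a) (fld b) Z, jac b (fld a) (fld c) Z,
      jac a (fld b) (fld c) Z]
    rw [evalThree_rotate H (fld b) (fld c) (lie (fld a) Z),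
      evalThree_swap H (fld a) (lie (fld b) (fld c)) Z,
      evalThree_rotate H (fld a) (fld b) (lie (fld c) Z),
      evalThree_rotate H (fld a) (fld c) (lie (fld b) Z),
      evalThree_swap H (fld b) (lie (fld a) (fld c)) Z]
    linarith

theorem bracketSec_fsmul (hs : IsSmoothForm H) (a b : TTSec E M) (f : C^∞⟮𝓘(ℝ, E), M; ℝ⟯) :
    bracketSec hs a (fsmul f b) = fsmul f (bracketSec hs a b) +
      fsmul ⟨_, contMDiff_der f.contMDiff (fld a)⟩ b := by
  refine ext_of_ev (fun x => lie_fsmul_right f (fld a) (fld b) x) fun Z x => ?_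
  have e1 : ∀ (b : TTSec E M) Z, ev (fsmul f b) Z = ⇑f * ev b Z := fun _ _ => rfl
  have e2 : fld (fsmul f b) = fsmul f (fld b) := rfl
  have e3 : ev a (fsmul f (fld b)) = ⇑f * ev a (fld b) := funext fun x =>
    map_smul (cov a x) (f x) (fld b x)
  have e4 : ev a (lie (fsmul f (fld b)) Z) x =
      f x * ev a (lie (fld b) Z) x - der Z f x * ev a (fld b) x := by
    rw [ev_lie_swap, ev_lie_swap a (fld b), ev, lie_fsmul_right, map_add, map_smul, map_smul]
    change -(f x * ev a (lie Z (fld b)) x + der Z f x * ev a (fld b) x) = _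
    ring
  have e5 : ∀ g : M → ℝ, der (fsmul f (fld b)) g x = f x * der (fld b) g x := fun g =>
    map_smul (dfun g x) (f x) (fld b x)
  have e6 : ev (fsmul ⟨_, contMDiff_der f.contMDiff (fld a)⟩ b) Z x = der (fld a) f x * ev b Z x :=
    rfl
  rw [ev_add, Pi.add_apply, e6]
  simp only [ev_bracketSec, Pi.add_apply, Pi.sub_apply, Pi.mul_apply, e1, e2, e3, e4, e5,
    der_mul f.contMDiff (contMDiff_ev _ _), evalThree_swap H (fld a), evalThree_fsmul]
  ring

theorem stdPairing_eq_ev (a b : TTSec E M) (x : M) :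
    stdPairing E x (a x) (b x) = 1 / 2 * (ev b (fld a) x + ev a (fld b) x) := rfl

theorem der_stdPairing (a b : TTSec E M) (Z : VField E M) (x : M) :
    der Z (fun y => stdPairing E y (a y) (b y)) x =
      1 / 2 * (der Z (ev b (fld a)) x + der Z (ev a (fld b)) x) := by
  have e : (fun y => stdPairing E y (a y) (b y)) =
      (1 / 2 : ℝ) • (ev b (fld a) + ev a (fld b)) := rfl
  rw [e, der_smul _ ((contMDiff_ev b _).add (contMDiff_ev a _)),
    der_add (contMDiff_ev b _) (contMDiff_ev a _)]

variable (H) in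
/-- The exact Courant algebroid `TM ⊕ T*M` with the bracket twisted by a closed 3-form. -/
def courant (hs : IsSmoothForm H) (hd : d H = 0) :
    CourantAlgebroid E (E × (E →L[ℝ] ℝ)) (TTstar E M) where
  pairing := stdPairing E
  anchor x := LinearMap.fst ℝ _ _
  -- The 2 compensates the factor ½ in the pairing.
  coanchor x := (2 : ℝ) • LinearMap.inr ℝ (T E M x) (Tstar E M x)
  bracket := LinearMap.mk₂ ℝ (bracketSec hs) (bracketSec_add_left hs) (bracketSec_smul_left hs)
    (bracketSec_add_right hs) (bracketSec_smul_right hs)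
  smooth_pairing := contMDiff_stdPairing
  smooth_anchor a := (fld a).contMDiff
  symm x e e' := by rw [stdPairing_apply, stdPairing_apply, add_comm]
  nondegenerate := stdPairing_nondegenerate
  pairing_coanchor x ξ e := by
    rw [stdPairing_apply]
    change (1 / 2 : ℝ) * ((e.2 ((2 : ℝ) • (0 : T E M x)) : ℝ) + 2 * ξ e.1) = ξ e.1
    rw [smul_zero, map_zero]
    change (1 / 2 : ℝ) * (0 + 2 * ξ e.1) = ξ e.1
    ring
  jacobi := bracketSec_jacobi hs hd
  anchor_bracket a b x := rfl
  leibniz a b f x := by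
    change bracketSec hs a (fsmul f b) x = _
    rw [bracketSec_fsmul]
    rfl
  invariance a b c x := by
    change der (fld a) (fun y => stdPairing E y (b y) (c y)) x =
      stdPairing E x (bracketSec hs a b x) (c x) + stdPairing E x (b x) (bracketSec hs a c x)
    rw [der_stdPairing, stdPairing_eq_ev, stdPairing_eq_ev]
    simp only [ev_bracketSec, fld_bracketSec, Pi.add_apply, Pi.sub_apply]
    rw [ev_lie_swap a (fld c) (fld b), evalThree_rotate H (fld a) (fld c),
      evalThree_swap H (fld b) (fld a), evalThree_rotate H (fld a) (fld b),
      evalThree_swap H (fld c) (fld a), evalThree_rotate H (fld a) (fld c),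
      evalThree_swap H (fld b) (fld a), evalThree_rotate H (fld a) (fld b)]
    ring
  bracket_self a x := by
    have h : bracketSec hs a a x = ((0 : T E M x), (dfun (ev a (fld a)) x : Tstar E M x)) := by
      refine Prod.ext (lie_self (fld a) x) (ContinuousLinearMap.ext fun w => ?_)
      obtain ⟨Z, rfl⟩ := exists_vfield x w
      change ev (bracketSec hs a a) Z x = der Z (ev a (fld a)) x
      rw [ev_bracketSec]
      simp only [Pi.add_apply, Pi.sub_apply, evalThree_self]
      ring
    have h2 : (fun y => stdPairing E y (a y) (a y)) = ev a (fld a) := by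
      funext y
      rw [stdPairing_eq_ev]
      ring
    change bracketSec hs a a x = (1 / 2 : ℝ) • ((2 : ℝ) •
      ((0 : T E M x), (dfun (fun y => stdPairing E y (a y) (a y)) x : Tstar E M x)))
    rw [h, h2, smul_smul]
    norm_num

theorem isExact_courant (hs : IsSmoothForm H) (hd : d H = 0) : (courant H hs hd).IsExact := by
  intro x
  refine ⟨?_, ?_, ?_⟩
  · intro ξ ξ' h
    have h2 : (2 : ℝ) • ξ = (2 : ℝ) • ξ' := congrArg Prod.snd h
    exact smul_right_injective _ two_ne_zero h2
  · intro v
    exact ⟨(v, 0), rfl⟩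
  · intro e
    constructor
    · intro h
      refine ⟨(1 / 2 : ℝ) • e.2, Prod.ext ?_ ?_⟩
      · change (2 : ℝ) • (0 : T E M x) = e.1
        rw [smul_zero]
        exact h.symm
      · change (2 : ℝ) • (1 / 2 : ℝ) • e.2 = e.2
        rw [smul_smul]
        norm_num
    · rintro ⟨ξ, rfl⟩
      exact smul_zero (2 : ℝ)

/-- The inclusion of `TM` as an isotropic splitting. -/
def courantSplitting (hs : IsSmoothForm H) (hd : d H = 0) :
    (courant H hs hd).IsotropicSplitting where
  nab x := LinearMap.inl ℝ _ _
  smooth_nab X := (mk X 0 fun _ => contMDiff_const).contMDiff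
  anchor_nab x v := rfl
  isotropic x v w := by
    change (1 / 2 : ℝ) * (0 + 0) = 0
    norm_num

theorem isCurvature_courantSplitting (hs : IsSmoothForm H) (hd : d H = 0) :
    (courantSplitting hs hd).IsCurvature H := by
  intro X Y Z x
  let N := courantSplitting hs hd
  change evalThree H X Y Z x = 2 * stdPairing E x (bracketSec hs (N.lift X) (N.lift Y) x) (N.lift Z x)
  have e0 : ∀ X Z : VField E M, ev (N.lift X) Z = fun _ => 0 := fun _ _ => rfl
  have e1 : ∀ X : VField E M, fld (N.lift X) = X := fun _ => rfl
  have e2 : ∀ X : VField E M, der X (fun _ => 0) x = 0 := fun X => by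
    rw [der, dfun_const]
    rfl
  rw [stdPairing_eq_ev]
  simp only [ev_bracketSec, e0, e1, e2, Pi.add_apply, Pi.sub_apply]
  ring

end TTSec

end Standard

end SKT

end

/-! ### The equivalence of the two kinds of strong KT structure. -/

theorem mainTheorem5
    {E : Type*} [NormedAddCommGroup E] [NormedSpace ℝ E] [FiniteDimensional ℝ E]
    {M : Type*} [TopologicalSpace M] [ChartedSpace E M] [IsManifold 𝓘(ℝ, E) ∞ M]
    [T2Space M] [SigmaCompactSpace M] :
    (∀ (F : Type*) [NormedAddCommGroup F] [NormedSpace ℝ F] [FiniteDimensional ℝ F]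
        (V : M → Type*) [TopologicalSpace (TotalSpace F V)]
        [∀ x, AddCommGroup (V x)] [∀ x, Module ℝ (V x)] [∀ x, TopologicalSpace (V x)]
        [FiberBundle F V] [VectorBundle ℝ F V] [ContMDiffVectorBundle ∞ F V 𝓘(ℝ, E)]
        (A : SKT.CourantAlgebroid E F V), A.IsExact →
      -- a strong KT structure on `A` induces one on `M`, and `[d^c ω] = -[H]`
      (∀ K : A.StrongKT, (∃! S : SKT.StrongKT E M, K.Induces S) ∧
        ∀ S : SKT.StrongKT E M, K.Induces S →
          A.HasCharacteristicClass (-(SKT.dc S.J S.omega))) ∧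
      -- a strong KT structure on `M` comes from one on `A` if the class of `A` is `[-d^c ω]`
      (∀ S : SKT.StrongKT E M, A.HasCharacteristicClass (-(SKT.dc S.J S.omega)) →
        ∃ K : A.StrongKT, K.Induces S)) ∧
    -- an exact Courant algebroid with class `[-d^c ω]` exists, on the bundle `TM ⊕ T*M`
    (∀ S : SKT.StrongKT E M,
      ∃ A : SKT.CourantAlgebroid E (E × (E →L[ℝ] ℝ)) (SKT.TTstar E M),
        A.IsExact ∧ A.HasCharacteristicClass (-(SKT.dc S.J S.omega)) ∧
          ∃ K : A.StrongKT, K.Induces S) := by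
  refine ⟨fun F _ _ _ V _ _ _ _ _ _ _ A hA => ⟨fun K => ⟨⟨K.induced hA, K.induces_induced hA,
    fun S hS => K.eq_induced hA hS⟩, fun S hS => K.hasCharacteristicClass_of_induces hA hS⟩,
    fun S hS => SKT.CourantAlgebroid.exists_strongKT hA S hS⟩, fun S => ?_⟩
  have hs := S.toHermitianStructure.isSmoothForm_dc_omega.neg
  -- The strong KT condition is exactly the closedness that the twisted bracket requires for its
  -- Jacobi identity.
  have hd : SKT.d (-SKT.dc S.J S.omega) = 0 := by
    rw [SKT.d_neg, S.closed, neg_zero]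
  have hA := SKT.TTSec.isExact_courant hs hd
  have hc := (SKT.TTSec.courantSplitting hs hd).hasCharacteristicClass_of_isCurvature hA
    (SKT.TTSec.isCurvature_courantSplitting hs hd) hs
  exact ⟨_, hA, hc, SKT.CourantAlgebroid.exists_strongKT hA S hc⟩
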